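/- Let $D\ge 0$, $N\ge 1$, $\varepsilon>0$ and $0=t_0<t_1<\dots<t_N<t_{N+1}=1$. Let $\mathcal P_{2,ac}(\mathbb R^d)$ be the set of absolutely continuous probability measures on $\mathbb R^d$ with finite second moment and finite differential entropy, and let $p_0,p_1\in\mathcal P_{2,ac}(\mathbb R^D)$. Let $\Pi(p_0,p_1)$ be the set of $\pi\in\mathcal P_{2,ac}(\mathbb R^D\times\mathbb R^D)$ with marginals $p_0$ and $p_1$. Let $W^\varepsilon$ be the law on $C([0,1],\mathbb R^D)$ of the process $dx_t=\sqrt\varepsilon\,dW_t$, $x_0\sim p_0$, and let $T^*$ be the Schrödinger Bridge between $p_0$ and $p_1$, i.e. a minimizer of $\mathrm{KL}(T\|W^\varepsilon)$ over all probability measures $T$ on $C([0,1],\mathbb R^D)$ whose marginals at times $0$ and $1$ are $p_0$ and $p_1$. Write $p^{T^*}$ for the joint law of $T^*$ at the times $t_0,\dots,t_{N+1}$, and $p^{T^*}(x_0,x_1)$, $p^{W^\varepsilon}(x_0,x_1)$ for the joint laws of $T^*$, $W^\varepsilon$ at the times $0,1$. Let $$p^{W^\varepsilon}(x_{t_1},\dots,x_{t_N}\mid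 x_0,x_1)=\prod_{n=1}^N \mathcal N\Big(x_{t_n}\,\Big|\,x_{t_{n-1}}+\tfrac{t_n-t_{n-1}}{1-t_{n-1}}(x_1-x_{t_{n-1}}),\ \varepsilon\tfrac{(t_n-t_{n-1})(1-t_n)}{1-t_{n-1}}I\Big)$$ be the density of the discrete Brownian bridge. For an absolutely continuous law $q$ on $\mathbb R^{D\times(N+2)}$, define its reciprocal and Markovian projections as the laws with densities $$[\mathrm{proj}_{\mathcal R}(q)](x_0,\dots,x_1)=p^{W^\varepsilon}(x_{t_1},\dots,x_{t_N}\mid x_0,x_1)\,q(x_0,x_1),\qquad [\mathrm{proj}_{\mathcal M}(q)](x_0,\dots,x_1)=q(x_0)\prod_{n=1}^{N+1}q(x_{t_n}\mid x_{t_{n-1}}).$$ Let $\pi\in\Pi(p_0,p_1)$, let $q^0$ have density $p^{W^\varepsilon}(x_{t_1},\dots,x_{t_N}\mid x_0,x_1)\,\pi(x_0,x_1)$, and put $q^{2l+1}=\mathrm{proj}_{\mathcal M}(q^{2l})$, $q^{2l+2}=\mathrm{proj}_{\mathcal R}(q^{2l+1})$ for $l\ge 0$. **Theorem.** Assume $\mathrm{KL}(q^0\|p^{T^*})<\infty$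 and $\mathrm{KL}(q^l\|q^{l+1})<\infty$ for every $l\ge 0$. Then $$\lim_{l\to\infty}\mathrm{KL}(q^l\|p^{T^*})=0 .$$ Moreover, $p^{T^*}(x_0,x_1)$ solves the static Schrödinger Bridge problem, i.e. it lies in $\Pi(p_0,p_1)$ and minimizes $\mathrm{KL}(\,\cdot\,\|p^{W^\varepsilon}(x_0,x_1))$ over $\Pi(p_0,p_1)$, and $$\lim_{l\to\infty}\mathrm{KL}\big(q^l(x_0,x_1)\,\|\,p^{T^*}(x_0,x_1)\big)=0 .$$ -/

import Mathlib

open MeasureTheory ProbabilityTheory InformationTheory Filter Topology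
open scoped ENNReal NNReal

noncomputable section

namespace DIMF

/-- The `D`-dimensional Euclidean space. -/
abbrev E (D : ℕ) : Type := EuclideanSpace ℝ (Fin D)

/-- The space `C([0, 1], ℝ^D)` of continuous trajectories (topology of uniform convergence). -/
abbrev PathSpace (D : ℕ) : Type := C(unitInterval, E D)

/-- Trajectories carry the Borel sigma-algebra. -/
instance instMeasurableSpacePathSpace (D : ℕ) : MeasurableSpace (PathSpace D) := borel _

instance instBorelSpacePathSpace (D : ℕ) : BorelSpace (PathSpace D) := ⟨rfl⟩

/-- The class `P_{2,ac}`: absolutely continuous probability measures with finite second moment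
and finite (differential) entropy. -/
structure IsP2ac {F : Type*} [NormedAddCommGroup F] [MeasureSpace F] (μ : Measure F) : Prop where
  isProbabilityMeasure : IsProbabilityMeasure μ
  absolutelyContinuous : μ ≪ (volume : Measure F)
  secondMoment : ∫⁻ x, ‖x‖ₑ ^ 2 ∂μ < ∞
  entropy : Integrable (fun x => Real.log (μ.rnDeriv volume x).toReal) μ

/-- The set `Π(p₀, p₁)` of couplings of `p₀` and `p₁` that belong to `P_{2,ac}`. -/
structure IsCoupling {D : ℕ} (p₀ p₁ : Measure (E D)) (π : Measure (E D × E D)) : Prop where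
  isP2ac : IsP2ac π
  fst : π.map Prod.fst = p₀
  snd : π.map Prod.snd = p₁

/-- Density at `x` of the Gaussian distribution `N(m, v I)` on `ℝ^D`, for a variance `v > 0`. -/
def isoGaussianPDF {D : ℕ} (m : E D) (v : ℝ) (x : E D) : ℝ≥0∞ :=
  ∏ j, gaussianPDF (m j) v.toNNReal (x j)

/-- The Gaussian distribution `N(m, v I)` on `ℝ^D`, for a variance `v > 0`. -/
def isoGaussian {D : ℕ} (m : E D) (v : ℝ) : Measure (E D) :=
  (volume : Measure (E D)).withDensity (isoGaussianPDF m v)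

/-- `W` is the law on path space of the Wiener process with volatility `ε` started at `p₀`, i.e. of
the solution of `dx_t = √ε dW_t`, `x_0 ∼ p₀`: the increment over `[s, t]` is independent of the
path up to time `s` and has law `N(0, ε (t - s) I)`. -/
structure IsWienerLaw {D : ℕ} (ε : ℝ) (p₀ : Measure (E D)) (W : Measure (PathSpace D)) :
    Prop where
  isProbabilityMeasure : IsProbabilityMeasure W
  initial : W.map (fun ω => ω 0) = p₀
  increment : ∀ s t : unitInterval, s < t →
    W.map (fun ω => ω t - ω s) = isoGaussian 0 (ε * ((t : ℝ) - (s : ℝ)))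
  independent : ∀ s t : unitInterval, s < t →
    IndepFun (fun (ω : PathSpace D) (u : Set.Iic s) => ω u) (fun ω => ω t - ω s) W

/-- `F(p₀, p₁)`: laws of continuous processes that start at `p₀` and end at `p₁`. -/
structure IsBetween {D : ℕ} (p₀ p₁ : Measure (E D)) (T : Measure (PathSpace D)) : Prop where
  isProbabilityMeasure : IsProbabilityMeasure T
  initial : T.map (fun ω => ω 0) = p₀
  final : T.map (fun ω => ω 1) = p₁

/-- `T` is the Schrödinger Bridge between `p₀` and `p₁` for the prior `W`. -/
structure IsSchrodingerBridge {D : ℕ} (p₀ p₁ : Measure (E D)) (W T : Measure (PathSpace D)) :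
    Prop where
  isBetween : IsBetween p₀ p₁ T
  minimal : ∀ T' : Measure (PathSpace D), IsBetween p₀ p₁ T' → klDiv T W ≤ klDiv T' W

/-- `π` solves the static Schrödinger Bridge problem between `p₀` and `p₁` for the prior `R`. -/
structure IsStaticSchrodingerBridge {D : ℕ} (p₀ p₁ : Measure (E D)) (R π : Measure (E D × E D)) :
    Prop where
  isCoupling : IsCoupling p₀ p₁ π
  minimal : ∀ π' : Measure (E D × E D), IsCoupling p₀ p₁ π' → klDiv π R ≤ klDiv π' R

/-- The finite-dimensional projection of a process to the times `t`. -/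
def discretize {D n : ℕ} (t : Fin n → unitInterval) (T : Measure (PathSpace D)) :
    Measure (Fin n → E D) :=
  T.map (fun ω i => ω (t i))

/-- The joint marginal of a continuous process at the times `0` and `1`. -/
def pathEndpoints {D : ℕ} (T : Measure (PathSpace D)) : Measure (E D × E D) :=
  T.map (fun ω => (ω 0, ω 1))

/-- The joint marginal `q(x_0, x_1)` of a discrete process at the first and the last time. -/
def endpoints {D N : ℕ} (q : Measure (Fin (N + 2) → E D)) : Measure (E D × E D) :=
  q.map (fun x => (x 0, x (Fin.last (N + 1))))

/-- The density `p^{W^ε}(x_{t_1}, …, x_{t_N} | x_0, x_1)` of the discrete Brownian bridge: the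
product over `n = 1, …, N` of the Gaussian densities of `x_{t_n}` given `x_{t_{n-1}}` and `x_1`.
The factor with index `i : Fin N` is the one for `n = i + 1`. -/
def bridgePDF {D N : ℕ} (ε : ℝ) (t : Fin (N + 2) → unitInterval) (x : Fin (N + 2) → E D) :
    ℝ≥0∞ :=
  ∏ i : Fin N,
    let s : ℝ := t i.castSucc.castSucc
    let u : ℝ := t i.succ.castSucc
    let y : E D := x i.castSucc.castSucc
    isoGaussianPDF (y + ((u - s) / (1 - s)) • (x (Fin.last (N + 1)) - y))
      (ε * ((u - s) * (1 - u) / (1 - s))) (x i.succ.castSucc)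

/-- The mixture of discrete Brownian bridges `p^{W^ε}(x_in | x_0, x_1) π(x_0, x_1)`, for an
absolutely continuous `π`. -/
def bridgeMixture {D N : ℕ} (ε : ℝ) (t : Fin (N + 2) → unitInterval) (π : Measure (E D × E D)) :
    Measure (Fin (N + 2) → E D) :=
  (volume : Measure (Fin (N + 2) → E D)).withDensity fun x =>
    bridgePDF ε t x * π.rnDeriv volume (x 0, x (Fin.last (N + 1)))

/-- The discrete reciprocal projection. -/
def projR {D N : ℕ} (ε : ℝ) (t : Fin (N + 2) → unitInterval) (q : Measure (Fin (N + 2) → E D)) :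
    Measure (Fin (N + 2) → E D) :=
  bridgeMixture ε t (endpoints q)

/-- The marginal density `q(x_i)` of a discrete process. -/
def marginalPDF {D n : ℕ} (q : Measure (Fin n → E D)) (i : Fin n) (a : E D) : ℝ≥0∞ :=
  (q.map (fun x => x i)).rnDeriv volume a

/-- The transition density `q(x_j = b | x_i = a) = q(x_i = a, x_j = b) / q(x_i = a)`. -/
def transitionPDF {D n : ℕ} (q : Measure (Fin n → E D)) (i j : Fin n) (a b : E D) : ℝ≥0∞ :=
  (q.map (fun x => (x i, x j))).rnDeriv volume (a, b) / marginalPDF q i a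

/-- The discrete Markovian projection, with density `q(x_0) ∏_{n=1}^{N+1} q(x_{t_n}|x_{t_{n-1}})`. -/
def projM {D N : ℕ} (q : Measure (Fin (N + 2) → E D)) : Measure (Fin (N + 2) → E D) :=
  (volume : Measure (Fin (N + 2) → E D)).withDensity fun x =>
    marginalPDF q 0 (x 0) *
      ∏ i : Fin (N + 1), transitionPDF q i.castSucc i.succ (x i.castSucc) (x i.succ)

/-- The D-IMF sequence started at the bridge mixture of `π`: `q^{2l+1}` is the Markovian projection
of `q^{2l}` and `q^{2l+2}` is the reciprocal projection of `q^{2l+1}`. -/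
def dimf {D N : ℕ} (ε : ℝ) (t : Fin (N + 2) → unitInterval) (π : Measure (E D × E D)) :
    ℕ → Measure (Fin (N + 2) → E D)
  | 0 => bridgeMixture ε t π
  | l + 1 => if Even l then projM (dimf ε t π l) else projR ε t (dimf ε t π l)

end DIMF

end

set_option linter.unusedSectionVars false

/-! Write `p` for `discretize t Tstar`. Both projections are orthogonal for the divergence: if `q'`
is the projection of `q` and `p` is a fixed point, then `klDiv q p = klDiv q q' + klDiv q' p`
(`klDiv_eq_add_lift`, `klDiv_eq_add_projM`). In each case the log-density of `q'` with respect to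
`p` is built from marginals that `q` and `q'` share, so it has the same integral under both. The
reciprocal projection is an instance of `lift`: keep the conditional law given the endpoints and
replace the law of the endpoints. That `p` is fixed by both projections comes from minimality: with
the Wiener law as reference, the same identities make each projection of `p` a competitor with the
same end marginals, strictly better unless it equals `p` (`eq_of_klDiv_eq_add`).

Hence the divergence of the iterates to `p` decreases, and its decrements, the divergences between
successive iterates, tend to zero. It remains to see that the limit is zero, and by monotonicity a
subsequence suffices. The even iterates are bridge mixtures of couplings `πl` of `p₀` and `p₁` that
become asymptotically Markovian. Both properties survive restriction to the times `0`, `t 1`, `1`,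
where a bridge mixture is the Gaussian mixture `mix3`.

Identification of the limit. At three times, with the middle point frozen, a Markovian density is a
function of the first endpoint times a function of the last. The Gaussian law of the middle point is
positive, so freezing is legitimate, and the density of `πl` with respect to the endpoint law `π` of
the bridge is asymptotically a product `u(x) v(y)`. Since both marginals are prescribed, the product
must tend to `1` (`exists_subseq_rnDeriv_tendsto_one`): the test function `cayley u + cayley v` does
not distinguish `πl` from `π`, yet has the sign of `u v - 1`.

From densities to divergences. Almost everywhere convergence of densities does not bound the
divergence, since entropy could escape. The identity at three times writes `klDiv (πl l) π` as a
defect of Markovianity, which tends to zero, plus the divergence of the Markovian projection, which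
is at most the sum of the divergences of the two consecutive pairs (`klDiv_projM_le`). In a pair one
endpoint has been averaged against a Gaussian, so its log-ratio is bounded above by a function of
second moments whose integral is fixed by `p₀` and `p₁` (`log_gaussian_mixture_div_le`). Fatou's
lemma then sends these divergences to zero (`exists_subseq_klDiv_gaussMix`).

For the static problem, passing to endpoints does not increase the divergence, while lifting a
coupling to path space along the Wiener law preserves it. -/

namespace DIMF

/-! ### Divergence, and replacing a marginal while keeping the conditional law -/

section KullbackLeibler

variable {Ω Z : Type*} [MeasurableSpace Ω] [MeasurableSpace Z]

/-- Pythagorean identity for the Kullback-Leibler divergence. -/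
lemma klDiv_eq_add_of_integral_eq {q q' p : Measure Ω} [IsProbabilityMeasure q]
    [IsProbabilityMeasure q'] [IsProbabilityMeasure p] (hqq' : q ≪ q') (hq'p : q' ≪ p)
    (hi : Integrable (llr q' p) q) (hi' : Integrable (llr q' p) q')
    (he : ∫ x, llr q' p x ∂q = ∫ x, llr q' p x ∂q') :
    klDiv q p = klDiv q q' + klDiv q' p := by
  have hqp := hqq'.trans hq'p
  -- Chain rule for densities, in logarithmic form; all factors are positive and finite `q`-a.e.
  have hsum : llr q p =ᵐ[q] fun x => llr q q' x + llr q' p x := by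
    filter_upwards [hqp.ae_le (Measure.rnDeriv_mul_rnDeriv (κ := p) hqq'), Measure.rnDeriv_pos hqq',
      hqq'.ae_le (Measure.rnDeriv_pos hq'p), hqp.ae_le (Measure.rnDeriv_ne_top q' p),
      hqq'.ae_le (Measure.rnDeriv_ne_top q q')] with x h1 h2 h3 h4 h5
    simp only [llr]
    rw [← h1, Pi.mul_apply, ENNReal.toReal_mul, Real.log_mul]
    · exact (ENNReal.toReal_pos h2.ne' h5).ne'
    · exact (ENNReal.toReal_pos h3.ne' h4).ne'
  by_cases hint : Integrable (llr q q') q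
  · have hint2 : Integrable (llr q p) q := (hint.add hi).congr hsum.symm
    have e1 := toReal_klDiv_of_measure_eq hqp (by simp)
    have e2 := toReal_klDiv_of_measure_eq hqq' (by simp)
    have e3 := toReal_klDiv_of_measure_eq hq'p (by simp)
    rw [integral_congr_ae hsum, integral_add hint hi, he, ← e2, ← e3] at e1
    rw [← ENNReal.ofReal_toReal (klDiv_ne_top hqp hint2), e1,
      ENNReal.ofReal_add ENNReal.toReal_nonneg ENNReal.toReal_nonneg,
      ENNReal.ofReal_toReal (klDiv_ne_top hqq' hint),
      ENNReal.ofReal_toReal (klDiv_ne_top hq'p hi')]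
  -- Both sides are infinite here: integrability of `llr q p` would give that of `llr q q'` after
  -- subtracting `hi`.
  · rw [klDiv_of_not_integrable hint, klDiv_of_not_integrable, top_add]
    intro h
    refine hint ((h.sub hi).congr ?_)
    filter_upwards [hsum] with x hx
    simp [hx]

lemma ac_of_klDiv_lt_top {μ ν : Measure Ω} (h : klDiv μ ν < ∞) : μ ≪ ν :=
  (klDiv_ne_top_iff.1 h.ne).1

lemma integrable_llr_of_klDiv_lt_top {μ ν : Measure Ω} (h : klDiv μ ν < ∞) :
    Integrable (llr μ ν) μ :=
  (klDiv_ne_top_iff.1 h.ne).2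

/-- The measure whose `f`-marginal is `ν` and whose conditional law given `f` is that of `μ`. -/
noncomputable def lift (μ : Measure Ω) (f : Ω → Z) (ν : Measure Z) : Measure Ω :=
  μ.withDensity fun ω => ν.rnDeriv (μ.map f) (f ω)

variable {μ : Measure Ω} {f : Ω → Z} {ν : Measure Z}

lemma lift_ac : lift μ f ν ≪ μ := withDensity_absolutelyContinuous _ _

lemma map_lift [IsFiniteMeasure μ] [IsFiniteMeasure ν] (hf : Measurable f) (hν : ν ≪ μ.map f) :
    (lift μ f ν).map f = ν := by
  ext s hs
  rw [Measure.map_apply hf hs, lift, withDensity_apply _ (hf hs),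
    ← setLIntegral_map hs (Measure.measurable_rnDeriv _ _) hf, Measure.setLIntegral_rnDeriv hν]

lemma isProbabilityMeasure_lift [IsFiniteMeasure μ] [IsProbabilityMeasure ν] (hf : Measurable f)
    (hν : ν ≪ μ.map f) : IsProbabilityMeasure (lift μ f ν) := by
  constructor
  rw [← Set.preimage_univ (f := f), ← Measure.map_apply hf .univ, map_lift hf hν, measure_univ]

lemma rnDeriv_lift [SigmaFinite μ] (hf : Measurable f) :
    (lift μ f ν).rnDeriv μ =ᵐ[μ] fun ω => ν.rnDeriv (μ.map f) (f ω) :=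
  Measure.rnDeriv_withDensity _ ((Measure.measurable_rnDeriv _ _).comp hf)

lemma llr_lift [SigmaFinite μ] (hf : Measurable f) :
    llr (lift μ f ν) μ =ᵐ[μ] fun ω => llr ν (μ.map f) (f ω) := by
  filter_upwards [rnDeriv_lift (ν := ν) hf] with ω h
  simp [llr, h]

/-- The density of the lift depends on the point only through `f`, so the entropy integral is one
over the image. Lifting is therefore free, which turns marginal problems into problems on the full
space. -/
lemma klDiv_lift [IsFiniteMeasure μ] [IsProbabilityMeasure ν] (hf : Measurable f)
    (hν : ν ≪ μ.map f) : klDiv (lift μ f ν) μ = klDiv ν (μ.map f) := by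
  have := isProbabilityMeasure_lift hf hν
  rw [klDiv_eq_lintegral_klFun_of_ac lift_ac, klDiv_eq_lintegral_klFun_of_ac hν,
    lintegral_map (by fun_prop) hf]
  refine lintegral_congr_ae ?_
  filter_upwards [rnDeriv_lift (ν := ν) hf] with ω h
  rw [h]

/-- Only the conditional law given `f` matters, and a lift has the same one. This later allows the
Wiener law to be exchanged for the Schrödinger bridge as reference. -/
lemma lift_lift [IsFiniteMeasure μ] [IsProbabilityMeasure ν] {ν' : Measure Z}
    [IsFiniteMeasure ν'] (hf : Measurable f) (hν : ν ≪ μ.map f) (hν' : ν' ≪ ν) :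
    lift (lift μ f ν) f ν' = lift μ f ν' := by
  rw [lift, map_lift hf hν, lift, lift, ← withDensity_mul₀ (by fun_prop) (by fun_prop)]
  refine withDensity_congr_ae ?_
  filter_upwards [ae_of_ae_map hf.aemeasurable
    (Measure.rnDeriv_mul_rnDeriv (κ := μ.map f) hν')] with ω h
  rw [← h, mul_comm]
  rfl

/-- The density of the lift is that of the `f`-marginal of `q`, and this is positive `q`-a.e. -/
lemma ac_lift_map {q : Measure Ω} [IsFiniteMeasure μ] [IsFiniteMeasure q] (hf : Measurable f)
    (hq : q ≪ μ) : q ≪ lift μ f (q.map f) := by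
  refine Measure.AbsolutelyContinuous.mk fun s hs h0 => ?_
  rw [lift, withDensity_apply_eq_zero' (by fun_prop)] at h0
  have hpos := ae_of_ae_map hf.aemeasurable (Measure.rnDeriv_pos (hq.map hf))
  rw [ae_iff] at hpos
  refine measure_mono_null ?_ (measure_union_null hpos (hq h0))
  intro x hx
  by_cases h : (q.map f).rnDeriv (μ.map f) (f x) = 0
  · left; simp [h]
  · right; exact ⟨h, hx⟩

/-- Pythagorean identity for the projection on a marginal. -/
lemma klDiv_eq_add_lift {q : Measure Ω} [IsProbabilityMeasure μ] [IsProbabilityMeasure q]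
    (hf : Measurable f) (hq : klDiv q μ < ∞) :
    klDiv q μ = klDiv q (lift μ f (q.map f)) + klDiv (lift μ f (q.map f)) μ := by
  have hac := ac_of_klDiv_lt_top hq
  have hac' := hac.map hf
  have : IsProbabilityMeasure (q.map f) := Measure.isProbabilityMeasure_map hf.aemeasurable
  have := isProbabilityMeasure_lift hf hac'
  have h1 := ac_lift_map (f := f) hf hac
  have hl := llr_lift (μ := μ) (ν := q.map f) hf
  have hi : Integrable (llr (q.map f) (μ.map f)) (q.map f) :=
    integrable_llr_of_klDiv_lt_top ((klDiv_map_le _ _ hf).trans_lt hq)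
  have hm := map_lift (μ := μ) hf hac'
  refine klDiv_eq_add_of_integral_eq h1 lift_ac ?_ ?_ ?_
  · exact (hi.comp_measurable hf).congr (hac.ae_le hl.symm)
  · have hi2 := hi
    rw [← hm] at hi2
    nth_rw 1 [hm] at hi2
    exact (hi2.comp_measurable hf).congr (lift_ac.ae_le hl.symm)
  -- The log-density factors through `f`, and `q` and the lift have the same image under `f`.
  · rw [integral_congr_ae (hac.ae_le hl), integral_congr_ae (lift_ac.ae_le hl),
      ← integral_map (φ := f) (μ := q) hf.aemeasurable (measurable_llr _ _).aestronglyMeasurable,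
      ← integral_map (φ := f) (μ := lift μ f (q.map f)) hf.aemeasurable
        (measurable_llr _ _).aestronglyMeasurable, hm]

end KullbackLeibler

/-! ### Markov chain densities and their marginals -/

section Chain

variable {X Y : Type*} [MeasurableSpace X] [MeasurableSpace Y]

lemma map_fst_withDensity_prod {μ : Measure X} {ν : Measure Y} [SFinite μ] [SFinite ν]
    {f : X × Y → ℝ≥0∞} (hf : Measurable f) :
    ((μ.prod ν).withDensity f).map Prod.fst = μ.withDensity fun a => ∫⁻ b, f (a, b) ∂ν := by
  ext s hs
  rw [Measure.map_apply measurable_fst hs, withDensity_apply _ (measurable_fst hs),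
    withDensity_apply _ hs, ← Set.prod_univ, ← Measure.prod_restrict, lintegral_prod _ (by fun_prop),
    Measure.restrict_univ]

lemma map_snd_withDensity_prod {μ : Measure X} {ν : Measure Y} [SFinite μ] [SFinite ν]
    {f : X × Y → ℝ≥0∞} (hf : Measurable f) :
    ((μ.prod ν).withDensity f).map Prod.snd = ν.withDensity fun b => ∫⁻ a, f (a, b) ∂μ := by
  ext s hs
  rw [Measure.map_apply measurable_snd hs, withDensity_apply _ (measurable_snd hs),
    withDensity_apply _ hs, ← Set.univ_prod, ← Measure.prod_restrict,
    lintegral_prod_symm _ (by fun_prop), Measure.restrict_univ]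

lemma rnDeriv_map_fst {μ : Measure X} {ν : Measure Y} [SigmaFinite μ] [SigmaFinite ν]
    {P : Measure (X × Y)} [IsFiniteMeasure P] (hP : P ≪ μ.prod ν) :
    (P.map Prod.fst).rnDeriv μ =ᵐ[μ] fun a => ∫⁻ b, P.rnDeriv (μ.prod ν) (a, b) ∂ν := by
  conv_lhs => rw [← Measure.withDensity_rnDeriv_eq P _ hP,
    map_fst_withDensity_prod (Measure.measurable_rnDeriv _ _)]
  exact Measure.rnDeriv_withDensity _ (Measure.measurable_rnDeriv _ _).lintegral_prod_right'

lemma rnDeriv_map_snd {μ : Measure X} {ν : Measure Y} [SigmaFinite μ] [SigmaFinite ν]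
    {P : Measure (X × Y)} [IsFiniteMeasure P] (hP : P ≪ μ.prod ν) :
    (P.map Prod.snd).rnDeriv ν =ᵐ[ν] fun b => ∫⁻ a, P.rnDeriv (μ.prod ν) (a, b) ∂μ := by
  conv_lhs => rw [← Measure.withDensity_rnDeriv_eq P _ hP,
    map_snd_withDensity_prod (Measure.measurable_rnDeriv _ _)]
  exact Measure.rnDeriv_withDensity _ (Measure.measurable_rnDeriv _ _).lintegral_prod_left'

variable {F : Type*} [MeasureSpace F] [SigmaFinite (volume : Measure F)]

/-- Two distinct coordinates send null sets back to null sets. -/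
lemma quasiMeasurePreserving_pair {n : ℕ} {i j : Fin n} (hij : i ≠ j) :
    Measure.QuasiMeasurePreserving (fun x : Fin n → F => (x i, x j)) volume volume := by
  obtain _ | n := n
  · exact i.elim0
  obtain ⟨k, rfl⟩ := Fin.exists_succAbove_eq hij.symm
  have h1 : Measure.QuasiMeasurePreserving (fun z : F × (Fin n → F) => (z.1, z.2 k)) volume
      volume :=
    MeasureTheory.QuasiMeasurePreserving.prodMap (Measure.QuasiMeasurePreserving.id volume)
      (Measure.quasiMeasurePreserving_eval (fun _ : Fin n => (volume : Measure F)) k)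
  exact h1.comp
    (volume_preserving_piFinSuccAbove (fun _ : Fin (n + 1) => F) i).quasiMeasurePreserving

lemma quasiMeasurePreserving_coord {n : ℕ} (i : Fin n) :
    Measure.QuasiMeasurePreserving (fun x : Fin n → F => x i) volume volume :=
  Measure.quasiMeasurePreserving_eval (fun _ : Fin n => (volume : Measure F)) i

lemma map_ac_of_quasi {g : X → Y} {μ q : Measure X} {ν : Measure Y}
    (hg : Measure.QuasiMeasurePreserving g μ ν) (hq : q ≪ μ) : q.map g ≪ ν :=
  (hq.map hg.measurable).trans hg.absolutelyContinuous

/-- The density of a Markov chain with initial density `m₀` and transition densities `k`. -/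
noncomputable def chainPDF {n : ℕ} (m₀ : F → ℝ≥0∞) (k : Fin n → F → F → ℝ≥0∞)
    (x : Fin (n + 1) → F) : ℝ≥0∞ :=
  m₀ (x 0) * ∏ i, k i (x i.castSucc) (x i.succ)

lemma measurable_chainPDF {n : ℕ} {m₀ : F → ℝ≥0∞} {k : Fin n → F → F → ℝ≥0∞}
    (hm₀ : Measurable m₀) (hk : ∀ i, Measurable fun z : F × F => k i z.1 z.2) :
    Measurable (chainPDF m₀ k) := by
  refine (hm₀.comp (measurable_pi_apply 0)).mul (Finset.measurable_prod _ fun i _ => ?_)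
  exact Measurable.comp (g := fun z : F × F => k i z.1 z.2) (hk i)
    (f := fun x : Fin (n + 1) → F => (x i.castSucc, x i.succ)) (by fun_prop)

lemma lintegral_snoc {n : ℕ} {G : (Fin (n + 1) → F) → ℝ≥0∞} (hG : Measurable G) :
    ∫⁻ x, G x = ∫⁻ z : Fin n → F, ∫⁻ b : F, G (Fin.snoc z b) := by
  have h := (volume_preserving_piFinSuccAbove (fun _ : Fin (n + 1) => F) (Fin.last n)).symm
  rw [← h.lintegral_comp hG]
  change ∫⁻ z : F × (Fin n → F), _ ∂(volume.prod volume) = _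
  refine (lintegral_prod_symm _ (hG.comp h.measurable).aemeasurable).trans ?_
  refine lintegral_congr fun z => lintegral_congr fun b => ?_
  exact congrArg G (Fin.insertNth_last' b z)

lemma measurable_snoc {n : ℕ} : Measurable fun z : (Fin n → F) × F =>
    (Fin.snoc z.1 z.2 : Fin (n + 1) → F) := by
  have h := (MeasurableEquiv.piFinSuccAbove (fun _ : Fin (n + 1) => F) (Fin.last n)).symm.measurable
  have e : (fun z : (Fin n → F) × F => (Fin.snoc z.1 z.2 : Fin (n + 1) → F)) =
      fun z => (MeasurableEquiv.piFinSuccAbove (fun _ : Fin (n + 1) => F) (Fin.last n)).symm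
        (z.2, z.1) :=
    funext fun z => (Fin.insertNth_last' z.2 z.1).symm
  rw [e]
  exact h.comp (measurable_snd.prodMk measurable_fst)

lemma chainPDF_snoc {n : ℕ} (m₀ : F → ℝ≥0∞) (k : Fin (n + 1) → F → F → ℝ≥0∞)
    (z : Fin (n + 1) → F) (b : F) :
    chainPDF m₀ k (Fin.snoc z b : Fin (n + 2) → F) =
      chainPDF m₀ (fun i => k i.castSucc) z * k (Fin.last n) (z (Fin.last n)) b := by
  have h0 : (Fin.snoc z b : Fin (n + 2) → F) 0 = z 0 := by
    rw [← Fin.castSucc_zero]; exact Fin.snoc_castSucc (α := fun _ => F) b z 0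
  have hc (i : Fin (n + 1)) : (Fin.snoc z b : Fin (n + 2) → F) i.castSucc = z i :=
    Fin.snoc_castSucc (α := fun _ => F) b z i
  have hl : (Fin.snoc z b : Fin (n + 2) → F) (Fin.last (n + 1)) = b :=
    Fin.snoc_last (α := fun _ => F) b z
  rw [chainPDF, chainPDF, Fin.prod_univ_castSucc, h0, ← mul_assoc]
  simp only [Fin.succ_last, hl, hc, Fin.succ_castSucc]

/-- Splitting off the last transition is the induction step both for the marginals of a chain and
for the finite-dimensional laws of the Wiener process. -/
lemma lintegral_chain_snoc {n : ℕ} {m₀ : F → ℝ≥0∞} {k : Fin (n + 1) → F → F → ℝ≥0∞}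
    (hm₀ : Measurable m₀) (hk : ∀ i, Measurable fun z : F × F => k i z.1 z.2)
    {G : (Fin (n + 2) → F) → ℝ≥0∞} (hG : Measurable G) :
    ∫⁻ x, G x ∂(volume.withDensity (chainPDF m₀ k)) =
      ∫⁻ z, ∫⁻ b, k (Fin.last n) (z (Fin.last n)) b * G (Fin.snoc z b)
        ∂volume ∂(volume.withDensity (chainPDF m₀ fun i => k i.castSucc)) := by
  have hmeas : Measurable fun z : (Fin (n + 1) → F) × F =>
      k (Fin.last n) (z.1 (Fin.last n)) z.2 * G (Fin.snoc z.1 z.2) :=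
    (Measurable.comp (g := fun z : F × F => k (Fin.last n) z.1 z.2) (hk _)
      (f := fun z : (Fin (n + 1) → F) × F => (z.1 (Fin.last n), z.2)) (by fun_prop)).mul
      (hG.comp measurable_snoc)
  have hc := measurable_chainPDF hm₀ hk
  have hc' := measurable_chainPDF (n := n) hm₀ fun i => hk i.castSucc
  rw [lintegral_withDensity_eq_lintegral_mul _ hc hG, lintegral_snoc (hc.mul hG),
    lintegral_withDensity_eq_lintegral_mul _ hc' hmeas.lintegral_prod_right']
  refine lintegral_congr fun z => ?_
  refine Eq.trans ?_ (lintegral_const_mul _ (hmeas.comp (measurable_prodMk_left (x := z))))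
  refine lintegral_congr fun b => ?_
  rw [Pi.mul_apply, chainPDF_snoc, mul_assoc]

/-- Marginals of a Markov chain. -/
lemma map_chain {n : ℕ} {m : Fin (n + 1) → F → ℝ≥0∞} {k : Fin n → F → F → ℝ≥0∞}
    (hm : ∀ i, Measurable (m i)) (hk : ∀ i, Measurable fun z : F × F => k i z.1 z.2)
    (h1 : ∀ i : Fin n, ∀ᵐ a, m i.castSucc a ≠ 0 → ∫⁻ b, k i a b = 1)
    (h2 : ∀ i : Fin n, ∀ᵐ b, ∫⁻ a, m i.castSucc a * k i a b = m i.succ b) :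
    (∀ i, (volume.withDensity (chainPDF (m 0) k)).map (fun x => x i) =
      volume.withDensity (m i)) ∧
    ∀ i : Fin n, (volume.withDensity (chainPDF (m 0) k)).map
      (fun x => (x i.castSucc, x i.succ)) =
        volume.withDensity fun z => m i.castSucc z.1 * k i z.1 z.2 := by
  induction n with
  | zero =>
    refine ⟨fun i => ?_, fun i => i.elim0⟩
    obtain rfl : i = 0 := Subsingleton.elim (α := Fin 1) i 0
    have h := volume_preserving_funUnique (Fin 1) F
    have he : (volume : Measure (Fin 1 → F)).withDensity (chainPDF (m 0) k) =
        volume.withDensity fun x => m 0 (MeasurableEquiv.funUnique (Fin 1) F x) := by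
      congr 1
      ext x
      simp [chainPDF]
    rw [he]
    ext s hs
    have h0 : Measurable fun x : Fin 1 → F => x 0 := by fun_prop
    rw [Measure.map_apply h0 hs, withDensity_apply _ (h0 hs), withDensity_apply _ hs]
    exact h.setLIntegral_comp_preimage hs (hm 0)
  | succ n ih =>
    obtain ⟨ihs, ihp⟩ := ih (m := fun i => m i.castSucc) (k := fun i => k i.castSucc)
      (fun i => hm _) (fun i => hk _) (fun i => h1 i.castSucc)
      (fun i => h2 i.castSucc)
    simp only [Fin.castSucc_zero] at ihs ihp
    set C := (volume : Measure (Fin (n + 2) → F)).withDensity (chainPDF (m 0) k) with hC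
    set C' := (volume : Measure (Fin (n + 1) → F)).withDensity
      (chainPDF (m 0) fun i => k i.castSucc) with hC'
    have hmi : Measurable (Fin.init : (Fin (n + 2) → F) → Fin (n + 1) → F) :=
      measurable_pi_lambda _ fun i => measurable_pi_apply _
    -- Forgetting the last coordinate leaves the shorter chain, because the last transition has mass
    -- one.
    have hinit : C.map Fin.init = C' := by
      refine Measure.ext_of_lintegral _ fun G hG => ?_
      rw [lintegral_map hG hmi, hC]
      refine (lintegral_chain_snoc (hm 0) hk (hG.comp hmi)).trans ?_
      -- Normalization is assumed only where the marginal density is nonzero; the induction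
      -- hypothesis says that this density is the law of the last state of `C'`, so the condition
      -- holds almost surely.
      have hae : ∀ᵐ z ∂C', ∫⁻ b, k (Fin.last n) (z (Fin.last n)) b = 1 := by
        have : ∀ᵐ a ∂(C'.map fun x => x (Fin.last n)), ∫⁻ b, k (Fin.last n) a b = 1 := by
          rw [ihs, ae_withDensity_iff (hm _)]
          exact h1 (Fin.last n)
        exact ae_of_ae_map (measurable_pi_apply _).aemeasurable this
      refine lintegral_congr_ae ?_
      filter_upwards [hae] with z hz
      have hkz : Measurable (k (Fin.last n) (z (Fin.last n))) :=
        (hk (Fin.last n)).comp measurable_prodMk_left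
      have (b : F) : Fin.init (Fin.snoc z b : Fin (n + 2) → F) = z :=
        Fin.init_snoc (α := fun _ => F) b z
      simp only [Function.comp_apply, this]
      rw [lintegral_mul_const _ hkz, hz, one_mul]
    have hlast : C.map (fun x => (x (Fin.last n).castSucc, x (Fin.last n).succ)) =
        volume.withDensity fun z => m (Fin.last n).castSucc z.1 * k (Fin.last n) z.1 z.2 := by
      have hmp : Measurable fun x : Fin (n + 2) → F =>
          (x (Fin.last n).castSucc, x (Fin.last n).succ) :=
        (measurable_pi_apply _).prodMk (measurable_pi_apply _)
      refine Measure.ext_of_lintegral _ fun G hG => ?_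
      rw [lintegral_map hG hmp, hC]
      refine (lintegral_chain_snoc (hm 0) hk (hG.comp hmp)).trans ?_
      have e (z : Fin (n + 1) → F) (b : F) :
          ((Fin.snoc z b : Fin (n + 2) → F) (Fin.last n).castSucc,
            (Fin.snoc z b : Fin (n + 2) → F) (Fin.last n).succ) = (z (Fin.last n), b) := by
        rw [Fin.succ_last, Fin.snoc_last (α := fun _ => F), Fin.snoc_castSucc (α := fun _ => F)]
      simp only [Function.comp_apply, e]
      have hmeas : Measurable fun z : F × F => k (Fin.last n) z.1 z.2 * G (z.1, z.2) :=
        (hk _).mul hG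
      have hmeas2 : Measurable fun z : F × F => m (Fin.last n).castSucc z.1 * k (Fin.last n) z.1 z.2 :=
        ((hm _).comp measurable_fst).mul (hk _)
      change ∫⁻ z, (fun a => ∫⁻ b, k (Fin.last n) a b * G (a, b)) (z (Fin.last n)) ∂C' = _
      rw [← lintegral_map hmeas.lintegral_prod_right' (measurable_pi_apply _), ihs,
        lintegral_withDensity_eq_lintegral_mul _ (hm _) hmeas.lintegral_prod_right',
        lintegral_withDensity_eq_lintegral_mul _ hmeas2 hG, Measure.volume_eq_prod,
        lintegral_prod _ (hmeas2.mul hG).aemeasurable]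
      refine lintegral_congr fun a => ?_
      refine (lintegral_const_mul _ (hmeas.comp (measurable_prodMk_left (x := a)))).symm.trans ?_
      refine lintegral_congr fun b => ?_
      simp [mul_assoc]
    refine ⟨fun i => ?_, fun i => ?_⟩
    · induction i using Fin.lastCases with
      | last =>
        have : C.map (fun x => x (Fin.last (n + 1))) =
            (C.map (fun x => (x (Fin.last n).castSucc, x (Fin.last n).succ))).map Prod.snd := by
          rw [Measure.map_map measurable_snd (by fun_prop)]
          rfl
        rw [this, hlast, Measure.volume_eq_prod]
        refine (map_snd_withDensity_prod (((hm _).comp measurable_fst).mul (hk _))).trans ?_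
        exact withDensity_congr_ae (h2 (Fin.last n))
      | cast i =>
        rw [← ihs i, ← hinit, Measure.map_map (by fun_prop) hmi]
        rfl
    · induction i using Fin.lastCases with
      | last => exact hlast
      | cast i =>
        rw [← ihp i, ← hinit, Measure.map_map (by fun_prop) hmi]
        rfl

end Chain

/-! ### The Markovian projection and its Pythagorean identity -/

section MarkovProjection

variable {D N n : ℕ}

/-- The joint law of the coordinates `i` and `j`. -/
noncomputable def pairLaw (q : Measure (Fin n → E D)) (i j : Fin n) : Measure (E D × E D) :=
  q.map fun x => (x i, x j)

/-- The law of the coordinate `i`. -/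
noncomputable def coordLaw (q : Measure (Fin n → E D)) (i : Fin n) : Measure (E D) :=
  q.map fun x => x i

lemma coordLaw_eq_fst (q : Measure (Fin n → E D)) (i j : Fin n) :
    coordLaw q i = (pairLaw q i j).map Prod.fst := by
  rw [pairLaw, Measure.map_map measurable_fst (by fun_prop)]
  rfl

lemma coordLaw_eq_snd (q : Measure (Fin n → E D)) (i j : Fin n) :
    coordLaw q j = (pairLaw q i j).map Prod.snd := by
  rw [pairLaw, Measure.map_map measurable_snd (by fun_prop)]
  rfl

instance (q : Measure (Fin n → E D)) [IsFiniteMeasure q] (i j : Fin n) :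
    IsFiniteMeasure (pairLaw q i j) := by
  unfold pairLaw; infer_instance

instance (q : Measure (Fin n → E D)) [IsFiniteMeasure q] (i : Fin n) :
    IsFiniteMeasure (coordLaw q i) := by
  unfold coordLaw; infer_instance

instance (q : Measure (Fin n → E D)) [IsProbabilityMeasure q] (i j : Fin n) :
    IsProbabilityMeasure (pairLaw q i j) :=
  Measure.isProbabilityMeasure_map (by fun_prop)

instance (q : Measure (Fin n → E D)) [IsProbabilityMeasure q] (i : Fin n) :
    IsProbabilityMeasure (coordLaw q i) :=
  Measure.isProbabilityMeasure_map (measurable_pi_apply i).aemeasurable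

lemma pairLaw_ac {q : Measure (Fin n → E D)} (hq : q ≪ volume) {i j : Fin n} (hij : i ≠ j) :
    pairLaw q i j ≪ volume :=
  map_ac_of_quasi (quasiMeasurePreserving_pair hij) hq

lemma coordLaw_ac {q : Measure (Fin n → E D)} (hq : q ≪ volume) (i : Fin n) :
    coordLaw q i ≪ volume :=
  map_ac_of_quasi (quasiMeasurePreserving_coord i) hq

/-- The joint density of the coordinates `i` and `j`. -/
noncomputable def pairPDF (q : Measure (Fin n → E D)) (i j : Fin n) : E D × E D → ℝ≥0∞ :=
  (pairLaw q i j).rnDeriv volume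

lemma measurable_pairPDF (q : Measure (Fin n → E D)) (i j : Fin n) :
    Measurable (pairPDF q i j) := Measure.measurable_rnDeriv _ _

lemma measurable_marginalPDF (q : Measure (Fin n → E D)) (i : Fin n) :
    Measurable (marginalPDF q i) := Measure.measurable_rnDeriv _ _

lemma measurable_transitionPDF (q : Measure (Fin n → E D)) (i j : Fin n) :
    Measurable fun z : E D × E D => transitionPDF q i j z.1 z.2 :=
  (measurable_pairPDF q i j).div ((measurable_marginalPDF q i).comp measurable_fst)

lemma transitionPDF_eq (q : Measure (Fin n → E D)) (i j : Fin n) (a b : E D) :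
    transitionPDF q i j a b = pairPDF q i j (a, b) / marginalPDF q i a := rfl

variable {q : Measure (Fin n → E D)} [IsProbabilityMeasure q]

lemma marginalPDF_eq_left (hq : q ≪ volume) {i j : Fin n} (hij : i ≠ j) :
    ∀ᵐ a, marginalPDF q i a = ∫⁻ b, pairPDF q i j (a, b) := by
  have h := rnDeriv_map_fst (μ := (volume : Measure (E D))) (ν := (volume : Measure (E D)))
    (pairLaw_ac hq hij)
  rw [← coordLaw_eq_fst] at h
  exact h

lemma marginalPDF_eq_right (hq : q ≪ volume) {i j : Fin n} (hij : i ≠ j) :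
    ∀ᵐ b, marginalPDF q j b = ∫⁻ a, pairPDF q i j (a, b) := by
  have h := rnDeriv_map_snd (μ := (volume : Measure (E D))) (ν := (volume : Measure (E D)))
    (pairLaw_ac hq hij)
  rw [← coordLaw_eq_snd] at h
  exact h

lemma marginalPDF_ne_top (i : Fin n) : ∀ᵐ a, marginalPDF q i a ≠ ∞ := by
  change ∀ᵐ a, (coordLaw q i).rnDeriv volume a ≠ ∞
  exact Measure.rnDeriv_ne_top _ _

lemma lintegral_transitionPDF (hq : q ≪ volume) {i j : Fin n} (hij : i ≠ j) :
    ∀ᵐ a, marginalPDF q i a ≠ 0 → ∫⁻ b, transitionPDF q i j a b = 1 := by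
  filter_upwards [marginalPDF_eq_left hq hij, marginalPDF_ne_top (q := q) i] with a h1 h2 h3
  simp only [transitionPDF_eq, div_eq_mul_inv]
  have hm : Measurable fun b => pairPDF q i j (a, b) :=
    (measurable_pairPDF q i j).comp measurable_prodMk_left
  rw [lintegral_mul_const _ hm, ← h1, ENNReal.mul_inv_cancel h3 h2]

/-- Division by a vanishing marginal does no harm: the marginal is the integral of the pair density,
so where it is zero the pair density vanishes for almost every second coordinate. -/
lemma marginalPDF_mul_transitionPDF (hq : q ≪ volume) {i j : Fin n} (hij : i ≠ j) :
    ∀ᵐ z : E D × E D, marginalPDF q i z.1 * transitionPDF q i j z.1 z.2 = pairPDF q i j z := by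
  have hm : MeasurableSet {z : E D × E D |
      marginalPDF q i z.1 * transitionPDF q i j z.1 z.2 = pairPDF q i j z} :=
    measurableSet_eq_fun (((measurable_marginalPDF q i).comp measurable_fst).mul
      (measurable_transitionPDF q i j)) (measurable_pairPDF q i j)
  rw [Measure.volume_eq_prod, Measure.ae_prod_iff_ae_ae hm]
  filter_upwards [marginalPDF_eq_left hq hij, marginalPDF_ne_top (q := q) i] with a h1 h2
  by_cases h0 : marginalPDF q i a = 0
  · have h3 := h1
    have hm : Measurable fun b => pairPDF q i j (a, b) :=
      (measurable_pairPDF q i j).comp measurable_prodMk_left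
    rw [h0, eq_comm, lintegral_eq_zero_iff hm] at h3
    filter_upwards [h3] with b hb
    rw [h0, zero_mul]
    exact hb.symm
  · refine ae_of_all _ fun b => ?_
    rw [transitionPDF_eq, ENNReal.mul_div_cancel h0 h2]

lemma withDensity_pairPDF (hq : q ≪ volume) {i j : Fin n} (hij : i ≠ j) :
    volume.withDensity (pairPDF q i j) = pairLaw q i j :=
  Measure.withDensity_rnDeriv_eq _ _ (pairLaw_ac hq hij)

lemma withDensity_marginalPDF (hq : q ≪ volume) (i : Fin n) :
    volume.withDensity (marginalPDF q i) = coordLaw q i :=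
  Measure.withDensity_rnDeriv_eq _ _ (coordLaw_ac hq i)

omit q [IsProbabilityMeasure q]

variable {q : Measure (Fin (N + 2) → E D)}

lemma castSucc_ne_succ {m : ℕ} (i : Fin m) : i.castSucc ≠ i.succ := (Fin.castSucc_lt_succ).ne

lemma projM_ac : projM q ≪ volume := withDensity_absolutelyContinuous _ _

variable [IsProbabilityMeasure q]

lemma lintegral_marginal_mul_transition (hq : q ≪ volume) (i : Fin (N + 1)) :
    ∀ᵐ b, ∫⁻ a, marginalPDF q i.castSucc a * transitionPDF q i.castSucc i.succ a b =
      marginalPDF q i.succ b := by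
  have h := marginalPDF_mul_transitionPDF hq (castSucc_ne_succ i)
  have hm : MeasurableSet {z : E D × E D | marginalPDF q i.castSucc z.1 *
      transitionPDF q i.castSucc i.succ z.1 z.2 = pairPDF q i.castSucc i.succ z} :=
    measurableSet_eq_fun (((measurable_marginalPDF q _).comp measurable_fst).mul
      (measurable_transitionPDF q _ _)) (measurable_pairPDF q _ _)
  rw [Measure.volume_eq_prod, Measure.ae_prod_iff_ae_ae hm, Measure.ae_ae_comm hm] at h
  filter_upwards [h, marginalPDF_eq_right hq (castSucc_ne_succ i)] with b h1 h2
  rw [h2]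
  exact lintegral_congr_ae h1

lemma coordLaw_projM (hq : q ≪ volume) (i : Fin (N + 2)) :
    coordLaw (projM q) i = coordLaw q i := by
  rw [← withDensity_marginalPDF hq]
  exact (map_chain (m := fun i => marginalPDF q i) (fun i => measurable_marginalPDF q i)
    (fun i => measurable_transitionPDF q i.castSucc i.succ)
    (fun i => lintegral_transitionPDF hq (castSucc_ne_succ i))
    (fun i => lintegral_marginal_mul_transition hq i)).1 i

/-- Only consecutive pairs are protected in this way. The joint law of the two ends may change, and
this is how the iteration moves the coupling. -/
lemma pairLaw_projM (hq : q ≪ volume) (i : Fin (N + 1)) :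
    pairLaw (projM q) i.castSucc i.succ = pairLaw q i.castSucc i.succ := by
  rw [← withDensity_pairPDF hq (castSucc_ne_succ i),
    ← withDensity_congr_ae (marginalPDF_mul_transitionPDF hq (castSucc_ne_succ i))]
  exact (map_chain (m := fun i => marginalPDF q i) (fun i => measurable_marginalPDF q i)
    (fun i => measurable_transitionPDF q i.castSucc i.succ)
    (fun i => lintegral_transitionPDF hq (castSucc_ne_succ i))
    (fun i => lintegral_marginal_mul_transition hq i)).2 i

lemma isProbabilityMeasure_projM (hq : q ≪ volume) : IsProbabilityMeasure (projM q) := by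
  have h : (coordLaw (projM q) 0) Set.univ = 1 := by rw [coordLaw_projM hq]; exact measure_univ
  rw [coordLaw, Measure.map_apply (by fun_prop) .univ] at h
  exact ⟨h⟩

/-- The densities that make up the density of the Markovian projection are positive and finite. -/
def GoodPoint (q : Measure (Fin (N + 2) → E D)) (x : Fin (N + 2) → E D) : Prop :=
  (∀ i : Fin (N + 1), pairPDF q i.castSucc i.succ (x i.castSucc, x i.succ) ≠ 0 ∧
    pairPDF q i.castSucc i.succ (x i.castSucc, x i.succ) ≠ ∞) ∧
  ∀ i, marginalPDF q i (x i) ≠ 0 ∧ marginalPDF q i (x i) ≠ ∞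

/-- Each density is positive and finite almost everywhere for its own law; the hypotheses transfer
this to the marginals of `r`, which is later `q`, its projection, or the projection of a smaller
law. -/
lemma ae_goodPoint (hq : q ≪ volume) {r : Measure (Fin (N + 2) → E D)}
    (hp : ∀ i : Fin (N + 1), pairLaw r i.castSucc i.succ ≪ pairLaw q i.castSucc i.succ)
    (hc : ∀ i, coordLaw r i ≪ coordLaw q i) : ∀ᵐ x ∂r, GoodPoint q x := by
  refine (ae_all_iff.2 fun i => ?_).and (ae_all_iff.2 fun i => ?_)
  · have hac := pairLaw_ac hq (castSucc_ne_succ i)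
    have h1 : ∀ᵐ z ∂(pairLaw r i.castSucc i.succ),
        pairPDF q i.castSucc i.succ z ≠ 0 ∧ pairPDF q i.castSucc i.succ z ≠ ∞ := by
      filter_upwards [(hp i).ae_le (Measure.rnDeriv_pos hac),
        (hp i).ae_le (hac.ae_le (Measure.rnDeriv_ne_top (pairLaw q i.castSucc i.succ) volume))]
        with z h1 h2 using ⟨h1.ne', h2⟩
    exact ae_of_ae_map (f := fun x : Fin (N + 2) → E D => (x i.castSucc, x i.succ))
      (by fun_prop) h1
  · have hac := coordLaw_ac hq i
    have h1 : ∀ᵐ z ∂(coordLaw r i), marginalPDF q i z ≠ 0 ∧ marginalPDF q i z ≠ ∞ := by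
      filter_upwards [(hc i).ae_le (Measure.rnDeriv_pos hac),
        (hc i).ae_le (hac.ae_le (Measure.rnDeriv_ne_top (coordLaw q i) volume))]
        with z h1 h2 using ⟨h1.ne', h2⟩
    exact ae_of_ae_map (f := fun x : Fin (N + 2) → E D => x i)
      (measurable_pi_apply i).aemeasurable h1

/-- The density of the Markovian projection. -/
noncomputable def projMPDF (q : Measure (Fin (N + 2) → E D)) : (Fin (N + 2) → E D) → ℝ≥0∞ :=
  chainPDF (marginalPDF q 0) fun i : Fin (N + 1) => transitionPDF q i.castSucc i.succ

lemma measurable_projMPDF (q : Measure (Fin (N + 2) → E D)) : Measurable (projMPDF q) :=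
  measurable_chainPDF (measurable_marginalPDF q 0)
    fun i => measurable_transitionPDF q i.castSucc i.succ

lemma projM_eq_withDensity (q : Measure (Fin (N + 2) → E D)) :
    projM q = volume.withDensity (projMPDF q) := rfl

lemma GoodPoint.projMPDF_ne_zero {x : Fin (N + 2) → E D} (hx : GoodPoint q x) :
    projMPDF q x ≠ 0 := by
  rw [projMPDF, chainPDF]
  refine mul_ne_zero (hx.2 0).1 (Finset.prod_ne_zero_iff.2 fun i _ => ?_)
  exact (ENNReal.div_pos (hx.1 i).1 (hx.2 _).2).ne'

lemma GoodPoint.projMPDF_ne_top {x : Fin (N + 2) → E D} (hx : GoodPoint q x) :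
    projMPDF q x ≠ ∞ := by
  rw [projMPDF, chainPDF]
  refine ENNReal.mul_ne_top (hx.2 0).2 (ENNReal.prod_ne_top fun i _ => ?_)
  exact ENNReal.div_ne_top (hx.1 i).2 (hx.2 _).1

/-- The initial density cancels the first denominator, so only the marginals at interior times
survive; these are the indices `i.succ.castSucc`. -/
lemma GoodPoint.log_projMPDF {x : Fin (N + 2) → E D} (hx : GoodPoint q x) :
    Real.log (projMPDF q x).toReal =
      ∑ i : Fin (N + 1), Real.log (pairPDF q i.castSucc i.succ (x i.castSucc, x i.succ)).toReal -
      ∑ i : Fin N, Real.log (marginalPDF q i.succ.castSucc (x i.succ.castSucc)).toReal := by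
  have hm (i : Fin (N + 2)) : (marginalPDF q i (x i)).toReal ≠ 0 :=
    (ENNReal.toReal_pos (hx.2 i).1 (hx.2 i).2).ne'
  have hp (i : Fin (N + 1)) :
      (pairPDF q i.castSucc i.succ (x i.castSucc, x i.succ)).toReal ≠ 0 :=
    (ENNReal.toReal_pos (hx.1 i).1 (hx.1 i).2).ne'
  have ht (i : Fin (N + 1)) :
      (transitionPDF q i.castSucc i.succ (x i.castSucc) (x i.succ)).toReal =
        (pairPDF q i.castSucc i.succ (x i.castSucc, x i.succ)).toReal /
          (marginalPDF q i.castSucc (x i.castSucc)).toReal := by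
    rw [transitionPDF_eq, ENNReal.toReal_div]
  rw [projMPDF, chainPDF, ENNReal.toReal_mul, ENNReal.toReal_prod, Real.log_mul (hm 0)
    (Finset.prod_ne_zero_iff.2 fun i _ => by rw [ht]; exact div_ne_zero (hp i) (hm _)),
    Real.log_prod (fun i _ => by rw [ht]; exact div_ne_zero (hp i) (hm _))]
  simp only [ht, Real.log_div (hp _) (hm _)]
  rw [Finset.sum_sub_distrib, Fin.sum_univ_succ (n := N)
    (f := fun i : Fin (N + 1) => Real.log (marginalPDF q i.castSucc (x i.castSucc)).toReal)]
  simp only [Fin.castSucc_zero]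
  ring

omit [IsProbabilityMeasure q] in
lemma ac_withDensity_of_ae_ne_zero {Ω : Type*} [MeasurableSpace Ω] {r μ : Measure Ω}
    {f : Ω → ℝ≥0∞} (hf : Measurable f) (hr : r ≪ μ) (h : ∀ᵐ x ∂r, f x ≠ 0) :
    r ≪ μ.withDensity f := by
  refine Measure.AbsolutelyContinuous.mk fun s hs h0 => ?_
  rw [withDensity_apply_eq_zero' hf.aemeasurable] at h0
  rw [ae_iff] at h
  refine measure_mono_null ?_ (measure_union_null h (hr h0))
  intro x hx
  by_cases h : f x = 0
  · left; simpa using h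
  · right; exact ⟨h, hx⟩

lemma ac_projM_of_pairLaw_ac (hq : q ≪ volume) {r : Measure (Fin (N + 2) → E D)}
    (hr : r ≪ volume)
    (hp : ∀ i : Fin (N + 1), pairLaw r i.castSucc i.succ ≪ pairLaw q i.castSucc i.succ)
    (hc : ∀ i, coordLaw r i ≪ coordLaw q i) : r ≪ projM q := by
  rw [projM_eq_withDensity]
  refine ac_withDensity_of_ae_ne_zero (measurable_projMPDF q) hr ?_
  filter_upwards [ae_goodPoint hq hp hc] with x hx using hx.projMPDF_ne_zero

lemma ac_projM (hq : q ≪ volume) : q ≪ projM q :=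
  ac_projM_of_pairLaw_ac hq hq (fun _ => Measure.AbsolutelyContinuous.rfl)
    fun _ => Measure.AbsolutelyContinuous.rfl

lemma pairLaw_mono {q p : Measure (Fin n → E D)} (h : q ≪ p) (i j : Fin n) :
    pairLaw q i j ≪ pairLaw p i j := h.map (by fun_prop)

lemma coordLaw_mono {q p : Measure (Fin n → E D)} (h : q ≪ p) (i : Fin n) :
    coordLaw q i ≪ coordLaw p i := h.map (by fun_prop)

lemma projM_ac_projM {p : Measure (Fin (N + 2) → E D)} [IsProbabilityMeasure p]
    (hp : p ≪ volume) (hqp : q ≪ p) : projM q ≪ projM p := by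
  have hq := hqp.trans hp
  refine ac_projM_of_pairLaw_ac hp projM_ac (fun i => ?_) fun i => ?_
  · rw [pairLaw_projM hq]; exact pairLaw_mono hqp _ _
  · rw [coordLaw_projM hq]; exact coordLaw_mono hqp _

/-- The log-likelihood ratio of two Markovian projections. -/
noncomputable def llrM (q p : Measure (Fin (N + 2) → E D)) (x : Fin (N + 2) → E D) : ℝ :=
  ∑ i : Fin (N + 1), llr (pairLaw q i.castSucc i.succ) (pairLaw p i.castSucc i.succ)
    (x i.castSucc, x i.succ) -
  ∑ i : Fin N, llr (coordLaw q i.succ.castSucc) (coordLaw p i.succ.castSucc) (x i.succ.castSucc)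

lemma rnDeriv_projM {p : Measure (Fin (N + 2) → E D)} [IsProbabilityMeasure p]
    (hp : p ≪ volume) (hqp : q ≪ p) :
    (projM q).rnDeriv (projM p) =ᵐ[projM p] fun x => projMPDF q x / projMPDF p x := by
  have hq := hqp.trans hp
  have := isProbabilityMeasure_projM hq
  have := isProbabilityMeasure_projM hp
  filter_upwards [Measure.rnDeriv_eq_div (projM_ac (q := q)) (projM_ac (q := p)),
    projM_ac.ae_le (Measure.rnDeriv_withDensity volume (measurable_projMPDF q)),
    projM_ac.ae_le (Measure.rnDeriv_withDensity volume (measurable_projMPDF p))] with x h1 h2 h3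
  rw [h1, ← h2, ← h3]
  rfl

/-- The point is that the log-ratio becomes a sum of functions of single states and of consecutive
pairs, that is, of exactly the data that the projection keeps. -/
lemma llr_projM {p : Measure (Fin (N + 2) → E D)} [IsProbabilityMeasure p]
    (hp : p ≪ volume) (hqp : q ≪ p) : llr (projM q) (projM p) =ᵐ[projM q] llrM q p := by
  have hq := hqp.trans hp
  have hpair (i : Fin (N + 1)) : ∀ᵐ x ∂(projM q),
      llr (pairLaw q i.castSucc i.succ) (pairLaw p i.castSucc i.succ) (x i.castSucc, x i.succ) =
      Real.log (pairPDF q i.castSucc i.succ (x i.castSucc, x i.succ) /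
        pairPDF p i.castSucc i.succ (x i.castSucc, x i.succ)).toReal := by
    have h := Measure.rnDeriv_eq_div (pairLaw_ac hq (castSucc_ne_succ i))
      (pairLaw_ac hp (castSucc_ne_succ i))
    have h2 := (pairLaw_mono hqp i.castSucc i.succ).ae_le h
    nth_rw 1 [← pairLaw_projM hq] at h2
    filter_upwards [ae_of_ae_map (by fun_prop) h2] with x hx
    rw [llr, hx]
    rfl
  have hcoord (i : Fin (N + 2)) : ∀ᵐ x ∂(projM q),
      llr (coordLaw q i) (coordLaw p i) (x i) =
      Real.log (marginalPDF q i (x i) / marginalPDF p i (x i)).toReal := by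
    have h := Measure.rnDeriv_eq_div (coordLaw_ac hq i) (coordLaw_ac hp i)
    have h2 := (coordLaw_mono hqp i).ae_le h
    nth_rw 1 [← coordLaw_projM hq] at h2
    filter_upwards [ae_of_ae_map (measurable_pi_apply i).aemeasurable h2] with x hx
    rw [llr, hx]
    rfl
  have hgq : ∀ᵐ x ∂(projM q), GoodPoint q x :=
    ae_goodPoint hq (fun i => by rw [pairLaw_projM hq]) fun i => by rw [coordLaw_projM hq]
  have hgp : ∀ᵐ x ∂(projM q), GoodPoint p x :=
    ae_goodPoint hp (fun i => by rw [pairLaw_projM hq]; exact pairLaw_mono hqp _ _)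
      fun i => by rw [coordLaw_projM hq]; exact coordLaw_mono hqp _
  filter_upwards [(projM_ac_projM hp hqp).ae_le (rnDeriv_projM hp hqp), hgq, hgp,
    ae_all_iff.2 hpair, ae_all_iff.2 hcoord] with x h1 h2 h3 h4 h5
  have hlog (a b : ℝ≥0∞) (ha : a ≠ 0) (ha' : a ≠ ∞) (hb : b ≠ 0) (hb' : b ≠ ∞) :
      Real.log (a / b).toReal = Real.log a.toReal - Real.log b.toReal := by
    rw [ENNReal.toReal_div, Real.log_div (ENNReal.toReal_pos ha ha').ne'
      (ENNReal.toReal_pos hb hb').ne']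
  rw [llr, h1, hlog _ _ h2.projMPDF_ne_zero h2.projMPDF_ne_top h3.projMPDF_ne_zero
    h3.projMPDF_ne_top, h2.log_projMPDF, h3.log_projMPDF, llrM]
  simp only [h4, h5]
  rw [Finset.sum_congr rfl fun i _ => hlog _ _ (h2.1 i).1 (h2.1 i).2 (h3.1 i).1 (h3.1 i).2,
    Finset.sum_congr rfl fun (i : Fin N) _ => hlog _ _ (h2.2 i.succ.castSucc).1
      (h2.2 i.succ.castSucc).2 (h3.2 i.succ.castSucc).1 (h3.2 i.succ.castSucc).2,
    Finset.sum_sub_distrib, Finset.sum_sub_distrib]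
  ring

/-- The value does not involve `r` beyond the shared marginals. Taking `r = q` and `r = projM q`
yields the equality of integrals behind the Pythagorean identity; data processing makes every term
finite. -/
lemma integral_llrM {p r : Measure (Fin (N + 2) → E D)} [IsProbabilityMeasure p]
    (hKL : klDiv q p < ∞)
    (hp : ∀ i : Fin (N + 1), pairLaw r i.castSucc i.succ = pairLaw q i.castSucc i.succ)
    (hc : ∀ i, coordLaw r i = coordLaw q i) :
    Integrable (llrM q p) r ∧ ∫ x, llrM q p x ∂r =
      ∑ i : Fin (N + 1), (klDiv (pairLaw q i.castSucc i.succ)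
        (pairLaw p i.castSucc i.succ)).toReal -
      ∑ i : Fin N, (klDiv (coordLaw q i.succ.castSucc) (coordLaw p i.succ.castSucc)).toReal := by
  have hqp := ac_of_klDiv_lt_top hKL
  have h1 (i : Fin (N + 1)) : Integrable (fun x : Fin (N + 2) → E D =>
      llr (pairLaw q i.castSucc i.succ) (pairLaw p i.castSucc i.succ) (x i.castSucc, x i.succ)) r ∧
      ∫ x, llr (pairLaw q i.castSucc i.succ) (pairLaw p i.castSucc i.succ)
        (x i.castSucc, x i.succ) ∂r =
      (klDiv (pairLaw q i.castSucc i.succ) (pairLaw p i.castSucc i.succ)).toReal := by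
    have hfin : klDiv (pairLaw q i.castSucc i.succ) (pairLaw p i.castSucc i.succ) < ∞ :=
      (klDiv_map_le _ _ (by fun_prop)).trans_lt hKL
    have hi := integrable_llr_of_klDiv_lt_top hfin
    rw [toReal_klDiv_of_measure_eq (pairLaw_mono hqp _ _) (by simp)]
    have hm : Measurable fun x : Fin (N + 2) → E D => (x i.castSucc, x i.succ) := by fun_prop
    nth_rw 2 [← hp i] at hi
    refine ⟨hi.comp_measurable hm, ?_⟩
    nth_rw 2 [← hp i]
    exact (integral_map hm.aemeasurable (measurable_llr _ _).aestronglyMeasurable).symm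
  have h2 (i : Fin (N + 2)) : Integrable (fun x : Fin (N + 2) → E D =>
      llr (coordLaw q i) (coordLaw p i) (x i)) r ∧
      ∫ x, llr (coordLaw q i) (coordLaw p i) (x i) ∂r =
      (klDiv (coordLaw q i) (coordLaw p i)).toReal := by
    have hfin : klDiv (coordLaw q i) (coordLaw p i) < ∞ :=
      (klDiv_map_le _ _ (by fun_prop)).trans_lt hKL
    have hi := integrable_llr_of_klDiv_lt_top hfin
    rw [toReal_klDiv_of_measure_eq (coordLaw_mono hqp _) (by simp)]
    have hm : Measurable fun x : Fin (N + 2) → E D => x i := by fun_prop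
    nth_rw 2 [← hc i] at hi
    refine ⟨hi.comp_measurable hm, ?_⟩
    nth_rw 2 [← hc i]
    exact (integral_map hm.aemeasurable (measurable_llr _ _).aestronglyMeasurable).symm
  have i1 := integrable_finsetSum (Finset.univ : Finset (Fin (N + 1))) fun i _ => (h1 i).1
  have i2 := integrable_finsetSum (Finset.univ : Finset (Fin N)) fun i _ =>
    (h2 i.succ.castSucc).1
  refine ⟨i1.sub i2, ?_⟩
  simp only [llrM]
  rw [integral_sub i1 i2, integral_finsetSum _ fun i _ => (h1 i).1,
    integral_finsetSum _ fun (i : Fin N) _ => (h2 i.succ.castSucc).1]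
  simp only [(h1 _).2, (h2 _).2]

/-- Pythagorean identity for the Markovian projection. -/
theorem klDiv_eq_add_projM {p : Measure (Fin (N + 2) → E D)} [IsProbabilityMeasure p]
    (hp : p ≪ volume) (hpM : projM p = p) (hKL : klDiv q p < ∞) :
    klDiv q p = klDiv q (projM q) + klDiv (projM q) p := by
  have hqp := ac_of_klDiv_lt_top hKL
  have hq := hqp.trans hp
  have := isProbabilityMeasure_projM hq
  have hl := llr_projM hp hqp
  have hac := projM_ac_projM hp hqp
  rw [hpM] at hl hac
  obtain ⟨i1, e1⟩ := integral_llrM (r := q) hKL (fun _ => rfl) fun _ => rfl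
  obtain ⟨i2, e2⟩ := integral_llrM (r := projM q) hKL (pairLaw_projM hq) (coordLaw_projM hq)
  have hl' : llr (projM q) p =ᵐ[q] llrM q p := (ac_projM hq).ae_le hl
  exact klDiv_eq_add_of_integral_eq (ac_projM hq) hac (i1.congr hl'.symm) (i2.congr hl.symm)
    (by rw [integral_congr_ae hl, integral_congr_ae hl', e1, e2])

/-- The exact value is this sum minus the divergences of the interior marginals, which are
nonnegative and can be dropped. -/
lemma klDiv_projM_le {p : Measure (Fin (N + 2) → E D)} [IsProbabilityMeasure p]
    (hp : p ≪ volume) (hpM : projM p = p) (hKL : klDiv q p < ∞) :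
    klDiv (projM q) p ≤ ∑ i : Fin (N + 1),
      klDiv (pairLaw q i.castSucc i.succ) (pairLaw p i.castSucc i.succ) := by
  have hqp := ac_of_klDiv_lt_top hKL
  have hq := hqp.trans hp
  have := isProbabilityMeasure_projM hq
  have hl := llr_projM hp hqp
  have hac := projM_ac_projM hp hqp
  rw [hpM] at hl hac
  obtain ⟨i2, e2⟩ := integral_llrM (r := projM q) hKL (pairLaw_projM hq) (coordLaw_projM hq)
  have hfin (i : Fin (N + 1)) :
      klDiv (pairLaw q i.castSucc i.succ) (pairLaw p i.castSucc i.succ) ≠ ∞ :=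
    ((klDiv_map_le _ _ (by fun_prop)).trans_lt hKL).ne
  rw [← ENNReal.ofReal_toReal (klDiv_ne_top hac (i2.congr hl.symm)),
    toReal_klDiv_of_measure_eq hac (by simp), integral_congr_ae hl, e2,
    ← ENNReal.ofReal_toReal (ENNReal.sum_ne_top.2 fun i _ => hfin i),
    ENNReal.toReal_sum fun i _ => hfin i]
  exact ENNReal.ofReal_le_ofReal
    (sub_le_self _ (Finset.sum_nonneg fun i _ => ENNReal.toReal_nonneg))

end MarkovProjection

/-! ### Fixed points of the Markovian projection -/

section MarkovMeasures

variable {D N : ℕ}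

/-- Agreement `r`-a.e. gives `f ≤ projMPDF r` Lebesgue-a.e., trivially where `f = 0`. So `r ≤ projM
r`, and equal total masses force equality. -/
lemma projM_eq_self_of_ae {r : Measure (Fin (N + 2) → E D)} [IsProbabilityMeasure r]
    {f : (Fin (N + 2) → E D) → ℝ≥0∞} (hf : Measurable f) (hr : r = volume.withDensity f)
    (h : ∀ᵐ x ∂r, f x = projMPDF r x) : projM r = r := by
  have hac : r ≪ volume := hr ▸ withDensity_absolutelyContinuous _ _
  have := isProbabilityMeasure_projM hac
  have hle : r ≤ projM r := by
    rw [hr, ae_withDensity_iff hf, ← hr] at h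
    rw [projM_eq_withDensity]
    nth_rw 1 [hr]
    refine withDensity_mono ?_
    filter_upwards [h] with x hx
    by_cases h0 : f x = 0
    · rw [h0]; exact zero_le
    · exact (hx h0).le
  exact (Measure.eq_of_le_of_measure_univ_eq hle (by simp)).symm

lemma pairPDF_of_withDensity {n : ℕ} {r : Measure (Fin n → E D)} {i j : Fin n}
    {f : E D × E D → ℝ≥0∞} (hf : Measurable f) (h : pairLaw r i j = volume.withDensity f) :
    pairPDF r i j =ᵐ[volume] f := by
  rw [pairPDF, h]
  exact Measure.rnDeriv_withDensity _ hf

lemma marginalPDF_of_withDensity {n : ℕ} {r : Measure (Fin n → E D)} {i : Fin n}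
    {f : E D → ℝ≥0∞} (hf : Measurable f) (h : coordLaw r i = volume.withDensity f) :
    marginalPDF r i =ᵐ[volume] f := by
  have : marginalPDF r i = (coordLaw r i).rnDeriv volume := rfl
  rw [this, h]
  exact Measure.rnDeriv_withDensity _ hf

/-- Chains with normalized transition densities are Markovian. -/
lemma projM_chain {m : Fin (N + 2) → E D → ℝ≥0∞} {k : Fin (N + 1) → E D → E D → ℝ≥0∞}
    (hm : ∀ i, Measurable (m i)) (hk : ∀ i, Measurable fun z : E D × E D => k i z.1 z.2)
    (h1 : ∀ i : Fin (N + 1), ∀ᵐ a, m i.castSucc a ≠ 0 → ∫⁻ b, k i a b = 1)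
    (h2 : ∀ i : Fin (N + 1), ∀ᵐ b, ∫⁻ a, m i.castSucc a * k i a b = m i.succ b)
    {r : Measure (Fin (N + 2) → E D)} [IsProbabilityMeasure r]
    (hr : r = volume.withDensity (chainPDF (m 0) k)) : projM r = r := by
  have hac : r ≪ volume := hr ▸ withDensity_absolutelyContinuous _ _
  refine projM_eq_self_of_ae (measurable_chainPDF (hm 0) hk) hr ?_
  obtain ⟨hs, hp⟩ := map_chain hm hk h1 h2
  rw [← hr] at hs hp
  have hp' (i : Fin (N + 1)) : ∀ᵐ x ∂r, pairPDF r i.castSucc i.succ (x i.castSucc, x i.succ) =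
      m i.castSucc (x i.castSucc) * k i (x i.castSucc) (x i.succ) :=
    hac.ae_le ((quasiMeasurePreserving_pair (castSucc_ne_succ i)).ae
      (pairPDF_of_withDensity (((hm _).comp measurable_fst).mul (hk i)) (hp i)))
  have hs' (i : Fin (N + 2)) : ∀ᵐ x ∂r, marginalPDF r i (x i) = m i (x i) :=
    hac.ae_le ((quasiMeasurePreserving_coord i).ae (marginalPDF_of_withDensity (hm i) (hs i)))
  have hg : ∀ᵐ x ∂r, GoodPoint r x := ae_goodPoint hac (fun _ => .rfl) fun _ => .rfl
  filter_upwards [ae_all_iff.2 hp', ae_all_iff.2 hs', hg] with x h1 h2 h3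
  rw [projMPDF, chainPDF, chainPDF, h2 0]
  congr 1
  refine Finset.prod_congr rfl fun i _ => ?_
  have h4 := h3.2 i.castSucc
  rw [h2] at h4
  rw [transitionPDF_eq, h1, h2, mul_comm, ENNReal.mul_div_cancel_right h4.1 h4.2]

lemma lintegral_cons {n : ℕ} {G : (Fin (n + 1) → E D) → ℝ≥0∞} (hG : Measurable G) :
    ∫⁻ x, G x = ∫⁻ a : E D, ∫⁻ z : Fin n → E D, G (Fin.cons a z) := by
  have h := (volume_preserving_piFinSuccAbove (fun _ : Fin (n + 1) => E D) 0).symm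
  rw [← h.lintegral_comp hG]
  change ∫⁻ z : E D × (Fin n → E D), _ ∂(volume.prod volume) = _
  refine (lintegral_prod _ (hG.comp h.measurable).aemeasurable).trans ?_
  refine lintegral_congr fun a => lintegral_congr fun z => ?_
  exact congrArg G (Fin.insertNth_zero' a z)

lemma measurable_cons {n : ℕ} : Measurable fun z : E D × (Fin n → E D) =>
    (Fin.cons z.1 z.2 : Fin (n + 1) → E D) := by
  refine measurable_pi_lambda _ fun i => ?_
  induction i using Fin.cases with
  | zero => exact measurable_fst
  | succ i => exact (measurable_pi_apply i).comp measurable_snd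

lemma lintegral_three {G : (Fin (1 + 2) → E D) → ℝ≥0∞} (hG : Measurable G) :
    ∫⁻ x, G x = ∫⁻ a : E D, ∫⁻ m : E D, ∫⁻ y : E D, G ![a, m, y] := by
  refine (lintegral_cons (n := 2) hG).trans (lintegral_congr fun a => ?_)
  have h1 : Measurable fun z : Fin 2 → E D => G (Fin.cons a z) :=
    hG.comp (measurable_cons.comp measurable_prodMk_left)
  refine (lintegral_cons (n := 1) h1).trans (lintegral_congr fun m => ?_)
  have h2 : Measurable fun z : Fin 1 → E D => G (Fin.cons a (Fin.cons m z)) :=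
    h1.comp (measurable_cons.comp measurable_prodMk_left)
  refine (lintegral_cons (n := 0) h2).trans (lintegral_congr fun y => ?_)
  rw [lintegral_unique]
  have : (volume : Measure (Fin 0 → E D)) Set.univ = 1 := by
    rw [volume_pi, Measure.pi_univ]; simp
  rw [this, mul_one]
  rfl

lemma measurable_vec3 : Measurable fun z : E D × E D × E D =>
    (![z.1, z.2.1, z.2.2] : Fin (1 + 2) → E D) := by
  refine measurable_pi_lambda _ fun i => ?_
  fin_cases i
  · exact measurable_fst
  · exact measurable_fst.comp measurable_snd
  · exact measurable_snd.comp measurable_snd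

/-- A law on three times whose density splits at the middle time is Markovian. -/
lemma projM_of_split {U V : E D × E D → ℝ≥0∞} (hU : Measurable U) (hV : Measurable V)
    {r : Measure (Fin (1 + 2) → E D)} [IsProbabilityMeasure r]
    (hr : r = volume.withDensity fun x => U (x 0, x 1) * V (x 1, x 2)) : projM r = r := by
  have hac : r ≪ volume := hr ▸ withDensity_absolutelyContinuous _ _
  have hf : Measurable fun x : Fin (1 + 2) → E D => U (x 0, x 1) * V (x 1, x 2) := by fun_prop
  refine projM_eq_self_of_ae hf hr ?_
  have hv : Measurable fun m => ∫⁻ y, V (m, y) := hV.lintegral_prod_right'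
  have hu : Measurable fun m => ∫⁻ a, U (a, m) := hU.lintegral_prod_left'
  have hint (G : (Fin (1 + 2) → E D) → ℝ≥0∞) (hG : Measurable G) :
      ∫⁻ x, G x ∂r = ∫⁻ a, ∫⁻ m, ∫⁻ y, U (a, m) * V (m, y) * G ![a, m, y] := by
    rw [hr, lintegral_withDensity_eq_lintegral_mul _ hf hG, lintegral_three (hf.mul hG)]
    rfl
  have h01 : pairLaw r 0 1 = volume.withDensity fun z => U z * ∫⁻ y, V (z.2, y) := by
    refine Measure.ext_of_lintegral _ fun G hG => ?_
    have hp : Measurable fun x : Fin (1 + 2) → E D => (x 0, x 1) := by fun_prop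
    have hd : Measurable fun z : E D × E D => U z * ∫⁻ y, V (z.2, y) :=
      hU.mul (hv.comp measurable_snd)
    have hG' : Measurable fun x : Fin (1 + 2) → E D => G (x 0, x 1) := hG.comp hp
    rw [pairLaw, lintegral_map hG hp, hint _ hG',
      lintegral_withDensity_eq_lintegral_mul _ hd hG, Measure.volume_eq_prod,
      lintegral_prod _ (hd.mul hG).aemeasurable]
    refine lintegral_congr fun a => lintegral_congr fun m => ?_
    have hVm : Measurable fun y => V (m, y) := hV.comp measurable_prodMk_left
    calc ∫⁻ y, U (a, m) * V (m, y) * G (a, m)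
        = ∫⁻ y, (U (a, m) * G (a, m)) * V (m, y) := by
          refine lintegral_congr fun y => ?_; ring
      _ = _ := by
          rw [lintegral_const_mul _ hVm, Pi.mul_apply]; ring
  have h12 : pairLaw r 1 2 = volume.withDensity fun z => (∫⁻ a, U (a, z.1)) * V z := by
    refine Measure.ext_of_lintegral _ fun G hG => ?_
    have hp : Measurable fun x : Fin (1 + 2) → E D => (x 1, x 2) := by fun_prop
    have hd : Measurable fun z : E D × E D => (∫⁻ a, U (a, z.1)) * V z :=
      (hu.comp measurable_fst).mul hV
    have hVG (a m : E D) : Measurable fun y => U (a, m) * V (m, y) * G (m, y) := by fun_prop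
    have hVG' (m : E D) : Measurable fun y => V (m, y) * G (m, y) := by fun_prop
    have hG' : Measurable fun x : Fin (1 + 2) → E D => G (x 1, x 2) := hG.comp hp
    rw [pairLaw, lintegral_map hG hp, hint _ hG',
      lintegral_withDensity_eq_lintegral_mul _ hd hG, Measure.volume_eq_prod,
      lintegral_prod _ (hd.mul hG).aemeasurable]
    have hF : Measurable fun m => ∫⁻ y, V (m, y) * G (m, y) := (hV.mul hG).lintegral_prod_right'
    calc ∫⁻ a, ∫⁻ m, ∫⁻ y, U (a, m) * V (m, y) * G (m, y)
        = ∫⁻ a, ∫⁻ m, U (a, m) * ∫⁻ y, V (m, y) * G (m, y) := by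
          refine lintegral_congr fun a => lintegral_congr fun m => ?_
          rw [← lintegral_const_mul _ (hVG' m)]
          simp only [mul_assoc]
      _ = ∫⁻ m, ∫⁻ a, U (a, m) * ∫⁻ y, V (m, y) * G (m, y) :=
          lintegral_lintegral_swap (hU.mul (hF.comp measurable_snd)).aemeasurable
      _ = _ := by
          refine lintegral_congr fun m => ?_
          have hUm : Measurable fun a => U (a, m) := hU.comp measurable_prodMk_right
          rw [lintegral_mul_const _ hUm, ← lintegral_const_mul _ (hVG' m)]
          simp only [Pi.mul_apply, mul_assoc]
  have h1 : coordLaw r 1 = volume.withDensity fun m => (∫⁻ a, U (a, m)) * ∫⁻ y, V (m, y) := by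
    rw [coordLaw_eq_fst r 1 2, h12, Measure.volume_eq_prod]
    refine (map_fst_withDensity_prod ((hu.comp measurable_fst).mul hV)).trans ?_
    refine withDensity_congr_ae (ae_of_all _ fun m => ?_)
    have hVm : Measurable fun y => V (m, y) := hV.comp measurable_prodMk_left
    exact lintegral_const_mul (∫⁻ a, U (a, m)) hVm
  have e01 : ∀ᵐ x ∂r, pairPDF r 0 1 (x 0, x 1) = U (x 0, x 1) * ∫⁻ y, V (x 1, y) :=
    hac.ae_le ((quasiMeasurePreserving_pair (by decide)).ae
      (pairPDF_of_withDensity (hU.mul (hv.comp measurable_snd)) h01))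
  have e12 : ∀ᵐ x ∂r, pairPDF r 1 2 (x 1, x 2) = (∫⁻ a, U (a, x 1)) * V (x 1, x 2) :=
    hac.ae_le ((quasiMeasurePreserving_pair (by decide)).ae
      (pairPDF_of_withDensity ((hu.comp measurable_fst).mul hV) h12))
  have e1 : ∀ᵐ x ∂r, marginalPDF r 1 (x 1) = (∫⁻ a, U (a, x 1)) * ∫⁻ y, V (x 1, y) :=
    hac.ae_le ((quasiMeasurePreserving_coord 1).ae (marginalPDF_of_withDensity (hu.mul hv) h1))
  have hg : ∀ᵐ x ∂r, GoodPoint (N := 1) r x := ae_goodPoint hac (fun _ => .rfl) fun _ => .rfl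
  filter_upwards [e01, e12, e1, hg] with x h1 h2 h3 h4
  have g0 := h4.2 0
  have g1 := h4.2 1
  have e : projMPDF (N := 1) r x = marginalPDF r 0 (x 0) *
      (pairPDF r 0 1 (x 0, x 1) / marginalPDF r 0 (x 0) *
        (pairPDF r 1 2 (x 1, x 2) / marginalPDF r 1 (x 1))) := by
    rw [projMPDF, chainPDF, Fin.prod_univ_two]
    rfl
  rw [e, ← mul_assoc, ENNReal.mul_div_cancel g0.1 g0.2, h1, h2, h3]
  rw [h3] at g1
  set u := ∫⁻ a, U (a, x 1)
  set v := ∫⁻ y, V (x 1, y)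
  -- The pair densities are `U v` and `u V` and the middle marginal is `u v`; the latter cancels
  -- because a good point makes it positive and finite.
  calc U (x 0, x 1) * V (x 1, x 2)
      = U (x 0, x 1) * V (x 1, x 2) * ((u * v) * (u * v)⁻¹) := by
        rw [ENNReal.mul_inv_cancel g1.1 g1.2, mul_one]
    _ = U (x 0, x 1) * v * (u * V (x 1, x 2) / (u * v)) := by
        rw [div_eq_mul_inv]; ring

/-- The coordinates `0`, `1` and the last one. -/
def tri (x : Fin (N + 2) → E D) : Fin (1 + 2) → E D := ![x 0, x 1, x (Fin.last (N + 1))]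

lemma measurable_tri : Measurable (tri : (Fin (N + 2) → E D) → Fin (1 + 2) → E D) := by
  have h : Measurable fun x : Fin (N + 2) → E D => (x 0, x 1, x (Fin.last (N + 1))) := by fun_prop
  exact measurable_vec3.comp h

/-- Integrating a chain over the states strictly between the second and the last time leaves a
density that splits at the second time, so `projM_of_split` applies. -/
lemma projM_map_tri (hN : 1 ≤ N) {q : Measure (Fin (N + 2) → E D)} [IsProbabilityMeasure q]
    (hq : q ≪ volume) : projM ((projM q).map tri) = (projM q).map tri := by
  -- At least one interior time keeps the coordinates `1` and last distinct; `N` now counts the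
  -- states to be integrated out.
  obtain ⟨N, rfl⟩ : ∃ N', N = N' + 1 := ⟨N - 1, by omega⟩
  have := isProbabilityMeasure_projM hq
  have : IsProbabilityMeasure ((projM q).map tri) :=
    Measure.isProbabilityMeasure_map measurable_tri.aemeasurable
  have hk (i j : Fin (N + 1 + 2)) := measurable_transitionPDF q i j
  have hm0 := measurable_marginalPDF q 0
  let U : E D × E D → ℝ≥0∞ := fun z => marginalPDF q 0 z.1 * transitionPDF q 0 1 z.1 z.2
  let B : (Fin (N + 2) → E D) → ℝ≥0∞ := fun z => ∏ i : Fin (N + 1),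
    transitionPDF q i.succ.castSucc i.succ.succ (z i.castSucc) (z i.succ)
  -- Transition density from the second time to the last, by Chapman-Kolmogorov.
  let V : E D × E D → ℝ≥0∞ := fun z =>
    ∫⁻ w : Fin N → E D, B (Fin.cons z.1 (Fin.snoc w z.2))
  have hU : Measurable U := (hm0.comp measurable_fst).mul (hk 0 1)
  have hB : Measurable B := Finset.measurable_prod _ fun i _ =>
    Measurable.comp (g := fun z : E D × E D => transitionPDF q i.succ.castSucc i.succ.succ z.1 z.2)
      (hk _ _) (f := fun z : Fin (N + 2) → E D => (z i.castSucc, z i.succ)) (by fun_prop)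
  have hBc : Measurable fun z : (E D × E D) × (Fin N → E D) =>
      B (Fin.cons z.1.1 (Fin.snoc z.2 z.1.2)) := by
    refine hB.comp ?_
    have h1 : Measurable fun z : (E D × E D) × (Fin N → E D) =>
        (Fin.snoc z.2 z.1.2 : Fin (N + 1) → E D) :=
      measurable_snoc.comp (measurable_snd.prodMk (measurable_snd.comp measurable_fst))
    exact measurable_cons.comp ((measurable_fst.comp measurable_fst).prodMk h1)
  have hV : Measurable V := hBc.lintegral_prod_right'
  refine projM_of_split hU hV ?_
  refine Measure.ext_of_lintegral _ fun G hG => ?_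
  have hd : Measurable fun x : Fin (1 + 2) → E D => U (x 0, x 1) * V (x 1, x 2) := by fun_prop
  have hGt : Measurable fun x : Fin (N + 1 + 2) → E D => G (tri x) := hG.comp measurable_tri
  rw [lintegral_map hG measurable_tri, projM_eq_withDensity,
    lintegral_withDensity_eq_lintegral_mul _ (measurable_projMPDF q) hGt,
    lintegral_withDensity_eq_lintegral_mul _ hd hG, lintegral_three (hd.mul hG)]
  let H : (Fin (N + 1 + 2) → E D) → ℝ≥0∞ := fun x => projMPDF q x * G (tri x)
  have hF : Measurable H := (measurable_projMPDF q).mul hGt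
  refine (lintegral_cons hF).trans (lintegral_congr fun a => ?_)
  have hF1 : Measurable fun z : Fin (N + 2) → E D =>
      H (Fin.cons a z) := hF.comp (measurable_cons.comp measurable_prodMk_left)
  refine (lintegral_cons hF1).trans (lintegral_congr fun m => ?_)
  have hF2 : Measurable fun z : Fin (N + 1) → E D =>
      H (Fin.cons a (Fin.cons m z)) :=
    hF1.comp (measurable_cons.comp measurable_prodMk_left)
  have hF3 : Measurable fun z : (Fin N → E D) × E D =>
      H (Fin.cons a (Fin.cons m (Fin.snoc z.1 z.2))) :=
    hF2.comp measurable_snoc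
  refine (lintegral_snoc hF2).trans ((lintegral_lintegral_swap hF3.aemeasurable).trans ?_)
  refine lintegral_congr fun y => ?_
  have hBm : Measurable fun w : Fin N → E D => B (Fin.cons m (Fin.snoc w y)) :=
    hBc.comp (measurable_prodMk_left (x := (m, y)))
  calc ∫⁻ w : Fin N → E D, H (Fin.cons a (Fin.cons m (Fin.snoc w y)))
      = ∫⁻ w : Fin N → E D, (U (a, m) * G ![a, m, y]) * B (Fin.cons m (Fin.snoc w y)) := by
        refine lintegral_congr fun w => ?_
        have e1 : tri (Fin.cons a (Fin.cons m (Fin.snoc w y)) : Fin (N + 1 + 2) → E D) =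
            ![a, m, y] := by
          have hl : (Fin.cons a (Fin.cons m (Fin.snoc w y)) : Fin (N + 1 + 2) → E D)
              (Fin.last (N + 1 + 1)) = y := by
            rw [← Fin.succ_last, Fin.cons_succ, ← Fin.succ_last, Fin.cons_succ]
            exact Fin.snoc_last (α := fun _ => E D) y w
          rw [tri, hl]
          rfl
        simp only [H]
        rw [e1, projMPDF, chainPDF, Fin.prod_univ_succ]
        simp only [Fin.castSucc_zero, Fin.succ_zero_eq_one, Fin.cons_zero, Fin.cons_one,
          ← Fin.succ_castSucc, Fin.cons_succ, U, B]
        ring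
    _ = U (a, m) * G ![a, m, y] * V (m, y) := lintegral_const_mul _ hBm
    _ = U (a, m) * V (m, y) * G ![a, m, y] := by ring

end MarkovMeasures

/-! ### Uniform integrability from entropy, and the test function `cayley` -/

section AsymptoticUniqueness

variable {Z : Type*} [MeasurableSpace Z]

lemma exists_subseq_ae_tendsto_zero {μ : Measure Z} {f : ℕ → Z → ℝ}
    (hf : ∀ l, AEStronglyMeasurable (f l) μ)
    (h : Tendsto (fun l => ∫⁻ z, ‖f l z‖ₑ ∂μ) atTop (𝓝 0)) :
    ∃ ns : ℕ → ℕ, StrictMono ns ∧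
      ∀ᵐ z ∂μ, Tendsto (fun k => f (ns k) z) atTop (𝓝 0) := by
  have h1 : TendstoInMeasure μ f atTop (fun _ => (0 : ℝ)) := by
    refine tendstoInMeasure_of_tendsto_eLpNorm one_ne_zero hf aestronglyMeasurable_const ?_
    refine h.congr fun l => ?_
    rw [eLpNorm_one_eq_lintegral_enorm]
    simp
  exact h1.exists_seq_tendsto_ae

/-- Superlinearity: `klFun x ≥ x (log x - 1) ≥ L x` once `log x ≥ L + 1`. -/
lemma le_div_klFun {x L : ℝ} (hL : 0 < L) (hx : Real.exp (L + 1) ≤ x) :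
    x ≤ L⁻¹ * klFun x := by
  have hx0 : 0 < x := (Real.exp_pos _).trans_le hx
  have hlog : L + 1 ≤ Real.log x := (Real.le_log_iff_exp_le hx0).2 hx
  have : x * L ≤ klFun x := by
    rw [klFun_apply]
    nlinarith
  rw [inv_mul_eq_div, le_div_iff₀ hL]
  exact this

/-- Uniform integrability from a bound on the entropy. -/
lemma tendsto_lintegral_of_klFun_bound {μ : Measure Z} [IsFiniteMeasure μ] {ρ f : ℕ → Z → ℝ}
    {C : ℝ≥0∞} (hC : C ≠ ∞) (hρ : ∀ l, Measurable (ρ l)) (hf : ∀ l, Measurable (f l))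
    (hbound : ∀ l, ∀ᵐ z ∂μ, f l z ≤ 2 + 2 * ρ l z)
    (hKL : ∀ l, ∫⁻ z, ENNReal.ofReal (klFun (ρ l z)) ∂μ ≤ C)
    (hlim : ∀ᵐ z ∂μ, Tendsto (fun l => f l z) atTop (𝓝 0)) :
    Tendsto (fun l => ∫⁻ z, ENNReal.ofReal (f l z) ∂μ) atTop (𝓝 0) := by
  rw [ENNReal.tendsto_nhds_zero]
  intro ε hε
  -- Where `ρ > K = exp (L + 1) ≥ 1` one has `f ≤ 2 + 2ρ ≤ 4ρ ≤ 4 L⁻¹ klFun ρ`, hence the constant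
  -- `4 L⁻¹`. Where `ρ ≤ K`, truncating `f` at `2 + 2K` changes nothing, and dominated convergence
  -- handles the truncation.
  obtain ⟨L, hL, hLC⟩ : ∃ L : ℝ, 0 < L ∧ ENNReal.ofReal (4 * L⁻¹) * C ≤ ε / 2 := by
    have ht : Tendsto (fun L : ℝ => ENNReal.ofReal (4 * L⁻¹) * C) atTop (𝓝 0) := by
      have h1 : Tendsto (fun L : ℝ => 4 * L⁻¹) atTop (𝓝 0) := by
        simpa using tendsto_inv_atTop_zero.const_mul (4 : ℝ)
      have h2 := ENNReal.Tendsto.mul_const (b := C) (ENNReal.tendsto_ofReal h1) (Or.inr hC)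
      simpa using h2
    have h3 := (ENNReal.tendsto_nhds_zero.1 ht) (ε / 2) (ENNReal.half_pos hε.ne')
    obtain ⟨L, hL⟩ := (h3.and (eventually_gt_atTop 0)).exists
    exact ⟨L, hL.2, hL.1⟩
  set K := Real.exp (L + 1) with hK
  have hK1 : 1 ≤ K := by rw [hK]; exact Real.one_le_exp (by linarith)
  have htr : Tendsto (fun l => ∫⁻ z, ENNReal.ofReal (min (f l z) (2 + 2 * K)) ∂μ) atTop (𝓝 0) := by
    have h0 : (0 : ℝ≥0∞) = ∫⁻ _, 0 ∂μ := by simp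
    rw [h0]
    refine tendsto_lintegral_of_dominated_convergence (fun _ => ENNReal.ofReal (2 + 2 * K))
      (fun l => by fun_prop) (fun l => ae_of_all _ fun z =>
        ENNReal.ofReal_le_ofReal (min_le_right _ _)) ?_ ?_
    · rw [lintegral_const]; exact ENNReal.mul_ne_top ENNReal.ofReal_ne_top (measure_ne_top _ _)
    · filter_upwards [hlim] with z hz
      have := ENNReal.tendsto_ofReal (hz.min (tendsto_const_nhds (x := 2 + 2 * K)))
      rwa [min_eq_left (by positivity), ENNReal.ofReal_zero] at this
  filter_upwards [(ENNReal.tendsto_nhds_zero.1 htr) (ε / 2) (ENNReal.half_pos hε.ne')] with l hl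
  calc ∫⁻ z, ENNReal.ofReal (f l z) ∂μ
      ≤ ∫⁻ z, (ENNReal.ofReal (min (f l z) (2 + 2 * K)) +
          ENNReal.ofReal (4 * L⁻¹) * ENNReal.ofReal (klFun (ρ l z))) ∂μ := by
        refine lintegral_mono_ae ?_
        filter_upwards [hbound l] with z hz
        by_cases h : ρ l z ≤ K
        · rw [min_eq_left (by linarith)]
          exact le_self_add
        · push Not at h
          refine le_trans ?_ le_add_self
          rw [← ENNReal.ofReal_mul (by positivity)]
          refine ENNReal.ofReal_le_ofReal ?_
          have := le_div_klFun hL h.le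
          linarith
    _ = ∫⁻ z, ENNReal.ofReal (min (f l z) (2 + 2 * K)) ∂μ +
          ENNReal.ofReal (4 * L⁻¹) * ∫⁻ z, ENNReal.ofReal (klFun (ρ l z)) ∂μ := by
        rw [lintegral_add_left (by fun_prop), lintegral_const_mul]
        exact (measurable_klFun.comp (hρ l)).ennreal_ofReal
    _ ≤ ε / 2 + ε / 2 := by
        refine add_le_add hl (le_trans ?_ hLC)
        gcongr
        exact hKL l
    _ = ε := ENNReal.add_halves ε

/-- An odd function of `log x`, bounded and increasing. -/
noncomputable def cayley (x : ℝ) : ℝ := (x - 1) / (x + 1)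

lemma measurable_cayley : Measurable cayley := by unfold cayley; fun_prop

lemma abs_cayley_le {x : ℝ} (hx : 0 ≤ x) : |cayley x| ≤ 1 := by
  rw [cayley, abs_div, abs_of_pos (by linarith : 0 < x + 1), div_le_one (by linarith), abs_le]
  constructor <;> linarith

lemma cayley_eq {x : ℝ} (hx : 0 ≤ x) : cayley x = 1 - 2 / (x + 1) := by
  rw [cayley]; field_simp; ring

/-- A bounded sum of a function of `u` and a function of `v` that nevertheless has the sign of `u v
- 1`: this is the whole reason for `cayley`. -/
lemma cayley_add_cayley {u v : ℝ} (hu : 0 ≤ u) (hv : 0 ≤ v) :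
    cayley u + cayley v = 2 * (u * v - 1) / ((1 + u) * (1 + v)) := by
  rw [cayley, cayley]; field_simp; ring

lemma tendsto_one_of_cayley {u : ℕ → ℝ} (hu : ∀ l, 0 ≤ u l)
    (h : Tendsto (fun l => cayley (u l)) atTop (𝓝 0)) : Tendsto u atTop (𝓝 1) := by
  have h1 : Tendsto (fun l => 2 / (1 - cayley (u l)) - 1) atTop (𝓝 (2 / (1 - 0) - 1)) :=
    (tendsto_const_nhds.div (tendsto_const_nhds.sub h) (by norm_num)).sub tendsto_const_nhds
  norm_num at h1
  refine h1.congr fun l => ?_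
  have := hu l
  rw [cayley_eq this]
  field_simp
  ring

/-- A product `U V` determines its factors only up to `(U / c, c V)`; this fixes the constant. With
`c = exp s` the integral is continuous and runs from `-1` to `1`, so the intermediate value theorem
applies. -/
lemma exists_scale {ν : Measure Z} [IsProbabilityMeasure ν] {V : Z → ℝ} (hV : Measurable V)
    (hpos : ∀ᵐ z ∂ν, 0 < V z) : ∃ c : ℝ, 0 < c ∧ ∫ z, cayley (c * V z) ∂ν = 0 := by
  have hb (s : ℝ) : ∀ᵐ z ∂ν, ‖cayley (Real.exp s * V z)‖ ≤ 1 := by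
    filter_upwards [hpos] with z hz
    exact abs_cayley_le (by positivity)
  have hm (s : ℝ) : AEStronglyMeasurable (fun z => cayley (Real.exp s * V z)) ν :=
    (measurable_cayley.comp (by fun_prop)).aestronglyMeasurable
  have hlim {l : Filter ℝ} [l.IsCountablyGenerated] {g : Z → ℝ}
      (h : ∀ᵐ z ∂ν, Tendsto (fun s => cayley (Real.exp s * V z)) l (𝓝 (g z))) :
      Tendsto (fun s => ∫ z, cayley (Real.exp s * V z) ∂ν) l (𝓝 (∫ z, g z ∂ν)) :=
    tendsto_integral_filter_of_dominated_convergence (fun _ => 1) (Eventually.of_forall hm)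
      (Eventually.of_forall hb) (integrable_const 1) h
  have hcont : Continuous fun s => ∫ z, cayley (Real.exp s * V z) ∂ν := by
    refine continuous_iff_continuousAt.2 fun s => hlim ?_
    filter_upwards [hpos] with z hz
    have : ContinuousAt (fun s => cayley (Real.exp s * V z)) s := by
      unfold cayley
      refine ContinuousAt.div (by fun_prop) (by fun_prop) (by positivity)
    exact this
  have htop : Tendsto (fun s => ∫ z, cayley (Real.exp s * V z) ∂ν) atTop (𝓝 1) := by
    have h := hlim (l := atTop) (g := fun _ => 1) ?_
    · simpa using h
    filter_upwards [hpos] with z hz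
    have h1 : Tendsto (fun s => Real.exp s * V z + 1) atTop atTop :=
      tendsto_atTop_add_const_right _ _ (Real.tendsto_exp_atTop.atTop_mul_const hz)
    have h2 := (h1.const_div_atTop 2).const_sub 1
    rw [sub_zero] at h2
    refine h2.congr fun s => (cayley_eq (by positivity)).symm
  have hbot : Tendsto (fun s => ∫ z, cayley (Real.exp s * V z) ∂ν) atBot (𝓝 (-1)) := by
    have h := hlim (l := atBot) (g := fun _ => -1) ?_
    · simpa using h
    filter_upwards [hpos] with z hz
    have h1 : Tendsto (fun s => Real.exp s * V z) atBot (𝓝 (0 * V z)) :=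
      Real.tendsto_exp_atBot.mul_const _
    rw [zero_mul] at h1
    have h2 := (h1.sub_const 1).div (h1.add_const 1) (by norm_num)
    norm_num at h2
    exact h2
  obtain ⟨s, hs⟩ := mem_range_of_exists_le_of_exists_ge hcont
    (hbot.eventually_le_const (by norm_num : (-1 : ℝ) < 0)).exists
    (htop.eventually_const_le (by norm_num : (0 : ℝ) < 1)).exists
  exact ⟨Real.exp s, Real.exp_pos s, hs⟩

end AsymptoticUniqueness

/-! ### Couplings with asymptotically factorized densities -/

section AsymptoticUniqueness

variable {X Y : Type*} [MeasurableSpace X] [MeasurableSpace Y]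

lemma tendsto_lintegral_enorm_of_integral_abs {μ : Measure X} {f : ℕ → X → ℝ}
    (hf : ∀ k, Integrable (f k) μ) (hl : Tendsto (fun k => ∫ x, |f k x| ∂μ) atTop (𝓝 0)) :
    Tendsto (fun k => ∫⁻ x, ‖f k x‖ₑ ∂μ) atTop (𝓝 0) := by
  have := ENNReal.tendsto_ofReal hl
  rw [ENNReal.ofReal_zero] at this
  refine this.congr fun k => ?_
  rw [← ofReal_integral_norm_eq_lintegral_enorm (hf k)]
  rfl

/-- If the densities `ρ l` of couplings of the marginals of `π` are asymptotically of product
form, then they converge to `1` almost everywhere along a subsequence. -/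
theorem exists_subseq_rnDeriv_tendsto_one {π : Measure (X × Y)} [IsProbabilityMeasure π]
    (hprod : (π.map Prod.fst).prod (π.map Prod.snd) ≪ π)
    {πl : ℕ → Measure (X × Y)} [∀ l, IsProbabilityMeasure (πl l)] (hac : ∀ l, πl l ≪ π)
    (hfst : ∀ l, (πl l).map Prod.fst = π.map Prod.fst)
    (hsnd : ∀ l, (πl l).map Prod.snd = π.map Prod.snd)
    {C : ℝ≥0∞} (hC : C ≠ ∞) (hKL : ∀ l, klDiv (πl l) π ≤ C)
    {U : ℕ → X → ℝ} {V : ℕ → Y → ℝ} (hUm : ∀ l, Measurable (U l)) (hVm : ∀ l, Measurable (V l))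
    (hU : ∀ l, ∀ᵐ x ∂(π.map Prod.fst), 0 < U l x) (hV : ∀ l, ∀ᵐ y ∂(π.map Prod.snd), 0 < V l y)
    (hlim : ∀ᵐ z ∂π, Tendsto (fun l => ((πl l).rnDeriv π z).toReal - U l z.1 * V l z.2)
      atTop (𝓝 0)) :
    ∃ ns : ℕ → ℕ, StrictMono ns ∧
      ∀ᵐ z ∂π, Tendsto (fun k => ((πl (ns k)).rnDeriv π z).toReal) atTop (𝓝 1) := by
  set p₀ := π.map Prod.fst with hp₀
  set p₁ := π.map Prod.snd with hp₁
  have : IsProbabilityMeasure p₀ := Measure.isProbabilityMeasure_map (by fun_prop)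
  have : IsProbabilityMeasure p₁ := Measure.isProbabilityMeasure_map (by fun_prop)
  choose c hc hcV using fun l => exists_scale (hVm l) (hV l)
  let u (l : ℕ) (x : X) : ℝ := U l x / c l
  let v (l : ℕ) (y : Y) : ℝ := c l * V l y
  have hu (l : ℕ) : ∀ᵐ x ∂p₀, 0 < u l x := by
    filter_upwards [hU l] with x hx using div_pos hx (hc l)
  have hv (l : ℕ) : ∀ᵐ y ∂p₁, 0 < v l y := by
    filter_upwards [hV l] with y hy using mul_pos (hc l) hy
  have huv (l : ℕ) (x : X) (y : Y) : U l x * V l y = u l x * v l y := by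
    have := (hc l).ne'
    simp only [u, v]; field_simp
  have hum (l : ℕ) : Measurable (u l) := (hUm l).div_const _
  have hvm (l : ℕ) : Measurable (v l) := (hVm l).const_mul _
  have hφm (l : ℕ) : Measurable fun x => cayley (u l x) := measurable_cayley.comp (hum l)
  have hψm (l : ℕ) : Measurable fun y => cayley (v l y) := measurable_cayley.comp (hvm l)
  have hφb (l : ℕ) : ∀ᵐ x ∂p₀, ‖cayley (u l x)‖ ≤ 1 := by
    filter_upwards [hu l] with x hx using abs_cayley_le hx.le
  have hψb (l : ℕ) : ∀ᵐ y ∂p₁, ‖cayley (v l y)‖ ≤ 1 := by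
    filter_upwards [hv l] with y hy using abs_cayley_le hy.le
  have hφi (l : ℕ) : Integrable (fun x => cayley (u l x)) p₀ :=
    Integrable.of_bound (hφm l).aestronglyMeasurable 1 (hφb l)
  have hψi (l : ℕ) : Integrable (fun y => cayley (v l y)) p₁ :=
    Integrable.of_bound (hψm l).aestronglyMeasurable 1 (hψb l)
  let s (l : ℕ) (z : X × Y) : ℝ := cayley (u l z.1) + cayley (v l z.2)
  let ρ (l : ℕ) (z : X × Y) : ℝ := ((πl l).rnDeriv π z).toReal
  have hsm (l : ℕ) : Measurable (s l) :=
    ((hφm l).comp measurable_fst).add ((hψm l).comp measurable_snd)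
  have hρm (l : ℕ) : Measurable (ρ l) := (Measure.measurable_rnDeriv _ _).ennreal_toReal
  have hρ0 (l : ℕ) (z : X × Y) : 0 ≤ ρ l z := ENNReal.toReal_nonneg
  -- the test functions do not distinguish `πl l` and `π`
  have hgen (l : ℕ) (μ : Measure (X × Y)) (h1 : μ.map Prod.fst = p₀) (h2 : μ.map Prod.snd = p₁) :
      Integrable (s l) μ ∧ ∫ z, s l z ∂μ = ∫ x, cayley (u l x) ∂p₀ + ∫ y, cayley (v l y) ∂p₁ := by
    have i1 : Integrable (fun z : X × Y => cayley (u l z.1)) μ :=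
      Integrable.comp_measurable (f := Prod.fst) (by rw [h1]; exact hφi l) measurable_fst
    have i2 : Integrable (fun z : X × Y => cayley (v l z.2)) μ :=
      Integrable.comp_measurable (f := Prod.snd) (by rw [h2]; exact hψi l) measurable_snd
    refine ⟨i1.add i2, ?_⟩
    simp only [s]
    rw [integral_add i1 i2, ← h1, ← h2, integral_map (by fun_prop) (hφm l).aestronglyMeasurable,
      integral_map (by fun_prop) (hψm l).aestronglyMeasurable]
  have hpos : ∀ l, ∀ᵐ z ∂π, 0 < u l z.1 ∧ 0 < v l z.2 := fun l =>
    (ae_of_ae_map measurable_fst.aemeasurable (hu l)).and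
      (ae_of_ae_map measurable_snd.aemeasurable (hv l))
  -- The integral of `h l` is zero because `πl l` and `π` have the same marginals, whereas for an
  -- exact product `ρ = u v` it would be nonnegative. Asymptotically both hold, and this squeezes
  -- `s`.
  let h (l : ℕ) (z : X × Y) : ℝ := s l z * (ρ l z - 1)
  have hhm (l : ℕ) : Measurable (h l) := (hsm l).mul ((hρm l).sub_const 1)
  have hh (l : ℕ) : Integrable (h l) π ∧ ∫ z, h l z ∂π = 0 := by
    obtain ⟨i1, e1⟩ := hgen l π rfl rfl
    obtain ⟨i2, e2⟩ := hgen l (πl l) (hfst l) (hsnd l)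
    have i3 : Integrable (fun z => ρ l z * s l z) π := (integrable_rnDeriv_smul_iff (hac l)).2 i2
    have e3 : ∫ z, ρ l z * s l z ∂π = ∫ z, s l z ∂(πl l) := integral_rnDeriv_smul (hac l)
    have he : h l = fun z => ρ l z * s l z - s l z := by
      ext z; simp only [h]; ring
    rw [he]
    exact ⟨i3.sub i1, by rw [integral_sub i3 i1, e3, e1, e2, sub_self]⟩
  have hkey (l : ℕ) : ∀ᵐ z ∂π, |s l z| ≤ 2 ∧
      (s l z) ^ 2 ≤ 2 * (s l z * (u l z.1 * v l z.2 - 1)) := by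
    filter_upwards [hpos l] with z hz
    have h1 := abs_cayley_le hz.1.le
    have h2 := abs_cayley_le hz.2.le
    refine ⟨(abs_add_le _ _).trans (by linarith), ?_⟩
    simp only [s]
    rw [cayley_add_cayley hz.1.le hz.2.le]
    set S := u l z.1 * v l z.2 with hS
    have hS0 : 0 < S := mul_pos hz.1 hz.2
    -- With `d` this denominator, `s = 2(S - 1)/d`, so `s²` and `2 s (S - 1)` differ only by a
    -- factor `d ≥ 1`.
    have hd : 1 ≤ (1 + u l z.1) * (1 + v l z.2) := by nlinarith [hz.1, hz.2]
    set d := (1 + u l z.1) * (1 + v l z.2)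
    have hd0 : 0 < d := by linarith
    have e1 : (2 * (S - 1) / d) ^ 2 = 4 * (S - 1) ^ 2 / d / d := by field_simp; ring
    have e2 : 2 * (2 * (S - 1) / d * (S - 1)) = 4 * (S - 1) ^ 2 / d := by field_simp; ring
    rw [e1, e2]
    exact div_le_self (by positivity) hd
  -- Since `s (u v - 1) ≥ 0` and `|s| ≤ 2`, one has `-h ≤ 2 |ρ - u v|`, which tends to zero
  -- pointwise; the entropy bound gives uniform integrability.
  have hneg : Tendsto (fun l => ∫⁻ z, ENNReal.ofReal (-h l z) ∂π) atTop (𝓝 0) := by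
    have h1 := tendsto_lintegral_of_klFun_bound (μ := π) (ρ := ρ) (f := fun l z => max (-h l z) 0)
      hC hρm (fun l => (hhm l).neg.max measurable_const) ?_ ?_ ?_
    · simpa [ENNReal.ofReal_max] using h1
    · intro l
      filter_upwards [hkey l] with z hz
      refine max_le ?_ (by have := hρ0 l z; linarith)
      calc -h l z ≤ |s l z| * |ρ l z - 1| := by rw [← abs_mul]; exact neg_le_abs _
        _ ≤ 2 * (ρ l z + 1) := by
          gcongr
          · exact hz.1
          · rw [abs_le]; constructor <;> linarith [hρ0 l z]
        _ = _ := by ring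
    · intro l
      rw [← klDiv_eq_lintegral_klFun_of_ac (hac l)]
      exact hKL l
    · filter_upwards [hlim, ae_all_iff.2 hkey] with z hz hk
      have hz2 := (hz.abs.const_mul 2)
      rw [abs_zero, mul_zero] at hz2
      refine squeeze_zero (fun l => le_max_right _ _) (fun l => max_le ?_ (by positivity)) hz2
      obtain ⟨h1, h2⟩ := hk l
      rw [huv]
      have h3 : 0 ≤ s l z * (u l z.1 * v l z.2 - 1) := by nlinarith [sq_nonneg (s l z)]
      have h4 : -(s l z * (ρ l z - u l z.1 * v l z.2)) ≤ 2 * |ρ l z - u l z.1 * v l z.2| := by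
        refine (neg_le_abs _).trans ?_
        rw [abs_mul]
        gcongr
      simp only [h]
      calc -(s l z * (ρ l z - 1)) = -(s l z * (ρ l z - u l z.1 * v l z.2)) -
            s l z * (u l z.1 * v l z.2 - 1) := by ring
        _ ≤ 2 * |ρ l z - u l z.1 * v l z.2| := by linarith
  -- A function with zero integral has positive and negative parts of the same mass.
  have habs : Tendsto (fun l => ∫⁻ z, ‖h l z‖ₑ ∂π) atTop (𝓝 0) := by
    have h1 (l : ℕ) : ∫⁻ z, ‖h l z‖ₑ ∂π = 2 * ∫⁻ z, ENNReal.ofReal (-h l z) ∂π := by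
      obtain ⟨hi, h0⟩ := hh l
      have e1 : ∫⁻ z, ENNReal.ofReal (h l z) ∂π = ∫⁻ z, ENNReal.ofReal (-h l z) ∂π := by
        rw [integral_eq_lintegral_pos_part_sub_lintegral_neg_part hi, sub_eq_zero,
          ENNReal.toReal_eq_toReal_iff' hi.lintegral_lt_top.ne
            (Integrable.lintegral_lt_top (f := fun z => -h l z) hi.neg).ne] at h0
        exact h0
      calc ∫⁻ z, ‖h l z‖ₑ ∂π
          = ∫⁻ z, (ENNReal.ofReal (h l z) + ENNReal.ofReal (-h l z)) ∂π := by
            refine lintegral_congr fun z => ?_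
            rw [Real.enorm_eq_ofReal_abs]
            rcases le_total 0 (h l z) with h | h
            · rw [abs_of_nonneg h, ENNReal.ofReal_of_nonpos (by linarith : -_ ≤ (0 : ℝ)), add_zero]
            · rw [abs_of_nonpos h, ENNReal.ofReal_of_nonpos h, zero_add]
        _ = _ := by
            rw [lintegral_add_left (hhm l).ennreal_ofReal, e1, two_mul]
    simp only [h1]
    have := ENNReal.Tendsto.const_mul (a := 2) hneg (Or.inr (by norm_num))
    simpa using this
  obtain ⟨n1, hn1, hlim1⟩ := exists_subseq_ae_tendsto_zero
    (fun l => (hhm l).aestronglyMeasurable) habs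
  -- From `s² ≤ 2 s (u v - 1) = 2 h - 2 s (ρ - u v)`.
  have hs0 : ∀ᵐ z ∂π, Tendsto (fun k => s (n1 k) z) atTop (𝓝 0) := by
    filter_upwards [hlim1, hlim, ae_all_iff.2 hkey] with z h1 h2 h3
    have h4 : Tendsto (fun k => 2 * (h (n1 k) z + 2 * |ρ (n1 k) z -
        U (n1 k) z.1 * V (n1 k) z.2|)) atTop (𝓝 0) := by
      have := (h1.add ((h2.comp hn1.tendsto_atTop).abs.const_mul 2)).const_mul 2
      simpa using this
    have h5 : Tendsto (fun k => (s (n1 k) z) ^ 2) atTop (𝓝 0) := by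
      refine squeeze_zero (fun k => sq_nonneg _) (fun k => ?_) h4
      obtain ⟨h6, h7⟩ := h3 (n1 k)
      refine h7.trans ?_
      rw [huv]
      set S := u (n1 k) z.1 * v (n1 k) z.2
      have h8 : -(s (n1 k) z * (ρ (n1 k) z - S)) ≤ 2 * |ρ (n1 k) z - S| := by
        refine (neg_le_abs _).trans ?_
        rw [abs_mul]
        gcongr
      have h9 : s (n1 k) z * (S - 1) = h (n1 k) z - s (n1 k) z * (ρ (n1 k) z - S) := by
        simp only [h]; ring
      rw [h9]; linarith
    have h6 := h5.sqrt
    simp only [Real.sqrt_sq_eq_abs, Real.sqrt_zero] at h6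
    exact (tendsto_zero_iff_abs_tendsto_zero _).2 h6
  -- the two parts of the test function converge to zero
  have hsi (k : ℕ) : Integrable (s k) (p₀.prod p₁) := (hgen k _ (by simp) (by simp)).1
  -- Here `hprod` is essential: the convergence holds `π`-a.e. and must pass to the product measure,
  -- under which the two variables can be separated.
  have hsint : Tendsto (fun k => ∫ z, |s (n1 k) z| ∂(p₀.prod p₁)) atTop (𝓝 0) := by
    have h0 : (0 : ℝ) = ∫ _, 0 ∂(p₀.prod p₁) := by simp
    rw [h0]
    refine tendsto_integral_of_dominated_convergence (fun _ => 2)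
      (fun k => (hsm _).abs.aestronglyMeasurable) (integrable_const 2) (fun k => ?_) ?_
    · filter_upwards [hprod.ae_le (hkey (n1 k))] with z hz
      rw [Real.norm_eq_abs, abs_abs]; exact hz.1
    · filter_upwards [hprod.ae_le hs0] with z hz
      simpa using hz.abs
  have hφint : Tendsto (fun k => ∫ x, |cayley (u (n1 k) x)| ∂p₀) atTop (𝓝 0) := by
    refine squeeze_zero (fun k => integral_nonneg fun x => abs_nonneg _) (fun k => ?_) hsint
    rw [integral_prod _ (hsi (n1 k)).abs]
    refine integral_mono (hφi (n1 k)).abs (hsi (n1 k)).abs.integral_prod_left fun x => ?_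
    -- The normalization by `c` removes the term in `v`.
    have h1 : ∫ y, s (n1 k) (x, y) ∂p₁ = cayley (u (n1 k) x) := by
      simp only [s]
      rw [integral_add (integrable_const _) (hψi (n1 k)), hcV, integral_const]
      simp
    simp only
    rw [← h1]
    exact abs_integral_le_integral_abs
  have hψint : Tendsto (fun k => ∫ y, |cayley (v (n1 k) y)| ∂p₁) atTop (𝓝 0) := by
    refine squeeze_zero (fun k => integral_nonneg fun x => abs_nonneg _) (fun k => ?_)
      (by simpa using hsint.add hφint)
    have i1 : Integrable (fun z : X × Y => |cayley (u (n1 k) z.1)|) (p₀.prod p₁) :=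
      (hφi (n1 k)).abs.comp_fst p₁
    have i2 : Integrable (fun z : X × Y => |cayley (v (n1 k) z.2)|) (p₀.prod p₁) :=
      (hψi (n1 k)).abs.comp_snd p₀
    have e1 : ∫ x, |cayley (u (n1 k) x)| ∂p₀ =
        ∫ z : X × Y, |cayley (u (n1 k) z.1)| ∂(p₀.prod p₁) := by
      rw [integral_prod _ i1]; simp
    have e2 : ∫ y, |cayley (v (n1 k) y)| ∂p₁ =
        ∫ z : X × Y, |cayley (v (n1 k) z.2)| ∂(p₀.prod p₁) := by
      rw [integral_prod _ i2]; simp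
    rw [e1, e2, ← integral_add (hsi (n1 k)).abs i1]
    refine integral_mono i2 ((hsi (n1 k)).abs.add i1) fun z => ?_
    have : cayley (v (n1 k) z.2) = s (n1 k) z - cayley (u (n1 k) z.1) := by simp [s]
    simp only
    rw [this]
    exact abs_sub _ _
  obtain ⟨n2, hn2, hlim2⟩ := exists_subseq_ae_tendsto_zero
    (fun k => (hφm (n1 k)).aestronglyMeasurable) (tendsto_lintegral_enorm_of_integral_abs (fun k => hφi (n1 k)) hφint)
  obtain ⟨n3, hn3, hlim3⟩ := exists_subseq_ae_tendsto_zero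
    (fun k => (hψm (n1 (n2 k))).aestronglyMeasurable)
    (tendsto_lintegral_enorm_of_integral_abs (fun k => hψi (n1 (n2 k))) (hψint.comp hn2.tendsto_atTop))
  refine ⟨fun k => n1 (n2 (n3 k)), hn1.comp (hn2.comp hn3), ?_⟩
  filter_upwards [hlim, ae_of_ae_map (by fun_prop) hlim2, ae_of_ae_map (by fun_prop) hlim3,
    ae_all_iff.2 hpos] with z h1 h2 h3 h4
  have h5 : Tendsto (fun k => u (n1 (n2 (n3 k))) z.1) atTop (𝓝 1) :=
    tendsto_one_of_cayley (fun k => (h4 _).1.le) (h2.comp hn3.tendsto_atTop)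
  have h6 : Tendsto (fun k => v (n1 (n2 (n3 k))) z.2) atTop (𝓝 1) :=
    tendsto_one_of_cayley (fun k => (h4 _).2.le) h3
  have h7 := (h1.comp (hn1.comp (hn2.comp hn3)).tendsto_atTop).add (h5.mul h6)
  norm_num at h7
  refine h7.congr fun k => ?_
  simp only [huv]
  ring

end AsymptoticUniqueness

/-! ### From convergence of densities to convergence of divergences, and back -/

section FatouForEntropy

variable {Ω Z : Type*} [MeasurableSpace Ω] [MeasurableSpace Z]

/-- Fatou for the nonnegative functions `ρ (H - L)`: with `A` the constant value of `∫ ρ H`, the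
limit inferior of `A - ∫ ρ L` is at least `A`. So `∫ ρ L` has nonpositive limit superior, and it is
nonnegative by hypothesis. Only an upper bound on `L` is needed. -/
lemma tendsto_integral_mul_of_le {μ : Measure Ω} {ρ L : ℕ → Ω → ℝ} {H : Ω → ℝ}
    (hρ0 : ∀ l ω, 0 ≤ ρ l ω) (hρm : ∀ l, Measurable (ρ l)) (hLm : ∀ l, Measurable (L l))
    (hHm : Measurable H)
    (hρ : ∀ᵐ ω ∂μ, Tendsto (fun l => ρ l ω) atTop (𝓝 1))
    (hL : ∀ᵐ ω ∂μ, Tendsto (fun l => L l ω) atTop (𝓝 0))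
    (hle : ∀ l, ∀ᵐ ω ∂μ, L l ω ≤ H ω) (hH : Integrable H μ) (hH0 : ∀ ω, 0 ≤ H ω)
    (hρH : ∀ l, Integrable (fun ω => ρ l ω * H ω) μ)
    (hρL : ∀ l, Integrable (fun ω => ρ l ω * L l ω) μ)
    (he : ∀ l, ∫ ω, ρ l ω * H ω ∂μ = ∫ ω, H ω ∂μ) (h0 : ∀ l, 0 ≤ ∫ ω, ρ l ω * L l ω ∂μ) :
    Tendsto (fun l => ∫ ω, ρ l ω * L l ω ∂μ) atTop (𝓝 0) := by
  set A := ∫ ω, H ω ∂μ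
  set K := fun l => ∫ ω, ρ l ω * L l ω ∂μ
  have hfe (l : ℕ) : ∫⁻ ω, ENNReal.ofReal (ρ l ω * (H ω - L l ω)) ∂μ = ENNReal.ofReal (A - K l) := by
    have e : (fun ω => ρ l ω * (H ω - L l ω)) = fun ω => ρ l ω * H ω - ρ l ω * L l ω := by
      ext ω; ring
    have hi : Integrable (fun ω => ρ l ω * (H ω - L l ω)) μ := by
      rw [e]; exact (hρH l).sub (hρL l)
    have hn : 0 ≤ᵐ[μ] fun ω => ρ l ω * (H ω - L l ω) := by
      filter_upwards [hle l] with ω hω using mul_nonneg (hρ0 l ω) (by linarith)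
    rw [← ofReal_integral_eq_lintegral_ofReal hi hn, e, integral_sub (hρH l) (hρL l), he]
  have hfat : ENNReal.ofReal A ≤ liminf (fun l => ENNReal.ofReal (A - K l)) atTop := by
    simp only [← hfe]
    have hA : ENNReal.ofReal A = ∫⁻ ω, ENNReal.ofReal (H ω) ∂μ :=
      ofReal_integral_eq_lintegral_ofReal hH (ae_of_all _ hH0)
    rw [hA]
    refine le_trans (lintegral_mono_ae ?_) (lintegral_liminf_le (fun l => by
      have := hρm l; have := hLm l; fun_prop))
    filter_upwards [hρ, hL] with ω h1 h2
    have h3 : Tendsto (fun l => ENNReal.ofReal (ρ l ω * (H ω - L l ω))) atTop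
        (𝓝 (ENNReal.ofReal (1 * (H ω - 0)))) :=
      ENNReal.tendsto_ofReal (h1.mul (tendsto_const_nhds.sub h2))
    rw [h3.liminf_eq, one_mul, sub_zero]
  rw [Metric.tendsto_atTop]
  by_contra! hcon
  obtain ⟨ε, hε, hfr⟩ := hcon
  have hK (l : ℕ) : dist (K l) 0 = K l := by
    rw [Real.dist_eq, sub_zero, abs_of_nonneg (h0 l)]
  have hfreq : ∃ᶠ l in atTop, ENNReal.ofReal (A - K l) ≤ ENNReal.ofReal (A - ε) := by
    rw [frequently_atTop]
    intro n
    obtain ⟨l, hl, h⟩ := hfr n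
    rw [hK] at h
    exact ⟨l, hl, ENNReal.ofReal_le_ofReal (by linarith)⟩
  have h1 := hfat.trans (liminf_le_of_frequently_le' hfreq)
  -- `ENNReal.ofReal` truncates at zero, so comparing `A` with `A - ε` requires the latter to be
  -- nonnegative.
  have hAε : ε ≤ A := by
    obtain ⟨l, _, h⟩ := hfr 0
    rw [hK] at h
    have h2 : 0 ≤ A - K l := by
      rw [← he l, ← integral_sub (hρH l) (hρL l)]
      refine integral_nonneg_of_ae ?_
      filter_upwards [hle l] with ω hω
      have := mul_le_mul_of_nonneg_left hω (hρ0 l ω)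
      simp only [Pi.zero_apply]
      linarith
    linarith
  rw [ENNReal.ofReal_le_ofReal_iff (by linarith)] at h1
  linarith

/-- The density of the images, composed with `g`, is the conditional expectation of the density
given `g`, and conditional expectation contracts `L¹`. -/
lemma integral_abs_rnDeriv_map_sub_one_le {μ ν : Measure Ω} [IsProbabilityMeasure μ]
    [IsProbabilityMeasure ν] (hac : ν ≪ μ) {g : Ω → Z} (hg : Measurable g) :
    ∫ ω, |((ν.map g).rnDeriv (μ.map g) (g ω)).toReal - 1| ∂μ ≤
      ∫ ω, |(ν.rnDeriv μ ω).toReal - 1| ∂μ := by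
  have : IsProbabilityMeasure (μ.map g) := Measure.isProbabilityMeasure_map hg.aemeasurable
  refine le_trans (le_of_eq ?_) (integral_abs_condExp_le (m := MeasurableSpace.comap g inferInstance)
    (fun ω => (ν.rnDeriv μ ω).toReal - 1))
  refine integral_congr_ae ?_
  have h1 : μ[(fun ω => (ν.rnDeriv μ ω).toReal) - (fun _ => (1 : ℝ)) |
      MeasurableSpace.comap g inferInstance] =ᵐ[μ] _ :=
    condExp_sub Measure.integrable_toReal_rnDeriv (integrable_const (1 : ℝ)) _
  rw [condExp_const hg.comap_le] at h1
  filter_upwards [toReal_rnDeriv_map hac hg, h1] with ω h2 h3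
  have h4 : (fun ω => (ν.rnDeriv μ ω).toReal - 1) =
    (fun ω => (ν.rnDeriv μ ω).toReal) - (fun _ => (1 : ℝ)) := rfl
  rw [h2, h4, h3]
  rfl

/-- If the densities `dν l / dμ` converge to `1` and the log-densities of the `g`-marginals are
dominated by a function with constant integral, then the divergences of the `g`-marginals converge
to `0` along a subsequence. -/
theorem exists_subseq_klDiv_map_tendsto_zero {μ : Measure Ω} [IsProbabilityMeasure μ]
    {ν : ℕ → Measure Ω} [∀ l, IsProbabilityMeasure (ν l)] {g : Ω → Z} (hg : Measurable g)
    {C : ℝ≥0∞} (hC : C ≠ ∞) (hKL : ∀ l, klDiv (ν l) μ ≤ C)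
    (hρ : ∀ᵐ ω ∂μ, Tendsto (fun l => ((ν l).rnDeriv μ ω).toReal) atTop (𝓝 1))
    {H : Ω → ℝ} (hHm : Measurable H) (hH0 : ∀ ω, 0 ≤ H ω) (hHμ : Integrable H μ)
    (hHν : ∀ l, Integrable H (ν l)) (hHe : ∀ l, ∫ ω, H ω ∂(ν l) = ∫ ω, H ω ∂μ)
    (hle : ∀ l, ∀ᵐ ω ∂μ, llr ((ν l).map g) (μ.map g) (g ω) ≤ H ω) :
    ∃ ns : ℕ → ℕ, StrictMono ns ∧
      Tendsto (fun k => klDiv ((ν (ns k)).map g) (μ.map g)) atTop (𝓝 0) := by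
  have hKL' (l : ℕ) : klDiv (ν l) μ < ∞ := (hKL l).trans_lt hC.lt_top
  have hac (l : ℕ) : ν l ≪ μ := ac_of_klDiv_lt_top (hKL' l)
  have hp (l : ℕ) : IsProbabilityMeasure ((ν l).map g) :=
    Measure.isProbabilityMeasure_map hg.aemeasurable
  have hp' : IsProbabilityMeasure (μ.map g) := Measure.isProbabilityMeasure_map hg.aemeasurable
  let ρ (l : ℕ) (ω : Ω) : ℝ := ((ν l).rnDeriv μ ω).toReal
  let α (l : ℕ) (ω : Ω) : ℝ := (((ν l).map g).rnDeriv (μ.map g) (g ω)).toReal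
  let L (l : ℕ) (ω : Ω) : ℝ := llr ((ν l).map g) (μ.map g) (g ω)
  have hρm (l : ℕ) : Measurable (ρ l) := (Measure.measurable_rnDeriv _ _).ennreal_toReal
  have hαm (l : ℕ) : Measurable (α l) :=
    ((Measure.measurable_rnDeriv _ _).comp hg).ennreal_toReal
  have hLm (l : ℕ) : Measurable (L l) := (measurable_llr _ _).comp hg
  have hρi (l : ℕ) : Integrable (ρ l) μ := Measure.integrable_toReal_rnDeriv
  have hαi (l : ℕ) : Integrable (α l) μ :=
    Integrable.comp_measurable (f := g) Measure.integrable_toReal_rnDeriv hg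
  have hρ1 : Tendsto (fun l => ∫ ω, |ρ l ω - 1| ∂μ) atTop (𝓝 0) := by
    have h1 := tendsto_lintegral_of_klFun_bound (μ := μ) (ρ := ρ) (f := fun l ω => |ρ l ω - 1|)
      hC hρm (fun l => ((hρm l).sub_const 1).abs) ?_ ?_ ?_
    · have h2 := (ENNReal.tendsto_toReal ENNReal.zero_ne_top).comp h1
      refine h2.congr fun l => ?_
      rw [Function.comp_apply, integral_eq_lintegral_of_nonneg_ae (ae_of_all _ fun _ => abs_nonneg _)
        ((hρm l).sub_const 1).abs.aestronglyMeasurable]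
    · intro l
      refine ae_of_all _ fun ω => ?_
      have : 0 ≤ ρ l ω := ENNReal.toReal_nonneg
      rw [abs_le]; constructor <;> linarith
    · intro l
      rw [← klDiv_eq_lintegral_klFun_of_ac (hac l)]
      exact hKL l
    · filter_upwards [hρ] with ω hω
      simpa using (hω.sub_const 1).abs
  have hα1 : Tendsto (fun l => ∫ ω, |α l ω - 1| ∂μ) atTop (𝓝 0) :=
    squeeze_zero (fun l => integral_nonneg fun _ => abs_nonneg _)
      (fun l => integral_abs_rnDeriv_map_sub_one_le (hac l) hg) hρ1
  obtain ⟨ns, hns, hαlim⟩ := exists_subseq_ae_tendsto_zero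
    (f := fun l ω => α l ω - 1) (fun l => ((hαm l).sub_const 1).aestronglyMeasurable)
    (tendsto_lintegral_enorm_of_integral_abs
      (fun l => (hαi l).sub (integrable_const 1)) hα1)
  have hLi (l : ℕ) : Integrable (L l) (ν l) :=
    (integrable_llr_of_klDiv_lt_top ((klDiv_map_le _ _ hg).trans_lt (hKL' l))).comp_measurable hg
  have hK (l : ℕ) : (klDiv ((ν l).map g) (μ.map g)).toReal = ∫ ω, ρ l ω * L l ω ∂μ := by
    rw [toReal_klDiv_of_measure_eq ((hac l).map hg) (by simp),
      integral_map hg.aemeasurable (measurable_llr _ _).aestronglyMeasurable]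
    exact (integral_rnDeriv_smul (hac l)).symm
  refine ⟨ns, hns, ?_⟩
  -- The weight is the density on the full space, while `L` comes from the image; this lets `H` live
  -- on the full space.
  have hmain := tendsto_integral_mul_of_le (μ := μ) (ρ := fun k => ρ (ns k))
    (L := fun k => L (ns k)) (H := H) (fun _ _ => ENNReal.toReal_nonneg) (fun _ => hρm _)
    (fun _ => hLm _) hHm ?_ ?_ (fun k => hle (ns k)) hHμ hH0 ?_ ?_ ?_ ?_
  · simp only [← hK] at hmain
    have h1 := ENNReal.tendsto_ofReal hmain
    rw [ENNReal.ofReal_zero] at h1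
    refine h1.congr fun k => ENNReal.ofReal_toReal ?_
    exact ((klDiv_map_le _ _ hg).trans_lt (hKL' (ns k))).ne
  · filter_upwards [hρ] with ω hω using hω.comp hns.tendsto_atTop
  · filter_upwards [hαlim] with ω hω
    have h1 : Tendsto (fun k => α (ns k) ω) atTop (𝓝 1) := by simpa using hω.add_const 1
    simpa [L, llr, α] using h1.log one_ne_zero
  · exact fun k => (integrable_rnDeriv_smul_iff (hac _)).2 (hHν _)
  · exact fun k => (integrable_rnDeriv_smul_iff (hac _)).2 (hLi _)
  · exact fun k => (integral_rnDeriv_smul (hac _)).trans (hHe _)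
  · exact fun k => (hK (ns k)) ▸ ENNReal.toReal_nonneg

/-- A pointwise Pinsker-type bound, usable when both measures vary. With `x = y²`, `log y ≥ 1 - 1/y`
gives the Hellinger estimate `(y - 1)² ≤ klFun (y²)`, and Young's inequality treats the cross term
in `y² - 1 = (y - 1)² + 2(y - 1)`. The constant `4` is not sharp. -/
lemma abs_sub_one_le_klFun {x η : ℝ} (hx : 0 ≤ x) (hη : 0 < η) :
    |x - 1| ≤ η + (4 + 1 / η) * klFun x := by
  obtain ⟨y, hy, rfl⟩ : ∃ y, 0 ≤ y ∧ x = y ^ 2 := ⟨√x, Real.sqrt_nonneg x, (Real.sq_sqrt hx).symm⟩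
  have hk : (y - 1) ^ 2 ≤ klFun (y ^ 2) := by
    rcases hy.eq_or_lt with rfl | hy
    · simp [klFun_apply]
    rw [klFun_apply, Real.log_pow]
    have h1 := Real.one_sub_inv_le_log_of_pos hy
    have h2 : y ^ 2 * (1 - y⁻¹) ≤ y ^ 2 * Real.log y := by gcongr
    have h3 : y ^ 2 * (1 - y⁻¹) = y ^ 2 - y := by field_simp
    push_cast
    nlinarith
  have h4 : |y ^ 2 - 1| ≤ η + (4 + 1 / η) * (y - 1) ^ 2 := by
    have h5 : y ^ 2 - 1 = (y - 1) ^ 2 + 2 * (y - 1) := by ring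
    have h6 : 2 * |y - 1| ≤ η + 1 / η * (y - 1) ^ 2 := by
      have h7 : 0 ≤ (η - |y - 1|) ^ 2 / η := by positivity
      have h8 : (η - |y - 1|) ^ 2 / η = η - 2 * |y - 1| + 1 / η * (y - 1) ^ 2 := by
        rw [← sq_abs (y - 1)]; field_simp; ring
      linarith
    rw [h5]
    refine (abs_add_le _ _).trans ?_
    rw [abs_of_nonneg (sq_nonneg (y - 1)), abs_mul, abs_two]
    nlinarith [sq_nonneg (y - 1)]
  exact h4.trans (by gcongr)

/-- Convergence in divergence implies convergence in total variation. -/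
lemma tendsto_integral_abs_rnDeriv_sub_one {q r : ℕ → Measure Ω}
    [∀ l, IsProbabilityMeasure (q l)] [∀ l, IsProbabilityMeasure (r l)]
    (hKL : ∀ l, klDiv (q l) (r l) < ∞)
    (h : Tendsto (fun l => klDiv (q l) (r l)) atTop (𝓝 0)) :
    Tendsto (fun l => ∫⁻ ω, ‖((q l).rnDeriv (r l) ω).toReal - 1‖ₑ ∂(r l)) atTop (𝓝 0) := by
  rw [ENNReal.tendsto_nhds_zero]
  intro δ hδ
  obtain ⟨η, hη, hηδ⟩ : ∃ η : ℝ, 0 < η ∧ ENNReal.ofReal η ≤ δ / 2 := by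
    rcases eq_or_ne δ ∞ with rfl | hδt
    · exact ⟨1, one_pos, by simp [ENNReal.top_div_of_ne_top]⟩
    · exact ⟨(δ / 2).toReal, ENNReal.toReal_pos (ENNReal.half_pos hδ.ne').ne'
        (ENNReal.div_ne_top hδt (by norm_num)), ENNReal.ofReal_toReal_le⟩
  have h1 := ENNReal.Tendsto.const_mul (a := ENNReal.ofReal (4 + 1 / η)) h
    (Or.inr ENNReal.ofReal_ne_top)
  rw [mul_zero] at h1
  filter_upwards [ENNReal.tendsto_nhds_zero.1 h1 (δ / 2) (ENNReal.half_pos hδ.ne')] with l hl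
  rw [klDiv_eq_lintegral_klFun_of_ac (ac_of_klDiv_lt_top (hKL l))] at hl
  calc ∫⁻ ω, ‖((q l).rnDeriv (r l) ω).toReal - 1‖ₑ ∂(r l)
      ≤ ∫⁻ ω, (ENNReal.ofReal η + ENNReal.ofReal (4 + 1 / η) *
          ENNReal.ofReal (klFun ((q l).rnDeriv (r l) ω).toReal)) ∂(r l) := by
        refine lintegral_mono fun ω => ?_
        rw [Real.enorm_eq_ofReal_abs, ← ENNReal.ofReal_mul (by positivity),
          ← ENNReal.ofReal_add hη.le
            (mul_nonneg (by positivity) (klFun_nonneg ENNReal.toReal_nonneg))]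
        exact ENNReal.ofReal_le_ofReal (abs_sub_one_le_klFun ENNReal.toReal_nonneg hη)
    _ = ENNReal.ofReal η + ENNReal.ofReal (4 + 1 / η) *
          ∫⁻ ω, ENNReal.ofReal (klFun ((q l).rnDeriv (r l) ω).toReal) ∂(r l) := by
        rw [lintegral_add_left measurable_const, lintegral_const_mul _ (by fun_prop)]
        simp
    _ ≤ δ / 2 + δ / 2 := add_le_add hηδ hl
    _ = δ := ENNReal.add_halves δ

end FatouForEntropy

/-! ### Gaussian densities and the comparison of Gaussian mixtures -/

section Gaussian

variable {D : ℕ} {v : ℝ}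

/-- The normalizing constant of the Gaussian density. -/
noncomputable def gaussianConst (D : ℕ) (v : ℝ) : ℝ := (√(2 * Real.pi * v))⁻¹ ^ D

lemma gaussianConst_pos (hv : 0 < v) : 0 < gaussianConst D v := by
  unfold gaussianConst; positivity

lemma isoGaussianPDF_eq (hv : 0 < v) (m x : E D) :
    isoGaussianPDF m v x =
      ENNReal.ofReal (gaussianConst D v * Real.exp (-(‖x - m‖ ^ 2 / (2 * v)))) := by
  simp only [isoGaussianPDF, gaussianPDF]
  rw [← ENNReal.ofReal_prod_of_nonneg fun j _ => gaussianPDFReal_nonneg _ _ _]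
  congr 1
  simp only [gaussianPDFReal, Real.coe_toNNReal v hv.le]
  rw [Finset.prod_mul_distrib, Finset.prod_const, Finset.card_univ, Fintype.card_fin,
    ← Real.exp_sum, EuclideanSpace.norm_sq_eq, gaussianConst]
  congr 2
  rw [Finset.sum_div, ← Finset.sum_neg_distrib]
  refine Finset.sum_congr rfl fun j _ => ?_
  rw [Real.norm_eq_abs, sq_abs, PiLp.sub_apply]
  ring

lemma isoGaussianPDF_sub (hv : 0 < v) (m x : E D) :
    isoGaussianPDF m v x = isoGaussianPDF 0 v (x - m) := by
  rw [isoGaussianPDF_eq hv, isoGaussianPDF_eq hv, sub_zero]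

lemma isoGaussianPDF_ne_zero (hv : 0 < v) (m x : E D) : isoGaussianPDF m v x ≠ 0 := by
  have := gaussianConst_pos (D := D) hv
  rw [isoGaussianPDF_eq hv]
  exact (ENNReal.ofReal_pos.2 (by positivity)).ne'

lemma isoGaussianPDF_ne_top (hv : 0 < v) (m x : E D) : isoGaussianPDF m v x ≠ ∞ := by
  rw [isoGaussianPDF_eq hv]
  exact ENNReal.ofReal_ne_top

@[fun_prop]
lemma measurable_isoGaussianPDF {Z : Type*} [MeasurableSpace Z] {f g : Z → E D}
    (hf : Measurable f) (hg : Measurable g) :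
    Measurable fun z => isoGaussianPDF (f z) v (g z) := by
  simp only [isoGaussianPDF, gaussianPDF, gaussianPDFReal]
  fun_prop

lemma lintegral_isoGaussianPDF (hv : 0 < v) (m : E D) : ∫⁻ x, isoGaussianPDF m v x = 1 := by
  have hc := gaussianConst_pos (D := D) hv
  simp only [isoGaussianPDF_sub hv m]
  rw [lintegral_sub_right_eq_self (fun x => isoGaussianPDF (0 : E D) v x) m]
  simp only [isoGaussianPDF_eq hv, sub_zero]
  have h1 := GaussianFourier.integral_rexp_neg_mul_sq_norm (V := E D) (b := 1 / (2 * v))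
    (by positivity)
  have h2 : (fun x : E D => Real.exp (-(1 / (2 * v)) * ‖x‖ ^ 2)) =
      fun x => Real.exp (-(‖x‖ ^ 2 / (2 * v))) := by
    ext x; congr 1; ring
  rw [h2] at h1
  have hpos : 0 < (Real.pi / (1 / (2 * v))) ^ ((Module.finrank ℝ (E D) : ℝ) / 2) := by positivity
  -- A nonintegrable function would have Bochner integral zero, but the known value is positive.
  have hint : Integrable fun x : E D => Real.exp (-(‖x‖ ^ 2 / (2 * v))) := by
    by_contra h
    rw [integral_undef h] at h1
    exact hpos.ne h1
  rw [← ofReal_integral_eq_lintegral_ofReal (hint.const_mul _)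
    (ae_of_all _ fun x => by positivity), integral_const_mul, h1, ← ENNReal.ofReal_one]
  congr 1
  have e : Real.pi / (1 / (2 * v)) = 2 * Real.pi * v := by field_simp
  rw [e, finrank_euclideanSpace_fin, gaussianConst, Real.sqrt_eq_rpow, inv_pow, ← Real.rpow_natCast,
    ← Real.rpow_mul (by positivity), one_div_mul_eq_div, inv_mul_cancel₀ (by positivity)]

instance isProbabilityMeasure_isoGaussian [h : Fact (0 < v)] (m : E D) :
    IsProbabilityMeasure (isoGaussian m v) :=
  ⟨by rw [isoGaussian, withDensity_apply _ .univ, Measure.restrict_univ,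
    lintegral_isoGaussianPDF h.out]⟩

/-- The factor `‖x‖²` is at most `4v exp (‖x‖² / (4v))`, which half of the Gaussian exponent
absorbs; a multiple `K` of the density of variance `2v` then dominates. -/
lemma lintegral_sq_mul_isoGaussianPDF_lt_top (hv : 0 < v) :
    ∫⁻ x : E D, ENNReal.ofReal (‖x‖ ^ 2) * isoGaussianPDF 0 v x < ∞ := by
  have hc := gaussianConst_pos (D := D) hv
  have hc2 := gaussianConst_pos (D := D) (v := 2 * v) (by positivity)
  let K := 4 * v * gaussianConst D v / gaussianConst D (2 * v)
  have hK : 0 < K := by positivity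
  calc ∫⁻ x : E D, ENNReal.ofReal (‖x‖ ^ 2) * isoGaussianPDF 0 v x
      ≤ ∫⁻ x : E D, ENNReal.ofReal K * isoGaussianPDF 0 (2 * v) x := by
        refine lintegral_mono fun x => ?_
        rw [isoGaussianPDF_eq hv, isoGaussianPDF_eq (by positivity), sub_zero,
          ← ENNReal.ofReal_mul (by positivity), ← ENNReal.ofReal_mul hK.le]
        refine ENNReal.ofReal_le_ofReal ?_
        have h1 : ‖x‖ ^ 2 / (4 * v) ≤ Real.exp (‖x‖ ^ 2 / (4 * v)) := by
          have := Real.add_one_le_exp (‖x‖ ^ 2 / (4 * v)); linarith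
        have h2 : ‖x‖ ^ 2 ≤ 4 * v * Real.exp (‖x‖ ^ 2 / (4 * v)) := by
          rw [div_le_iff₀ (by positivity)] at h1; linarith
        have h3 : Real.exp (-(‖x‖ ^ 2 / (2 * (2 * v)))) =
            Real.exp (‖x‖ ^ 2 / (4 * v)) * Real.exp (-(‖x‖ ^ 2 / (2 * v))) := by
          rw [← Real.exp_add]; congr 1; field_simp; ring
        have h4 : K * (gaussianConst D (2 * v) * Real.exp (-(‖x‖ ^ 2 / (2 * (2 * v))))) =
            (4 * v * Real.exp (‖x‖ ^ 2 / (4 * v))) *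
              (gaussianConst D v * Real.exp (-(‖x‖ ^ 2 / (2 * v)))) := by
          rw [h3, show K * (gaussianConst D (2 * v) * (Real.exp (‖x‖ ^ 2 / (4 * v)) *
              Real.exp (-(‖x‖ ^ 2 / (2 * v))))) = (K * gaussianConst D (2 * v)) *
              (Real.exp (‖x‖ ^ 2 / (4 * v)) * Real.exp (-(‖x‖ ^ 2 / (2 * v)))) from by ring,
            show K * gaussianConst D (2 * v) = _ from div_mul_cancel₀ _ hc2.ne']
          ring
        rw [h4]
        gcongr
    _ = ENNReal.ofReal K := by
        rw [lintegral_const_mul _ (by fun_prop),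
          lintegral_isoGaussianPDF (by positivity), mul_one]
    _ < ∞ := ENNReal.ofReal_lt_top

/-- The second moment of a centered Gaussian. -/
noncomputable def gaussianMoment (D : ℕ) (v : ℝ) : ℝ≥0∞ :=
  ∫⁻ x : E D, ENNReal.ofReal (‖x‖ ^ 2) * isoGaussianPDF 0 v x

lemma lintegral_sq_sub_mul_isoGaussianPDF (hv : 0 < v) (m : E D) :
    ∫⁻ x : E D, ENNReal.ofReal (‖x - m‖ ^ 2) * isoGaussianPDF m v x = gaussianMoment D v := by
  simp only [isoGaussianPDF_sub hv m]
  exact lintegral_sub_right_eq_self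
    (fun x : E D => ENNReal.ofReal (‖x‖ ^ 2) * isoGaussianPDF 0 v x) m

lemma norm_add_sq_le (x y : E D) : ‖x + y‖ ^ 2 ≤ 2 * ‖x‖ ^ 2 + 2 * ‖y‖ ^ 2 := by
  have h1 := norm_add_le x y
  nlinarith [norm_nonneg (x + y), norm_nonneg x, norm_nonneg y, sq_nonneg (‖x‖ - ‖y‖)]

/-- Gaussian mixtures with the same total mass are comparable, with a bound that involves only the
second moment of one of the mixing measures. -/
lemma log_gaussian_mixture_div_le (hv : 0 < v) {r r' : E D → ℝ≥0∞} (hr : Measurable r)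
    {P : ℝ≥0∞} (hP0 : P ≠ 0) (hPt : P ≠ ∞)
    (hrP : ∫⁻ y, r y = P) (hrP' : ∫⁻ y, r' y = P)
    (hh : ∫⁻ y, ENNReal.ofReal (‖y‖ ^ 2) * (r y / P) < ∞)
    (b : ℝ) (o m y : E D) :
    Real.log ((∫⁻ z, isoGaussianPDF (o + b • z) v m * r' z) /
      (∫⁻ z, isoGaussianPDF (o + b • z) v m * r z)).toReal ≤
    1 / v * ‖m - (o + b • y)‖ ^ 2 + 2 * b ^ 2 / v * ‖y‖ ^ 2 +
      2 * b ^ 2 / v * (∫⁻ z, ENNReal.ofReal (‖z‖ ^ 2) * (r z / P)).toReal := by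
  have hc := gaussianConst_pos (D := D) hv
  set h := (∫⁻ z, ENNReal.ofReal (‖z‖ ^ 2) * (r z / P)).toReal with hh_def
  set A := 1 / v * ‖m - (o + b • y)‖ ^ 2 + 2 * b ^ 2 / v * ‖y‖ ^ 2
  set k := 2 * b ^ 2 / v
  have hk : 0 ≤ k := by positivity
  have hA : 0 ≤ A := by positivity
  have hh0 : 0 ≤ h := ENNReal.toReal_nonneg
  -- Normalizing `r` to a probability measure makes Jensen's inequality available: the average of
  -- `exp (-k ‖z‖²)` is at least `exp (-k h)`, with `h` the second moment.
  let κ : Measure (E D) := volume.withDensity fun z => r z / P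
  have hκ : IsProbabilityMeasure κ := ⟨by
    rw [withDensity_apply _ .univ, Measure.restrict_univ]
    simp only [div_eq_mul_inv]
    rw [lintegral_mul_const _ hr, hrP, ENNReal.mul_inv_cancel hP0 hPt]⟩
  have hint : Integrable (fun z : E D => ‖z‖ ^ 2) κ := by
    refine ⟨by fun_prop, ?_⟩
    rw [hasFiniteIntegral_iff_ofReal (ae_of_all _ fun z => by positivity),
      lintegral_withDensity_eq_lintegral_mul _ (by fun_prop) (by fun_prop)]
    simpa only [Pi.mul_apply, mul_comm] using hh
  have hint_eq : ∫ z, ‖z‖ ^ 2 ∂κ = h := by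
    rw [integral_eq_lintegral_of_nonneg_ae (ae_of_all _ fun z => by positivity) (by fun_prop),
      lintegral_withDensity_eq_lintegral_mul _ (by fun_prop) (by fun_prop), hh_def]
    simp only [Pi.mul_apply, mul_comm]
  have hexp : Integrable (fun z : E D => Real.exp (-k * ‖z‖ ^ 2)) κ := by
    refine Integrable.of_bound (by fun_prop) 1 (ae_of_all _ fun z => ?_)
    rw [Real.norm_eq_abs, Real.abs_exp, Real.exp_le_one_iff]
    have := mul_nonneg hk (sq_nonneg ‖z‖)
    linarith
  have hjensen : Real.exp (-k * h) ≤ ∫ z, Real.exp (-k * ‖z‖ ^ 2) ∂κ := by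
    have := ConvexOn.map_integral_le (μ := κ) (f := fun z : E D => -k * ‖z‖ ^ 2) convexOn_exp
      Real.continuous_exp.continuousOn isClosed_univ (by simp) (hint.const_mul _) hexp
    rwa [integral_const_mul, hint_eq] at this
  have hlow : ENNReal.ofReal (gaussianConst D v * Real.exp (-(A + k * h))) * P ≤
      ∫⁻ z, isoGaussianPDF (o + b • z) v m * r z := by
    calc ENNReal.ofReal (gaussianConst D v * Real.exp (-(A + k * h))) * P
        = ENNReal.ofReal (gaussianConst D v * Real.exp (-A)) * ENNReal.ofReal (Real.exp (-k * h))
            * P := by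
          rw [← ENNReal.ofReal_mul (by positivity), mul_assoc (gaussianConst D v), ← Real.exp_add]
          congr 4; ring
      _ ≤ ENNReal.ofReal (gaussianConst D v * Real.exp (-A)) *
            (∫⁻ z, ENNReal.ofReal (Real.exp (-k * ‖z‖ ^ 2)) * (r z / P)) * P := by
          gcongr
          refine (ENNReal.ofReal_le_ofReal hjensen).trans (le_of_eq ?_)
          rw [ofReal_integral_eq_lintegral_ofReal hexp (ae_of_all _ fun z => by positivity),
            lintegral_withDensity_eq_lintegral_mul _ (by fun_prop) (by fun_prop)]
          simp only [Pi.mul_apply, mul_comm]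
      _ = ∫⁻ z, ENNReal.ofReal (gaussianConst D v * Real.exp (-A)) *
            ENNReal.ofReal (Real.exp (-k * ‖z‖ ^ 2)) * r z := by
          rw [← lintegral_const_mul _ (by fun_prop), ← lintegral_mul_const _ (by fun_prop)]
          refine lintegral_congr fun z => ?_
          rw [div_eq_mul_inv, mul_assoc, mul_assoc, mul_assoc, ENNReal.inv_mul_cancel hP0 hPt,
            mul_one, mul_assoc]
      _ ≤ ∫⁻ z, isoGaussianPDF (o + b • z) v m * r z := by
          refine lintegral_mono fun z => ?_
          gcongr
          rw [isoGaussianPDF_eq hv, ← ENNReal.ofReal_mul (by positivity), mul_assoc,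
            ← Real.exp_add]
          refine ENNReal.ofReal_le_ofReal ?_
          gcongr
          have e : m - (o + b • z) = (m - (o + b • y)) + b • (y - z) := by
            rw [smul_sub]; abel
          have h1 := norm_add_sq_le (m - (o + b • y)) (b • (y - z))
          rw [← e, norm_smul, mul_pow, Real.norm_eq_abs, sq_abs] at h1
          have h2 := norm_add_sq_le y (-z)
          rw [← sub_eq_add_neg, norm_neg] at h2
          have h3 : ‖m - (o + b • z)‖ ^ 2 ≤
              2 * ‖m - (o + b • y)‖ ^ 2 + 2 * (b ^ 2 * (2 * ‖y‖ ^ 2 + 2 * ‖z‖ ^ 2)) := by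
            refine h1.trans ?_
            gcongr
          -- The reference point `y` is free. Passing from `z` to `y` by two uses of `‖x + y‖² ≤
          -- 2‖x‖² + 2‖y‖²` produces the constants in `A` and `k`.
          have h4 : ‖m - (o + b • z)‖ ^ 2 / (2 * v) ≤ A + k * ‖z‖ ^ 2 := by
            rw [div_le_iff₀ (by positivity)]
            refine h3.trans (le_of_eq ?_)
            simp only [A, k]; field_simp; ring
          linarith
  -- For the numerator the maximum of the Gaussian density is enough, so nothing about `r'` but its
  -- mass enters.
  have hup : ∫⁻ z, isoGaussianPDF (o + b • z) v m * r' z ≤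
      ENNReal.ofReal (gaussianConst D v) * P := by
    rw [← hrP', ← lintegral_const_mul' _ _ ENNReal.ofReal_ne_top]
    refine lintegral_mono fun z => ?_
    gcongr
    rw [isoGaussianPDF_eq hv]
    refine ENNReal.ofReal_le_ofReal (mul_le_of_le_one_right hc.le ?_)
    rw [Real.exp_le_one_iff]
    have : 0 ≤ ‖m - (o + b • z)‖ ^ 2 / (2 * v) := by positivity
    linarith
  have hratio : (∫⁻ z, isoGaussianPDF (o + b • z) v m * r' z) /
      (∫⁻ z, isoGaussianPDF (o + b • z) v m * r z) ≤ ENNReal.ofReal (Real.exp (A + k * h)) := by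
    refine (ENNReal.div_le_div hup hlow).trans (le_of_eq ?_)
    rw [ENNReal.mul_div_mul_right _ _ hP0 hPt, ← ENNReal.ofReal_div_of_pos (by positivity)]
    congr 1
    rw [Real.exp_neg]; field_simp
  set ρ := (∫⁻ z, isoGaussianPDF (o + b • z) v m * r' z) /
      (∫⁻ z, isoGaussianPDF (o + b • z) v m * r z)
  have hρ : ρ.toReal ≤ Real.exp (A + k * h) := by
    refine (ENNReal.toReal_mono ENNReal.ofReal_ne_top hratio).trans_eq ?_
    exact ENNReal.toReal_ofReal (Real.exp_pos _).le
  rcases (ENNReal.toReal_nonneg (a := ρ)).eq_or_lt with h0 | h0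
  -- A ratio that is zero, or infinite and read as zero, has logarithm `0` by convention, below the
  -- nonnegative bound.
  · rw [← h0, Real.log_zero]; positivity
  · exact (Real.log_le_log h0 hρ).trans_eq (Real.log_exp _)

end Gaussian

/-! ### Finite-dimensional laws of the Wiener process and Brownian bridges -/

section Wiener

variable {D N : ℕ} {ε : ℝ} {p₀ : Measure (E D)} {W : Measure (PathSpace D)}

@[fun_prop]
lemma measurable_eval (u : unitInterval) : Measurable fun ω : PathSpace D => ω u :=
  (continuous_eval_const u).measurable

/-- The Markov property of the Wiener process over a time step. -/
lemma lintegral_wiener_step (hε : 0 < ε) (hW : IsWienerLaw ε p₀ W) {s t : unitInterval}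
    (hst : s < t) {Z : Type*} [MeasurableSpace Z] {X : PathSpace D → Z}
    {h : (Set.Iic s → E D) → Z} (hh : Measurable h) (hX : ∀ ω, X ω = h fun u => ω u)
    {last : Z → E D} (hlast : Measurable last) (hl : ∀ ω, last (X ω) = ω s)
    {G : Z × E D → ℝ≥0∞} (hG : Measurable G) :
    ∫⁻ ω, G (X ω, ω t) ∂W =
      ∫⁻ z, ∫⁻ b, isoGaussianPDF (last z) (ε * ((t : ℝ) - s)) b * G (z, b)
        ∂volume ∂(W.map X) := by
  have := hW.isProbabilityMeasure
  have hv : 0 < ε * ((t : ℝ) - s) := mul_pos hε (sub_pos.2 hst)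
  set v := ε * ((t : ℝ) - s)
  have hXm : Measurable X := by
    rw [show X = fun ω => h fun u => ω u from funext hX]
    exact hh.comp (measurable_pi_lambda _ fun u => measurable_eval _)
  have hinc : Measurable fun ω : PathSpace D => ω t - ω s := by fun_prop
  have hind : IndepFun X (fun ω => ω t - ω s) W := by
    have h1 := (hW.independent s t hst).comp hh measurable_id
    rwa [show h ∘ (fun (ω : PathSpace D) (u : Set.Iic s) => ω u) = X from (funext hX).symm,
      Function.id_comp] at h1
  rw [indepFun_iff_map_prod_eq_prod_map_map hXm.aemeasurable hinc.aemeasurable,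
    hW.increment s t hst] at hind
  -- The new state is the old one plus an independent Gaussian increment; a translation turns the
  -- increment density into the transition density.
  have hG' : Measurable fun z : Z × E D => G (z.1, last z.1 + z.2) := by fun_prop
  have e1 : ∫⁻ ω, G (X ω, ω t) ∂W =
      ∫⁻ z, G (z.1, last z.1 + z.2) ∂(W.map fun ω => (X ω, ω t - ω s)) := by
    rw [lintegral_map hG' (hXm.prodMk hinc)]
    refine lintegral_congr fun ω => ?_
    simp only
    rw [hl, add_sub_cancel]
  have := Fact.mk hv
  rw [e1, hind, lintegral_prod _ hG'.aemeasurable]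
  refine lintegral_congr fun z => ?_
  simp only
  rw [isoGaussian, lintegral_withDensity_eq_lintegral_mul _ (by fun_prop) (by fun_prop)]
  have e2 (b : E D) : isoGaussianPDF (last z) v b * G (z, b) =
      (fun y => isoGaussianPDF 0 v y * G (z, last z + y)) (b - last z) := by
    simp only
    rw [← isoGaussianPDF_sub hv, add_sub_cancel]
  simp only [e2]
  rw [lintegral_sub_right_eq_self (fun y => isoGaussianPDF 0 v y * G (z, last z + y))]
  rfl

/-- The transition densities of the Wiener process between the times `t i`. -/
noncomputable def wienerKernel (ε : ℝ) {n : ℕ} (t : Fin (n + 1) → unitInterval) (i : Fin n)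
    (a b : E D) : ℝ≥0∞ :=
  isoGaussianPDF a (ε * ((t i.succ : ℝ) - t i.castSucc)) b

lemma measurable_wienerKernel {n : ℕ} (t : Fin (n + 1) → unitInterval) (i : Fin n) :
    Measurable fun z : E D × E D => wienerKernel ε t i z.1 z.2 := by
  unfold wienerKernel; fun_prop

lemma measurable_discretize_map {n : ℕ} (t : Fin n → unitInterval) :
    Measurable fun (ω : PathSpace D) i => ω (t i) :=
  measurable_pi_lambda _ fun _ => measurable_eval _

/-- The finite-dimensional distributions of the Wiener process. -/
lemma discretize_wiener (hε : 0 < ε) (hW : IsWienerLaw ε p₀ W) (hp₀ : p₀ ≪ volume)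
    {n : ℕ} {t : Fin (n + 1) → unitInterval} (ht : StrictMono t) (ht0 : t 0 = 0) :
    discretize t W = volume.withDensity (chainPDF (p₀.rnDeriv volume) (wienerKernel ε t)) := by
  have := hW.isProbabilityMeasure
  have : IsProbabilityMeasure p₀ := by
    rw [← hW.initial]; exact Measure.isProbabilityMeasure_map (measurable_eval 0).aemeasurable
  have hm := Measure.measurable_rnDeriv p₀ volume
  induction n with
  | zero =>
    refine (MeasurableEquiv.funUnique (Fin 1) (E D)).map_measurableEquiv_injective ?_
    have h1 := (map_chain (n := 0) (m := fun _ => p₀.rnDeriv volume) (k := wienerKernel ε t)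
      (fun _ => hm) (fun i => i.elim0) (fun i => i.elim0) (fun i => i.elim0)).1 0
    refine Eq.trans ?_ h1.symm
    rw [Measure.withDensity_rnDeriv_eq _ _ hp₀, ← hW.initial, discretize,
      Measure.map_map (MeasurableEquiv.measurable _) (measurable_discretize_map t), ← ht0]
    rfl
  | succ n ih =>
    have ih' := ih (t := fun i => t i.castSucc) (fun i j h => ht (by simpa using h)) ht0
    refine Measure.ext_of_lintegral _ fun G hG => ?_
    rw [lintegral_chain_snoc hm (measurable_wienerKernel t) hG, discretize,
      lintegral_map hG (measurable_discretize_map t)]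
    have hlt : t (Fin.last n).castSucc < t (Fin.last n).succ := ht Fin.castSucc_lt_succ
    have h1 := lintegral_wiener_step hε hW hlt
      (X := fun ω (i : Fin (n + 1)) => ω (t i.castSucc))
      (h := fun z i => z ⟨t i.castSucc, ht.monotone (by simpa using Fin.le_last i)⟩)
      (measurable_pi_lambda _ fun i => measurable_pi_apply _) (fun ω => rfl)
      (last := fun z => z (Fin.last n)) (measurable_pi_apply _) (fun ω => rfl)
      (G := fun z => G (Fin.snoc z.1 z.2)) (hG.comp measurable_snoc)
    refine Eq.trans (lintegral_congr fun ω => ?_) (h1.trans ?_)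
    · refine congrArg G (funext fun i => ?_)
      change ω (t i) = (Fin.snoc (fun i : Fin (n + 1) => ω (t i.castSucc))
        (ω (t (Fin.last n).succ)) : Fin (n + 2) → E D) i
      induction i using Fin.lastCases with
      | last => rw [Fin.snoc_last (α := fun _ => E D), Fin.succ_last]
      | cast i => rw [Fin.snoc_castSucc (α := fun _ => E D)]
    · rw [show W.map (fun ω (i : Fin (n + 1)) => ω (t i.castSucc)) = _ from ih']
      rfl

/-- The joint law of the Wiener process at two times. -/
lemma map_pair_wiener (hε : 0 < ε) (hW : IsWienerLaw ε p₀ W) {s t : unitInterval} (hst : s < t)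
    (hs : W.map (fun ω => ω s) ≪ volume) :
    W.map (fun ω => (ω s, ω t)) = volume.withDensity fun z =>
      (W.map fun ω => ω s).rnDeriv volume z.1 *
        isoGaussianPDF z.1 (ε * ((t : ℝ) - s)) z.2 := by
  have := hW.isProbabilityMeasure
  have : IsProbabilityMeasure (W.map fun ω => ω s) :=
    Measure.isProbabilityMeasure_map (measurable_eval s).aemeasurable
  refine Measure.ext_of_lintegral _ fun G hG => ?_
  have hm := Measure.measurable_rnDeriv (W.map fun ω => ω s) volume
  have h1 := lintegral_wiener_step hε hW hst (X := fun ω => ω s)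
      (h := fun z => z ⟨s, Set.mem_Iic.2 le_rfl⟩) (measurable_pi_apply _) (fun ω => rfl)
      (last := id) measurable_id (fun ω => rfl) hG
  rw [lintegral_map hG (by fun_prop)]
  refine h1.trans ?_
  rw [lintegral_withDensity_eq_lintegral_mul _ (by fun_prop) hG, Measure.volume_eq_prod,
    lintegral_prod _ (by fun_prop)]
  conv_lhs => rw [← Measure.withDensity_rnDeriv_eq _ _ hs]
  have hmeas : Measurable fun z : E D × E D =>
      isoGaussianPDF z.1 (ε * ((t : ℝ) - s)) z.2 * G z := by fun_prop
  refine (lintegral_withDensity_eq_lintegral_mul _ hm hmeas.lintegral_prod_right').trans ?_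
  refine lintegral_congr fun a => ?_
  refine (lintegral_const_mul _ (hmeas.comp (measurable_prodMk_left (x := a)))).symm.trans ?_
  refine lintegral_congr fun b => ?_
  simp [mul_assoc]

/-- The one-time densities serve as the marginals in `projM_chain`; their compatibility with the
kernels is read off the two-time laws, by uniqueness of densities. -/
lemma projM_discretize_wiener (hε : 0 < ε) (hW : IsWienerLaw ε p₀ W) (hp₀ : p₀ ≪ volume)
    {t : Fin (N + 2) → unitInterval} (ht : StrictMono t) (ht0 : t 0 = 0) :
    projM (discretize t W) = discretize t W := by
  have := hW.isProbabilityMeasure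
  have : IsProbabilityMeasure (discretize t W) :=
    Measure.isProbabilityMeasure_map (measurable_discretize_map t).aemeasurable
  have hw := discretize_wiener hε hW hp₀ ht ht0
  have hac : discretize t W ≪ volume := hw ▸ withDensity_absolutelyContinuous _ _
  have hcl (i : Fin (N + 2)) : coordLaw (discretize t W) i = W.map fun ω => ω (t i) := by
    rw [coordLaw, discretize, Measure.map_map (measurable_pi_apply i) (measurable_discretize_map t)]
    rfl
  let m (i : Fin (N + 2)) : E D → ℝ≥0∞ := (W.map fun ω => ω (t i)).rnDeriv volume
  have hm (i : Fin (N + 2)) : Measurable (m i) := Measure.measurable_rnDeriv _ _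
  have hacs (i : Fin (N + 2)) : W.map (fun ω => ω (t i)) ≪ volume := hcl i ▸ coordLaw_ac hac i
  have hmdef (i : Fin (N + 2)) : m i = (W.map fun ω => ω (t i)).rnDeriv volume := rfl
  have hm0 : m 0 = p₀.rnDeriv volume := by simp only [m]; rw [ht0, hW.initial]
  refine projM_chain (m := m) (k := wienerKernel ε t) hm (measurable_wienerKernel t)
    (fun i => ae_of_all _ fun a _ => ?_) (fun i => ?_) (by rw [hm0]; exact hw)
  · exact lintegral_isoGaussianPDF (mul_pos hε (sub_pos.2 (ht Fin.castSucc_lt_succ))) a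
  · have h1 : W.map (fun ω => (ω (t i.castSucc), ω (t i.succ))) = volume.withDensity fun z =>
        m i.castSucc z.1 * wienerKernel ε t i z.1 z.2 :=
      map_pair_wiener hε hW (ht (Fin.castSucc_lt_succ (i := i))) (hacs i.castSucc)
    clear_value m
    have hf : Measurable fun z : E D × E D => m i.castSucc z.1 * wienerKernel ε t i z.1 z.2 :=
      ((hm _).comp measurable_fst).mul (measurable_wienerKernel t i)
    have h2 : W.map (fun ω => ω (t i.succ)) =
        volume.withDensity fun b => ∫⁻ a, m i.castSucc a * wienerKernel ε t i a b := by
      have e : W.map (fun ω => ω (t i.succ)) =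
          (W.map fun ω => (ω (t i.castSucc), ω (t i.succ))).map Prod.snd := by
        rw [Measure.map_map measurable_snd (by fun_prop)]
        rfl
      rw [e, h1, Measure.volume_eq_prod]
      exact map_snd_withDensity_prod hf
    have hf' : Measurable fun b => ∫⁻ a, m i.castSucc a * wienerKernel ε t i a b :=
      hf.lintegral_prod_left'
    have h3 := Measure.rnDeriv_withDensity (volume : Measure (E D)) hf'
    rw [← h2] at h3
    rw [hmdef i.succ]
    exact h3.symm

lemma gaussianConst_mul (D : ℕ) {v₁ v₂ : ℝ} (h₁ : 0 < v₁) :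
    gaussianConst D v₁ * gaussianConst D v₂ = (√((2 * Real.pi) ^ 2 * (v₁ * v₂)))⁻¹ ^ D := by
  rw [gaussianConst, gaussianConst, ← mul_pow, ← mul_inv, ← Real.sqrt_mul (by positivity)]
  rw [show 2 * Real.pi * v₁ * (2 * Real.pi * v₂) = (2 * Real.pi) ^ 2 * (v₁ * v₂) by ring]

/-- One step of the Brownian bridge as a quotient of Wiener transition densities. -/
lemma bridge_step (hε : 0 < ε) {s u : ℝ} (hsu : s < u) (hu : u < 1) (x z y : E D) :
    isoGaussianPDF x (ε * (1 - s)) y *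
      isoGaussianPDF (x + ((u - s) / (1 - s)) • (y - x)) (ε * ((u - s) * (1 - u) / (1 - s))) z =
    isoGaussianPDF x (ε * (u - s)) z * isoGaussianPDF z (ε * (1 - u)) y := by
  have h1 : 0 < 1 - s := by linarith
  have h2 : 0 < u - s := by linarith
  have h3 : 0 < 1 - u := by linarith
  have hc (v : ℝ) (hv : 0 < v) := gaussianConst_pos (D := D) hv
  have hv1 : 0 < ε * (1 - s) := by positivity
  have hv2 : 0 < ε * ((u - s) * (1 - u) / (1 - s)) := by positivity
  have hv3 : 0 < ε * (u - s) := by positivity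
  have hv4 : 0 < ε * (1 - u) := by positivity
  rw [isoGaussianPDF_eq hv1, isoGaussianPDF_eq hv2, isoGaussianPDF_eq hv3, isoGaussianPDF_eq hv4,
    ← ENNReal.ofReal_mul (mul_pos (hc _ hv1) (Real.exp_pos _)).le,
    ← ENNReal.ofReal_mul (mul_pos (hc _ hv3) (Real.exp_pos _)).le, mul_mul_mul_comm,
    mul_mul_mul_comm (gaussianConst D (ε * (u - s))), ← Real.exp_add, ← Real.exp_add,
    gaussianConst_mul D hv1, gaussianConst_mul D hv3]
  congr 2
  · congr 4; field_simp
  -- The normalizing constants agree since the products of variances do. After translating `x` to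
  -- the origin, the exponents give a quadratic identity in `‖a‖²`, `‖c‖²` and their inner product.
  · obtain ⟨a, rfl⟩ : ∃ a, y = x + a := ⟨y - x, by abel⟩
    obtain ⟨c, rfl⟩ : ∃ c, z = x + c := ⟨z - x, by abel⟩
    rw [add_sub_cancel_left, add_sub_add_left_eq_sub, add_sub_cancel_left,
      add_sub_add_left_eq_sub, norm_sub_sq_real, norm_sub_sq_real, inner_smul_right, norm_smul,
      real_inner_comm a c, Real.norm_of_nonneg (by positivity)]
    congr 1
    field_simp
    ring

/-- The Wiener chain is the product of its endpoint transition and of the Brownian bridge. -/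
lemma prod_wienerKernel (hε : 0 < ε) {t : Fin (N + 2) → unitInterval} (ht : StrictMono t)
    (ht0 : t 0 = 0) (ht1 : t (Fin.last (N + 1)) = 1) (x : Fin (N + 2) → E D) :
    ∏ i : Fin (N + 1), wienerKernel ε t i (x i.castSucc) (x i.succ) =
      isoGaussianPDF (x 0) ε (x (Fin.last (N + 1))) * bridgePDF ε t x := by
  set y := x (Fin.last (N + 1)) with hy
  -- Density of reaching `y` at time `1` from the state at time `t i`. By `bridge_step` each bridge
  -- factor is a Wiener factor times a quotient of consecutive `F`, and the quotients telescope.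
  let F (i : Fin (N + 1)) : ℝ≥0∞ :=
    isoGaussianPDF (x i.castSucc) (ε * (1 - (t i.castSucc : ℝ))) y
  have hlt (i : Fin (N + 1)) : (t i.castSucc : ℝ) < 1 := by
    have : t i.castSucc < t (Fin.last (N + 1)) := ht (Fin.castSucc_lt_last i)
    rw [ht1] at this
    exact this
  have hF0 (i : Fin (N + 1)) : F i ≠ 0 :=
    isoGaussianPDF_ne_zero (mul_pos hε (sub_pos.2 (hlt i))) _ _
  have hFt (i : Fin (N + 1)) : F i ≠ ∞ :=
    isoGaussianPDF_ne_top (mul_pos hε (sub_pos.2 (hlt i))) _ _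
  have h1 : (∏ i : Fin N, F i.castSucc) * bridgePDF ε t x =
      (∏ i : Fin N, wienerKernel ε t i.castSucc (x i.castSucc.castSucc) (x i.castSucc.succ)) *
        ∏ i : Fin N, F i.succ := by
    rw [bridgePDF, ← Finset.prod_mul_distrib, ← Finset.prod_mul_distrib]
    refine Finset.prod_congr rfl fun i _ => ?_
    have hs : (t i.castSucc.castSucc : ℝ) < t i.succ.castSucc :=
      ht (Fin.castSucc_lt_castSucc_iff.2 Fin.castSucc_lt_succ)
    exact bridge_step hε hs (hlt i.succ) (x i.castSucc.castSucc) (x i.succ.castSucc) y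
  have hlast : wienerKernel ε t (Fin.last N) (x (Fin.last N).castSucc) (x (Fin.last N).succ) =
      F (Fin.last N) := by
    simp only [F, wienerKernel, Fin.succ_last, ht1, hy]
    simp
  have hfirst : F 0 = isoGaussianPDF (x 0) ε y := by
    simp only [F, Fin.castSucc_zero, ht0]
    simp
  have hP0 : ∏ i : Fin N, F i.succ ≠ 0 := Finset.prod_ne_zero_iff.2 fun i _ => hF0 _
  have hPt : ∏ i : Fin N, F i.succ ≠ ∞ := ENNReal.prod_ne_top fun i _ => hFt _
  have h2 : (∏ i : Fin N, F i.castSucc) * F (Fin.last N) = F 0 * ∏ i : Fin N, F i.succ := by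
    rw [← Fin.prod_univ_castSucc, Fin.prod_univ_succ]
  rw [Fin.prod_univ_castSucc, hlast, ← hfirst, ← ENNReal.mul_left_inj hP0 hPt]
  calc _ = ((∏ i : Fin N, wienerKernel ε t i.castSucc (x i.castSucc.castSucc) (x i.castSucc.succ)) *
        ∏ i : Fin N, F i.succ) * F (Fin.last N) := by ring
    _ = ((∏ i : Fin N, F i.castSucc) * F (Fin.last N)) * bridgePDF ε t x := by rw [← h1]; ring
    _ = _ := by rw [h2]; ring

/-- The first and the last coordinate. -/
def ends (x : Fin (N + 2) → E D) : E D × E D := (x 0, x (Fin.last (N + 1)))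

@[fun_prop]
lemma measurable_ends : Measurable (ends : (Fin (N + 2) → E D) → E D × E D) :=
  (measurable_pi_apply _).prodMk (measurable_pi_apply _)

lemma endpoints_eq (q : Measure (Fin (N + 2) → E D)) : endpoints q = q.map ends := rfl

lemma quasiMeasurePreserving_ends :
    Measure.QuasiMeasurePreserving (ends : (Fin (N + 2) → E D) → E D × E D) volume volume :=
  quasiMeasurePreserving_pair (Fin.last_pos).ne

lemma endpoints_discretize {t : Fin (N + 2) → unitInterval} (ht0 : t 0 = 0)
    (ht1 : t (Fin.last (N + 1)) = 1) (T : Measure (PathSpace D)) :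
    (discretize t T).map ends = pathEndpoints T := by
  rw [discretize, Measure.map_map measurable_ends (measurable_discretize_map t), pathEndpoints]
  congr 1
  ext ω : 1
  simp only [Function.comp_apply, ends, ht0, ht1]

lemma pathEndpoints_wiener (hε : 0 < ε) (hW : IsWienerLaw ε p₀ W) (hp₀ : p₀ ≪ volume) :
    pathEndpoints W = volume.withDensity fun z =>
      p₀.rnDeriv volume z.1 * isoGaussianPDF z.1 ε z.2 := by
  have h := map_pair_wiener hε hW (s := 0) (t := 1) zero_lt_one (by rw [hW.initial]; exact hp₀)
  rw [hW.initial] at h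
  rw [pathEndpoints, h]
  simp

lemma ac_pathEndpoints_wiener (hε : 0 < ε) (hW : IsWienerLaw ε p₀ W) (hp₀ : p₀ ≪ volume)
    {π : Measure (E D × E D)} [IsFiniteMeasure π] (hπ : π ≪ volume) (hfst : π.map Prod.fst = p₀) :
    π ≪ pathEndpoints W := by
  have : IsFiniteMeasure p₀ := hfst ▸ inferInstance
  rw [pathEndpoints_wiener hε hW hp₀]
  have hpos : ∀ᵐ z ∂π, 0 < p₀.rnDeriv volume z.1 := by
    have := Measure.rnDeriv_pos hp₀
    exact ae_of_ae_map (f := Prod.fst) measurable_fst.aemeasurable (by rw [hfst]; exact this)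
  refine ac_withDensity_of_ae_ne_zero (by fun_prop) hπ ?_
  filter_upwards [hpos] with z hz
  exact mul_ne_zero hz.ne' (isoGaussianPDF_ne_zero hε _ _)

/-- The Brownian bridge is the conditional law of the Wiener process given its endpoints. This
identifies the explicit formula with `lift`, to which the general Pythagorean identity applies. -/
lemma bridgeMixture_eq_lift (hε : 0 < ε) (hW : IsWienerLaw ε p₀ W) (hp₀ : p₀ ≪ volume)
    {t : Fin (N + 2) → unitInterval} (ht : StrictMono t) (ht0 : t 0 = 0)
    (ht1 : t (Fin.last (N + 1)) = 1) {π : Measure (E D × E D)} [IsFiniteMeasure π]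
    (hπ : π ≪ volume) (hfst : π.map Prod.fst = p₀) :
    bridgeMixture ε t π = lift (discretize t W) ends π := by
  have := hW.isProbabilityMeasure
  have : IsFiniteMeasure p₀ := hfst ▸ inferInstance
  have hR := pathEndpoints_wiener hε hW hp₀
  have hπR := ac_pathEndpoints_wiener hε hW hp₀ hπ hfst
  have : IsProbabilityMeasure (pathEndpoints W) := Measure.isProbabilityMeasure_map (by fun_prop)
  have hm : Measurable fun z : E D × E D => p₀.rnDeriv volume z.1 * isoGaussianPDF z.1 ε z.2 := by
    fun_prop
  rw [lift, endpoints_discretize ht0 ht1, discretize_wiener hε hW hp₀ ht ht0,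
    ← withDensity_mul _ (measurable_chainPDF (by fun_prop) (measurable_wienerKernel t))
      (by fun_prop), bridgeMixture]
  refine withDensity_congr_ae ?_
  have h1 := Measure.rnDeriv_mul_rnDeriv (κ := (volume : Measure (E D × E D))) hπR
  have h2 := Measure.rnDeriv_withDensity (volume : Measure (E D × E D)) hm
  rw [← hR] at h2
  filter_upwards [quasiMeasurePreserving_ends.ae h1, quasiMeasurePreserving_ends.ae h2]
    with x h1 h2
  change bridgePDF ε t x * π.rnDeriv volume (ends x) = _
  rw [← h1, Pi.mul_apply, Pi.mul_apply, h2, chainPDF, prod_wienerKernel hε ht ht0 ht1]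
  simp only [ends]
  ring

end Wiener

/-! ### The Schrödinger bridge: finite divergence, reciprocal and Markov properties, static problem
-/

section Schrodinger

variable {D N : ℕ} {ε : ℝ} {p₀ p₁ : Measure (E D)} {W T : Measure (PathSpace D)}

lemma IsP2ac.integrable_sq (h : IsP2ac p₀) : Integrable (fun x : E D => ‖x‖ ^ 2) p₀ := by
  refine ⟨by fun_prop, ?_⟩
  have h1 := h.secondMoment
  simp only [hasFiniteIntegral_iff_enorm, enorm_pow, enorm_norm]
  exact h1

lemma integrable_log_isoGaussianPDF (hε : 0 < ε) {π : Measure (E D × E D)} [IsFiniteMeasure π]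
    (h0 : IsP2ac (π.map Prod.fst)) (h1 : IsP2ac (π.map Prod.snd)) :
    Integrable (fun z : E D × E D => Real.log (isoGaussianPDF z.1 ε z.2).toReal) π := by
  have hc := gaussianConst_pos (D := D) hε
  have i0 : Integrable (fun z : E D × E D => ‖z.1‖ ^ 2) π :=
    h0.integrable_sq.comp_measurable measurable_fst
  have i1 : Integrable (fun z : E D × E D => ‖z.2‖ ^ 2) π :=
    h1.integrable_sq.comp_measurable measurable_snd
  have e (z : E D × E D) : Real.log (isoGaussianPDF z.1 ε z.2).toReal =
      Real.log (gaussianConst D ε) - ‖z.2 - z.1‖ ^ 2 / (2 * ε) := by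
    rw [isoGaussianPDF_eq hε, ENNReal.toReal_ofReal (by positivity),
      Real.log_mul hc.ne' (Real.exp_pos _).ne', Real.log_exp]
    ring
  simp only [e]
  refine (integrable_const _).sub (Integrable.div_const ?_ _)
  refine Integrable.mono' ((i1.const_mul 2).add (i0.const_mul 2)) (by fun_prop)
    (ae_of_all _ fun z => ?_)
  have h2 := norm_add_sq_le z.2 (-z.1)
  rw [← sub_eq_add_neg, norm_neg] at h2
  rw [Real.norm_of_nonneg (by positivity)]
  exact h2

lemma llr_pathEndpoints_wiener (hε : 0 < ε) (hW : IsWienerLaw ε p₀ W) (hp₀ : p₀ ≪ volume)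
    {π : Measure (E D × E D)} [IsProbabilityMeasure π] (hπ : π ≪ volume)
    (hfst : π.map Prod.fst = p₀) :
    llr π (pathEndpoints W) =ᵐ[π] fun z => Real.log (π.rnDeriv volume z).toReal -
      Real.log (p₀.rnDeriv volume z.1).toReal - Real.log (isoGaussianPDF z.1 ε z.2).toReal := by
  have := hW.isProbabilityMeasure
  have : IsProbabilityMeasure (pathEndpoints W) := Measure.isProbabilityMeasure_map (by fun_prop)
  have : IsFiniteMeasure p₀ := hfst ▸ inferInstance
  have hR := pathEndpoints_wiener hε hW hp₀
  have hac : pathEndpoints W ≪ volume := hR ▸ withDensity_absolutelyContinuous _ _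
  have h2 := Measure.rnDeriv_withDensity (volume : Measure (E D × E D))
    (f := fun z => p₀.rnDeriv volume z.1 * isoGaussianPDF z.1 ε z.2) (by fun_prop)
  rw [← hR] at h2
  have hpos : ∀ᵐ z ∂π, 0 < p₀.rnDeriv volume z.1 ∧ p₀.rnDeriv volume z.1 < ∞ :=
    ae_of_ae_map (f := Prod.fst) (p := fun a => 0 < p₀.rnDeriv volume a ∧ p₀.rnDeriv volume a < ∞)
      measurable_fst.aemeasurable
      (by rw [hfst]; exact (Measure.rnDeriv_pos hp₀).and (hp₀.ae_le (Measure.rnDeriv_lt_top _ _)))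
  filter_upwards [(ac_pathEndpoints_wiener hε hW hp₀ hπ hfst).ae_le (Measure.rnDeriv_eq_div hπ hac),
    hπ.ae_le h2, hpos, Measure.rnDeriv_pos hπ, hπ.ae_le (Measure.rnDeriv_lt_top π volume)]
    with z h3 h4 h5 h6 h7
  have h8 : 0 < (isoGaussianPDF z.1 ε z.2).toReal :=
    ENNReal.toReal_pos (isoGaussianPDF_ne_zero hε _ _) (isoGaussianPDF_ne_top hε _ _)
  have h9 : 0 < (p₀.rnDeriv volume z.1).toReal := ENNReal.toReal_pos h5.1.ne' h5.2.ne
  have h10 : 0 < (π.rnDeriv volume z).toReal := ENNReal.toReal_pos h6.ne' h7.ne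
  rw [llr, h3, h4, ENNReal.toReal_div, ENNReal.toReal_mul,
    Real.log_div h10.ne' (mul_pos h9 h8).ne', Real.log_mul h9.ne' h8.ne']
  ring

lemma IsP2ac.prod (h0 : IsP2ac p₀) (h1 : IsP2ac p₁) : p₀.prod p₁ ≪ volume := by
  have := h0.isProbabilityMeasure
  have := h1.isProbabilityMeasure
  exact h0.absolutelyContinuous.prod h1.absolutelyContinuous

/-- The independent coupling is a competitor of finite cost, so the bridge has finite divergence.
The entropy of `p₀` cancels; that of `p₁` and a quadratic cost remain. -/
lemma klDiv_prod_lt_top (hε : 0 < ε) (hW : IsWienerLaw ε p₀ W) (h0 : IsP2ac p₀)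
    (h1 : IsP2ac p₁) : klDiv (p₀.prod p₁) (pathEndpoints W) < ∞ := by
  have := hW.isProbabilityMeasure
  have := h0.isProbabilityMeasure
  have := h1.isProbabilityMeasure
  have hac := h0.prod h1
  have hfst : (p₀.prod p₁).map Prod.fst = p₀ := by simp
  have hsnd : (p₀.prod p₁).map Prod.snd = p₁ := by simp
  have hl := llr_pathEndpoints_wiener hε hW h0.absolutelyContinuous hac hfst
  have hlog := integrable_log_isoGaussianPDF hε (hfst.symm ▸ h0) (hsnd.symm ▸ h1)
  have hm0 := Measure.measurable_rnDeriv p₀ volume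
  have hm1 := Measure.measurable_rnDeriv p₁ volume
  have hd : p₀.prod p₁ =
      volume.withDensity fun z => p₀.rnDeriv volume z.1 * p₁.rnDeriv volume z.2 := by
    conv_lhs => rw [← Measure.withDensity_rnDeriv_eq _ _ h0.absolutelyContinuous,
      ← Measure.withDensity_rnDeriv_eq _ _ h1.absolutelyContinuous]
    exact prod_withDensity hm0 hm1
  have hr := Measure.rnDeriv_withDensity (volume : Measure (E D × E D))
    (f := fun z => p₀.rnDeriv volume z.1 * p₁.rnDeriv volume z.2) (by fun_prop)
  rw [← hd] at hr
  have i1 : Integrable (fun z : E D × E D => Real.log (p₁.rnDeriv volume z.2).toReal)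
      (p₀.prod p₁) := h1.entropy.comp_snd p₀
  refine (klDiv_ne_top (ac_pathEndpoints_wiener hε hW h0.absolutelyContinuous hac hfst)
    ((i1.sub hlog).congr ?_)).lt_top
  have hpos0 : ∀ᵐ z ∂(p₀.prod p₁), (p₀.rnDeriv volume z.1).toReal ≠ 0 := by
    have h : ∀ᵐ a ∂p₀, (p₀.rnDeriv volume a).toReal ≠ 0 := by
      filter_upwards [Measure.rnDeriv_pos h0.absolutelyContinuous,
        h0.absolutelyContinuous.ae_le (Measure.rnDeriv_lt_top p₀ volume)] with a ha hb
      exact (ENNReal.toReal_pos ha.ne' hb.ne).ne'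
    exact ae_of_ae_map (f := Prod.fst) (p := fun a => (p₀.rnDeriv volume a).toReal ≠ 0)
      measurable_fst.aemeasurable (by rw [hfst]; exact h)
  have hpos1 : ∀ᵐ z ∂(p₀.prod p₁), (p₁.rnDeriv volume z.2).toReal ≠ 0 := by
    have h : ∀ᵐ a ∂p₁, (p₁.rnDeriv volume a).toReal ≠ 0 := by
      filter_upwards [Measure.rnDeriv_pos h1.absolutelyContinuous,
        h1.absolutelyContinuous.ae_le (Measure.rnDeriv_lt_top p₁ volume)] with a ha hb
      exact (ENNReal.toReal_pos ha.ne' hb.ne).ne'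
    exact ae_of_ae_map (f := Prod.snd) (p := fun a => (p₁.rnDeriv volume a).toReal ≠ 0)
      measurable_snd.aemeasurable (by rw [hsnd]; exact h)
  filter_upwards [hl, hac.ae_le hr, hpos0, hpos1] with z h2 h3 h4 h5
  rw [h2, h3, ENNReal.toReal_mul, Real.log_mul h4 h5, Pi.sub_apply]
  ring

/-- The minimality of the Schrödinger bridge passes to its images that retain the endpoints. -/
lemma IsSchrodingerBridge.klDiv_map_le (hT : IsSchrodingerBridge p₀ p₁ W T)
    [IsProbabilityMeasure W] {Z : Type*} [MeasurableSpace Z] {f : PathSpace D → Z}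
    (hf : Measurable f) {e : Z → E D × E D} (he : Measurable e) (hef : ∀ ω, e (f ω) = (ω 0, ω 1))
    {ν : Measure Z} [IsProbabilityMeasure ν] (h0 : (ν.map e).map Prod.fst = p₀)
    (h1 : (ν.map e).map Prod.snd = p₁) :
    klDiv T W ≤ klDiv ν (W.map f) := by
  by_cases hac : ν ≪ W.map f
  swap
  · rw [klDiv_of_not_ac hac]; exact le_top
  have := isProbabilityMeasure_lift hf hac
  have hm := map_lift (μ := W) hf hac
  have hme : (lift W f ν).map (fun ω => (ω 0, ω 1)) = ν.map e := by
    refine Eq.trans ?_ (congrArg (Measure.map e) hm)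
    rw [Measure.map_map he hf]
    congr 1
    ext ω : 1
    exact (hef ω).symm
  -- The competitor on path space is the lift of `ν` along the Wiener law; it has the endpoints of
  -- `ν` and costs the same.
  rw [← klDiv_lift hf hac]
  refine hT.minimal _ ⟨this, ?_, ?_⟩
  · rw [← h0, ← hme, Measure.map_map measurable_fst (by fun_prop)]
    rfl
  · rw [← h1, ← hme, Measure.map_map measurable_snd (by fun_prop)]
    rfl

lemma IsSchrodingerBridge.klDiv_lt_top (hε : 0 < ε) (hW : IsWienerLaw ε p₀ W) (h0 : IsP2ac p₀)
    (h1 : IsP2ac p₁) (hT : IsSchrodingerBridge p₀ p₁ W T) : klDiv T W < ∞ := by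
  have := hW.isProbabilityMeasure
  have := h0.isProbabilityMeasure
  have := h1.isProbabilityMeasure
  refine lt_of_le_of_lt ?_ (klDiv_prod_lt_top hε hW h0 h1)
  exact hT.klDiv_map_le (f := fun ω => (ω 0, ω 1)) (by fun_prop) (e := id) measurable_id
    (fun _ => rfl) (by simp) (by simp)

lemma IsSchrodingerBridge.pathEndpoints_fst (hT : IsSchrodingerBridge p₀ p₁ W T) :
    (pathEndpoints T).map Prod.fst = p₀ := by
  rw [← hT.isBetween.initial, pathEndpoints, Measure.map_map measurable_fst (by fun_prop)]
  rfl

lemma IsSchrodingerBridge.pathEndpoints_snd (hT : IsSchrodingerBridge p₀ p₁ W T) :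
    (pathEndpoints T).map Prod.snd = p₁ := by
  rw [← hT.isBetween.final, pathEndpoints, Measure.map_map measurable_snd (by fun_prop)]
  rfl

variable {t : Fin (N + 2) → unitInterval}

lemma klDiv_discretize_lt_top (hε : 0 < ε) (hW : IsWienerLaw ε p₀ W) (h0 : IsP2ac p₀)
    (h1 : IsP2ac p₁) (hT : IsSchrodingerBridge p₀ p₁ W T) :
    klDiv (discretize t T) (discretize t W) < ∞ := by
  have := hW.isProbabilityMeasure
  have := hT.isBetween.isProbabilityMeasure
  exact (InformationTheory.klDiv_map_le _ _ (measurable_discretize_map t)).trans_lt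
    (hT.klDiv_lt_top hε hW h0 h1)

/-- Pythagoras replaces strict convexity: a minimizer that is no worse than its own projection is at
divergence zero from it. -/
lemma eq_of_klDiv_eq_add {Ω : Type*} [MeasurableSpace Ω] {q q' p : Measure Ω}
    [IsFiniteMeasure q] [IsFiniteMeasure q'] (hfin : klDiv q p < ∞)
    (h : klDiv q p = klDiv q q' + klDiv q' p) (hle : klDiv q p ≤ klDiv q' p) : q = q' := by
  have h1 : klDiv q' p ≠ ∞ := by
    intro h2
    rw [h, h2, add_top] at hfin
    exact lt_irrefl _ hfin
  have h2 : klDiv q q' + klDiv q' p ≤ 0 + klDiv q' p := by rw [← h, zero_add]; exact hle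
  have h3 := ENNReal.le_of_add_le_add_right h1 h2
  exact klDiv_eq_zero_iff.1 (le_antisymm h3 zero_le)

lemma klDiv_discretize_le (hW : IsWienerLaw ε p₀ W) (hT : IsSchrodingerBridge p₀ p₁ W T)
    (ht0 : t 0 = 0) (ht1 : t (Fin.last (N + 1)) = 1) {ν : Measure (Fin (N + 2) → E D)}
    [IsProbabilityMeasure ν] (h0 : (ν.map ends).map Prod.fst = p₀)
    (h1 : (ν.map ends).map Prod.snd = p₁) :
    klDiv (discretize t T) (discretize t W) ≤ klDiv ν (discretize t W) := by
  have := hW.isProbabilityMeasure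
  have := hT.isBetween.isProbabilityMeasure
  refine (InformationTheory.klDiv_map_le _ _ (measurable_discretize_map t)).trans ?_
  refine hT.klDiv_map_le (measurable_discretize_map t) measurable_ends (fun ω => ?_) h0 h1
  simp only [ends, ht0, ht1]

instance {n : ℕ} (s : Fin n → unitInterval) (T : Measure (PathSpace D)) [IsProbabilityMeasure T] :
    IsProbabilityMeasure (discretize s T) :=
  Measure.isProbabilityMeasure_map (measurable_discretize_map s).aemeasurable

instance (T : Measure (PathSpace D)) [IsProbabilityMeasure T] :
    IsProbabilityMeasure (pathEndpoints T) :=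
  Measure.isProbabilityMeasure_map (by fun_prop)

/-- The Schrödinger bridge is a mixture of Brownian bridges. -/
lemma discretize_schrodinger_eq_lift (hε : 0 < ε) (hW : IsWienerLaw ε p₀ W) (h0 : IsP2ac p₀)
    (h1 : IsP2ac p₁) (hT : IsSchrodingerBridge p₀ p₁ W T) (ht0 : t 0 = 0)
    (ht1 : t (Fin.last (N + 1)) = 1) :
    discretize t T = lift (discretize t W) ends (pathEndpoints T) := by
  have := hW.isProbabilityMeasure
  have := hT.isBetween.isProbabilityMeasure
  have hfin := klDiv_discretize_lt_top (t := t) hε hW h0 h1 hT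
  have hac : pathEndpoints T ≪ (discretize t W).map ends := by
    rw [← endpoints_discretize ht0 ht1]
    exact (ac_of_klDiv_lt_top hfin).map measurable_ends
  have := isProbabilityMeasure_lift measurable_ends hac
  have h := klDiv_eq_add_lift measurable_ends hfin
  rw [endpoints_discretize ht0 ht1] at h
  refine eq_of_klDiv_eq_add hfin h ?_
  have hm := map_lift measurable_ends hac
  refine klDiv_discretize_le hW hT ht0 ht1 ?_ ?_ <;> rw [hm]
  · exact hT.pathEndpoints_fst
  · exact hT.pathEndpoints_snd

lemma map_ends_fst (q : Measure (Fin (N + 2) → E D)) : (q.map ends).map Prod.fst = coordLaw q 0 := by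
  rw [Measure.map_map measurable_fst measurable_ends]; rfl

lemma map_ends_snd (q : Measure (Fin (N + 2) → E D)) :
    (q.map ends).map Prod.snd = coordLaw q (Fin.last (N + 1)) := by
  rw [Measure.map_map measurable_snd measurable_ends]; rfl

lemma discretize_wiener_ac (hε : 0 < ε) (hW : IsWienerLaw ε p₀ W) (h0 : IsP2ac p₀)
    (ht : StrictMono t) (ht0 : t 0 = 0) : discretize t W ≪ volume :=
  discretize_wiener hε hW h0.absolutelyContinuous ht ht0 ▸ withDensity_absolutelyContinuous _ _

lemma discretize_schrodinger_ac (hε : 0 < ε) (hW : IsWienerLaw ε p₀ W) (h0 : IsP2ac p₀)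
    (h1 : IsP2ac p₁) (hT : IsSchrodingerBridge p₀ p₁ W T) (ht : StrictMono t) (ht0 : t 0 = 0) :
    discretize t T ≪ volume :=
  (ac_of_klDiv_lt_top (klDiv_discretize_lt_top hε hW h0 h1 hT)).trans
    (discretize_wiener_ac hε hW h0 ht ht0)

/-- The Schrödinger bridge is Markovian. -/
lemma projM_discretize_schrodinger (hε : 0 < ε) (hW : IsWienerLaw ε p₀ W) (h0 : IsP2ac p₀)
    (h1 : IsP2ac p₁) (hT : IsSchrodingerBridge p₀ p₁ W T) (ht : StrictMono t) (ht0 : t 0 = 0)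
    (ht1 : t (Fin.last (N + 1)) = 1) :
    projM (discretize t T) = discretize t T := by
  have := hW.isProbabilityMeasure
  have := hT.isBetween.isProbabilityMeasure
  have hfin := klDiv_discretize_lt_top (t := t) hε hW h0 h1 hT
  have hwM := projM_discretize_wiener (N := N) hε hW h0.absolutelyContinuous ht ht0
  have hac := discretize_schrodinger_ac hε hW h0 h1 hT ht ht0
  have := isProbabilityMeasure_projM hac
  have h := klDiv_eq_add_projM (discretize_wiener_ac hε hW h0 ht ht0) hwM hfin
  -- The projection is admissible because it keeps every one-time law, in particular those at the
  -- two ends.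
  refine (eq_of_klDiv_eq_add hfin h (klDiv_discretize_le hW hT ht0 ht1 ?_ ?_)).symm
  · rw [map_ends_fst, coordLaw_projM hac, ← map_ends_fst, endpoints_discretize ht0 ht1]
    exact hT.pathEndpoints_fst
  · rw [map_ends_snd, coordLaw_projM hac, ← map_ends_snd, endpoints_discretize ht0 ht1]
    exact hT.pathEndpoints_snd

lemma pathEndpoints_schrodinger_ac (hε : 0 < ε) (hW : IsWienerLaw ε p₀ W) (h0 : IsP2ac p₀)
    (h1 : IsP2ac p₁) (hT : IsSchrodingerBridge p₀ p₁ W T) : pathEndpoints T ≪ volume := by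
  refine ((ac_of_klDiv_lt_top (hT.klDiv_lt_top hε hW h0 h1)).map
    (by fun_prop : Measurable fun ω : PathSpace D => (ω 0, ω 1))).trans ?_
  change pathEndpoints W ≪ volume
  rw [pathEndpoints_wiener hε hW h0.absolutelyContinuous]
  exact withDensity_absolutelyContinuous _ _

/-- The endpoints of the Schrödinger bridge solve the static problem. -/
theorem isStaticSchrodingerBridge_pathEndpoints (hε : 0 < ε) (hW : IsWienerLaw ε p₀ W)
    (h0 : IsP2ac p₀) (h1 : IsP2ac p₁) (hT : IsSchrodingerBridge p₀ p₁ W T) :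
    IsStaticSchrodingerBridge p₀ p₁ (pathEndpoints W) (pathEndpoints T) := by
  have := hW.isProbabilityMeasure
  have := hT.isBetween.isProbabilityMeasure
  have hfst := hT.pathEndpoints_fst
  have hsnd := hT.pathEndpoints_snd
  have hac := pathEndpoints_schrodinger_ac hε hW h0 h1 hT
  have hpair : Measurable fun ω : PathSpace D => (ω 0, ω 1) := by fun_prop
  refine ⟨⟨⟨inferInstance, hac, ?_, ?_⟩, hfst, hsnd⟩, fun π hπ => ?_⟩
  · have hle (z : E D × E D) : ‖z‖ₑ ^ 2 ≤ ‖z.1‖ₑ ^ 2 + ‖z.2‖ₑ ^ 2 := by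
      rcases le_total ‖z.1‖ ‖z.2‖ with h | h
      · rw [show ‖z‖ₑ = ‖z.2‖ₑ from by
          rw [← ofReal_norm, ← ofReal_norm, Prod.norm_def, sup_eq_right.2 h]]
        exact le_add_self
      · rw [show ‖z‖ₑ = ‖z.1‖ₑ from by
          rw [← ofReal_norm, ← ofReal_norm, Prod.norm_def, sup_eq_left.2 h]]
        exact le_self_add
    refine (lintegral_mono hle).trans_lt ?_
    rw [lintegral_add_left (by fun_prop)]
    refine ENNReal.add_lt_top.2 ⟨?_, ?_⟩
    · have h := h0.secondMoment
      rwa [← hfst, lintegral_map (by fun_prop) measurable_fst] at h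
    · have h := h1.secondMoment
      rwa [← hsnd, lintegral_map (by fun_prop) measurable_snd] at h
  -- The log-density of the coupling is its log-ratio to the Wiener endpoints, plus the log-density
  -- of `p₀`, plus the log of the Gaussian kernel. These are integrable by finite divergence, finite
  -- entropy and second moments.
  · have hl := llr_pathEndpoints_wiener hε hW h0.absolutelyContinuous hac hfst
    have hlog := integrable_log_isoGaussianPDF hε (hfst.symm ▸ h0) (hsnd.symm ▸ h1)
    have i0 : Integrable (fun z : E D × E D => Real.log (p₀.rnDeriv volume z.1).toReal)
        (pathEndpoints T) := by
      have h := h0.entropy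
      nth_rw 2 [← hfst] at h
      exact h.comp_measurable measurable_fst
    have hi : Integrable (llr (pathEndpoints T) (pathEndpoints W)) (pathEndpoints T) :=
      integrable_llr_of_klDiv_lt_top ((InformationTheory.klDiv_map_le _ _ hpair).trans_lt
        (hT.klDiv_lt_top hε hW h0 h1))
    refine ((hi.add i0).add hlog).congr ?_
    filter_upwards [hl] with z hz
    simp only [Pi.add_apply, hz]
    ring
  · have := hπ.isP2ac.isProbabilityMeasure
    refine (InformationTheory.klDiv_map_le _ _ hpair).trans ?_
    exact hT.klDiv_map_le hpair (e := id) measurable_id (fun _ => rfl) (by simp [hπ.fst])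
      (by simp [hπ.snd])

end Schrodinger

/-! ### Two-point marginals of Gaussian mixtures of couplings -/

section GaussianMixture

variable {D : ℕ} {a b v : ℝ}

/-- The joint law of a Gaussian point with mean `a x + b y` and of the pair `(x, y) ∼ π`. -/
noncomputable def gaussMix (a b v : ℝ) (π : Measure (E D × E D)) : Measure (E D × (E D × E D)) :=
  ((volume : Measure (E D)).prod π).withDensity fun w =>
    isoGaussianPDF (a • w.2.1 + b • w.2.2) v w.1

lemma lintegral_gaussMix (π : Measure (E D × E D)) [SFinite π] {G : E D × (E D × E D) → ℝ≥0∞}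
    (hG : Measurable G) :
    ∫⁻ w, G w ∂(gaussMix a b v π) =
      ∫⁻ z, ∫⁻ m, isoGaussianPDF (a • z.1 + b • z.2) v m * G (m, z) ∂volume ∂π := by
  rw [gaussMix, lintegral_withDensity_eq_lintegral_mul _ (by fun_prop) hG,
    lintegral_prod_symm _ (by fun_prop)]
  rfl

lemma lintegral_gaussMix_snd (hv : 0 < v) (π : Measure (E D × E D)) [SFinite π]
    {G : E D × E D → ℝ≥0∞} (hG : Measurable G) :
    ∫⁻ w, G w.2 ∂(gaussMix a b v π) = ∫⁻ z, G z ∂π := by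
  rw [lintegral_gaussMix π (G := fun w => G w.2) (by fun_prop)]
  refine lintegral_congr fun z => ?_
  simp only
  rw [lintegral_mul_const _ (by fun_prop), lintegral_isoGaussianPDF hv, one_mul]

lemma map_snd_gaussMix (hv : 0 < v) (π : Measure (E D × E D)) [SFinite π] :
    (gaussMix a b v π).map Prod.snd = π := by
  refine Measure.ext_of_lintegral _ fun G hG => ?_
  rw [lintegral_map hG measurable_snd]
  exact lintegral_gaussMix_snd hv π hG

lemma isProbabilityMeasure_gaussMix (hv : 0 < v) (π : Measure (E D × E D))
    [IsProbabilityMeasure π] : IsProbabilityMeasure (gaussMix a b v π) := by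
  constructor
  rw [← Set.preimage_univ (f := Prod.snd), ← Measure.map_apply measurable_snd .univ,
    map_snd_gaussMix hv, measure_univ]

lemma gaussMix_eq_lift (hv : 0 < v) {π π' : Measure (E D × E D)} [IsFiniteMeasure π]
    [IsFiniteMeasure π'] (h : π' ≪ π) :
    gaussMix a b v π' = lift (gaussMix a b v π) Prod.snd π' := by
  rw [lift, map_snd_gaussMix hv]
  refine Measure.ext_of_lintegral _ fun G hG => ?_
  have hm := Measure.measurable_rnDeriv π' π
  rw [lintegral_gaussMix π' hG, lintegral_withDensity_eq_lintegral_mul _ (by fun_prop) hG]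
  refine Eq.trans ?_ (lintegral_gaussMix π (by fun_prop)).symm
  have hmeas : Measurable fun w : (E D × E D) × E D =>
      isoGaussianPDF (a • w.1.1 + b • w.1.2) v w.2 * G (w.2, w.1) := by fun_prop
  conv_lhs => rw [← Measure.withDensity_rnDeriv_eq _ _ h]
  refine (lintegral_withDensity_eq_lintegral_mul _ hm hmeas.lintegral_prod_right').trans ?_
  refine lintegral_congr fun z => ?_
  rw [Pi.mul_apply]
  simp only
  rw [← lintegral_const_mul _ (by fun_prop)]
  refine lintegral_congr fun m => ?_
  simp only [Pi.mul_apply]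
  ring

/-- The density of the Gaussian point and of one member of the pair. -/
noncomputable def gaussMixPDF (a b v : ℝ) (r : E D × E D → ℝ≥0∞) (z : E D × E D) : ℝ≥0∞ :=
  ∫⁻ y, isoGaussianPDF (a • z.1 + b • y) v z.2 * r (z.1, y)

lemma measurable_gaussMixPDF {r : E D × E D → ℝ≥0∞} (hr : Measurable r) :
    Measurable (gaussMixPDF a b v r) := by
  have : Measurable fun w : (E D × E D) × E D =>
      isoGaussianPDF (a • w.1.1 + b • w.2) v w.1.2 * r (w.1.1, w.2) := by fun_prop
  exact this.lintegral_prod_right'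

lemma map_gaussMix {r : E D × E D → ℝ≥0∞} (hr : Measurable r) {π : Measure (E D × E D)}
    [SFinite π] (h : π = volume.withDensity r) :
    (gaussMix a b v π).map (fun w => (w.2.1, w.1)) = volume.withDensity (gaussMixPDF a b v r) := by
  refine Measure.ext_of_lintegral _ fun G hG => ?_
  have hG' : Measurable fun w : E D × (E D × E D) => G (w.2.1, w.1) := by fun_prop
  rw [lintegral_map hG (by fun_prop), lintegral_gaussMix π hG']
  have hmeas : Measurable fun w : (E D × E D) × E D =>
      isoGaussianPDF (a • w.1.1 + b • w.1.2) v w.2 * G (w.1.1, w.2) := by fun_prop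
  conv_lhs => rw [h]
  refine (lintegral_withDensity_eq_lintegral_mul _ hr hmeas.lintegral_prod_right').trans ?_
  rw [lintegral_withDensity_eq_lintegral_mul _ (measurable_gaussMixPDF hr) hG,
    Measure.volume_eq_prod, lintegral_prod _ (hr.mul hmeas.lintegral_prod_right').aemeasurable,
    lintegral_prod _ ((measurable_gaussMixPDF hr).mul hG).aemeasurable]
  refine lintegral_congr fun x => ?_
  calc _ = ∫⁻ y, ∫⁻ m, isoGaussianPDF (a • x + b • y) v m * r (x, y) * G (x, m) := by
        refine lintegral_congr fun y => ?_
        rw [Pi.mul_apply]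
        simp only
        rw [← lintegral_const_mul _ (by fun_prop)]
        refine lintegral_congr fun m => ?_
        ring
    _ = ∫⁻ m, ∫⁻ y, isoGaussianPDF (a • x + b • y) v m * r (x, y) * G (x, m) := by
        have hx : Measurable fun q : E D × E D =>
            isoGaussianPDF (a • x + b • q.1) v q.2 * r (x, q.1) * G (x, q.2) := by fun_prop
        exact lintegral_lintegral_swap hx.aemeasurable
    _ = _ := by
        refine lintegral_congr fun m => ?_
        rw [lintegral_mul_const _ (by fun_prop)]
        rfl

/-- The marginals of Gaussian mixtures converge in divergence when the mixing densities converge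
almost everywhere and the marginals of the mixing measures are fixed. -/
theorem exists_subseq_klDiv_gaussMix (hv : 0 < v) {π : Measure (E D × E D)}
    [IsProbabilityMeasure π] (hπ : π ≪ volume) {πl : ℕ → Measure (E D × E D)}
    [∀ l, IsProbabilityMeasure (πl l)] {C : ℝ≥0∞} (hC : C ≠ ∞) (hKL : ∀ l, klDiv (πl l) π ≤ C)
    (hfst : ∀ l, (πl l).map Prod.fst = π.map Prod.fst)
    (hsnd : ∀ l, (πl l).map Prod.snd = π.map Prod.snd)
    (hmom : ∫⁻ y, ENNReal.ofReal (‖y‖ ^ 2) ∂(π.map Prod.snd) < ∞)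
    (hρ : ∀ᵐ z ∂π, Tendsto (fun l => ((πl l).rnDeriv π z).toReal) atTop (𝓝 1)) :
    ∃ ns : ℕ → ℕ, StrictMono ns ∧
      Tendsto (fun k => klDiv ((gaussMix a b v (πl (ns k))).map fun w => (w.2.1, w.1))
        ((gaussMix a b v π).map fun w => (w.2.1, w.1))) atTop (𝓝 0) := by
  have hac (l : ℕ) : πl l ≪ π := ac_of_klDiv_lt_top ((hKL l).trans_lt hC.lt_top)
  have := isProbabilityMeasure_gaussMix (a := a) (b := b) hv π
  have (l : ℕ) := isProbabilityMeasure_gaussMix (a := a) (b := b) hv (πl l)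
  have hlift (l : ℕ) := gaussMix_eq_lift (a := a) (b := b) hv (hac l)
  have hms := map_snd_gaussMix (a := a) (b := b) hv π
  set r := π.rnDeriv volume with hr_def
  have hr : Measurable r := Measure.measurable_rnDeriv _ _
  have hπr : π = volume.withDensity r := (Measure.withDensity_rnDeriv_eq _ _ hπ).symm
  let P (x : E D) : ℝ≥0∞ := ∫⁻ y, r (x, y)
  have hP : Measurable P := hr.lintegral_prod_right'
  have hfstP : π.map Prod.fst = volume.withDensity P := by
    conv_lhs => rw [hπr]
    exact map_fst_withDensity_prod hr
  let hint (z : E D × E D) : ℝ≥0∞ := ENNReal.ofReal (‖z.2‖ ^ 2) * (r z / P z.1)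
  have hintm : Measurable hint := by fun_prop
  -- Conditional second moment of the second endpoint given the first, under `π`.
  let h (x : E D) : ℝ≥0∞ := ∫⁻ y, hint (x, y)
  have hh : Measurable h := hintm.lintegral_prod_right'
  have hhfin : ∫⁻ x, h x ∂(π.map Prod.fst) < ∞ := by
    refine lt_of_le_of_lt ?_ hmom
    have e1 : ∫⁻ y, ENNReal.ofReal (‖y‖ ^ 2) ∂(π.map Prod.snd) =
        ∫⁻ x, ∫⁻ y, r (x, y) * ENNReal.ofReal (‖y‖ ^ 2) := by
      rw [lintegral_map (by fun_prop) measurable_snd]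
      conv_lhs => rw [hπr]
      rw [lintegral_withDensity_eq_lintegral_mul _ hr (by fun_prop), Measure.volume_eq_prod,
        lintegral_prod _ (by fun_prop)]
      rfl
    rw [e1, hfstP, lintegral_withDensity_eq_lintegral_mul _ hP hh]
    refine lintegral_mono fun x => ?_
    simp only [Pi.mul_apply, h]
    rw [← lintegral_const_mul _ (by fun_prop)]
    refine lintegral_mono fun y => ?_
    simp only [hint]
    calc P x * (ENNReal.ofReal (‖y‖ ^ 2) * (r (x, y) / P x)) =
          P x * (r (x, y) / P x) * ENNReal.ofReal (‖y‖ ^ 2) := by ring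
      _ ≤ r (x, y) * ENNReal.ofReal (‖y‖ ^ 2) := by gcongr; exact ENNReal.mul_div_le
  set k : ℝ := 2 * b ^ 2 / v
  have hk : 0 ≤ k := by positivity
  -- The bound from `log_gaussian_mixture_div_le` with the actual second endpoint as reference
  -- point. The first term has a Gaussian conditional mean independent of the pair, and the others
  -- involve one endpoint each, so the integral is the same number `J` for all couplings with these
  -- marginals.
  let H (w : E D × (E D × E D)) : ℝ := 1 / v * ‖w.1 - (a • w.2.1 + b • w.2.2)‖ ^ 2 +
    k * ‖w.2.2‖ ^ 2 + k * (h w.2.1).toReal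
  have hHm : Measurable H := by fun_prop
  have hH0 (w : E D × (E D × E D)) : 0 ≤ H w := by positivity
  let J : ℝ≥0∞ := ENNReal.ofReal (1 / v) * gaussianMoment D v +
    (∫⁻ y, ENNReal.ofReal (k * ‖y‖ ^ 2) ∂(π.map Prod.snd) +
      ∫⁻ x, ENNReal.ofReal (k * (h x).toReal) ∂(π.map Prod.fst))
  have hJ : J < ∞ := by
    refine ENNReal.add_lt_top.2 ⟨ENNReal.mul_lt_top ENNReal.ofReal_lt_top
      (lintegral_sq_mul_isoGaussianPDF_lt_top hv), ENNReal.add_lt_top.2 ⟨?_, ?_⟩⟩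
    · simp only [ENNReal.ofReal_mul hk]
      rw [lintegral_const_mul _ (by fun_prop)]
      exact ENNReal.mul_lt_top ENNReal.ofReal_lt_top hmom
    · simp only [ENNReal.ofReal_mul hk]
      rw [lintegral_const_mul _ (by fun_prop)]
      exact ENNReal.mul_lt_top ENNReal.ofReal_lt_top
        ((lintegral_mono fun x => ENNReal.ofReal_toReal_le).trans_lt hhfin)
  have hHint (π' : Measure (E D × E D)) [IsProbabilityMeasure π']
      (h1 : π'.map Prod.fst = π.map Prod.fst) (h2 : π'.map Prod.snd = π.map Prod.snd) :
      Integrable H (gaussMix a b v π') ∧ ∫ w, H w ∂(gaussMix a b v π') = J.toReal := by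
    have e : ∫⁻ w, ENNReal.ofReal (H w) ∂(gaussMix a b v π') = J := by
      rw [lintegral_gaussMix π' (by fun_prop)]
      have e1 (z : E D × E D) : ∫⁻ m, isoGaussianPDF (a • z.1 + b • z.2) v m *
          ENNReal.ofReal (H (m, z)) = ENNReal.ofReal (1 / v) * gaussianMoment D v +
            (ENNReal.ofReal (k * ‖z.2‖ ^ 2) + ENNReal.ofReal (k * (h z.1).toReal)) := by
        have e2 (m : E D) : isoGaussianPDF (a • z.1 + b • z.2) v m * ENNReal.ofReal (H (m, z)) =
            ENNReal.ofReal (1 / v) * (ENNReal.ofReal (‖m - (a • z.1 + b • z.2)‖ ^ 2) *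
              isoGaussianPDF (a • z.1 + b • z.2) v m) + isoGaussianPDF (a • z.1 + b • z.2) v m *
            (ENNReal.ofReal (k * ‖z.2‖ ^ 2) + ENNReal.ofReal (k * (h z.1).toReal)) := by
          simp only [H]
          rw [ENNReal.ofReal_add (by positivity) (by positivity),
            ENNReal.ofReal_add (by positivity) (by positivity),
            ENNReal.ofReal_mul (by positivity : (0 : ℝ) ≤ 1 / v)]
          ring
        simp only [e2]
        rw [lintegral_add_left (by fun_prop), lintegral_const_mul _ (by fun_prop),
          lintegral_sq_sub_mul_isoGaussianPDF hv, lintegral_mul_const _ (by fun_prop),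
          lintegral_isoGaussianPDF hv, one_mul]
      simp only [e1]
      rw [lintegral_add_left (by fun_prop), lintegral_const, measure_univ, mul_one,
        lintegral_add_left (by fun_prop)]
      simp only [J]
      rw [← h1, ← h2, lintegral_map (by fun_prop) measurable_snd,
        lintegral_map (by fun_prop) measurable_fst]
    have hn : 0 ≤ᵐ[gaussMix a b v π'] H := ae_of_all _ hH0
    refine ⟨⟨hHm.aestronglyMeasurable, ?_⟩, ?_⟩
    · rw [hasFiniteIntegral_iff_ofReal hn, e]; exact hJ
    · rw [integral_eq_lintegral_of_nonneg_ae hn hHm.aestronglyMeasurable, e]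
  have hg : Measurable fun w : E D × (E D × E D) => (w.2.1, w.1) := by fun_prop
  refine exists_subseq_klDiv_map_tendsto_zero (μ := gaussMix a b v π)
    (ν := fun l => gaussMix a b v (πl l)) hg hC (fun l => ?_) ?_ hHm hH0
    (hHint π rfl rfl).1 (fun l => (hHint (πl l) (hfst l) (hsnd l)).1)
    (fun l => by rw [(hHint π rfl rfl).2, (hHint (πl l) (hfst l) (hsnd l)).2]) fun l => ?_
  · rw [hlift l, klDiv_lift measurable_snd (by rw [hms]; exact hac l), hms]
    exact hKL l
  · have h1 (l : ℕ) : (gaussMix a b v (πl l)).rnDeriv (gaussMix a b v π) =ᵐ[gaussMix a b v π]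
        fun w => (πl l).rnDeriv π w.2 := by
      have := rnDeriv_lift (μ := gaussMix a b v π) (ν := πl l) measurable_snd
      rw [hms, ← hlift l] at this
      exact this
    have h2 : ∀ᵐ w ∂(gaussMix a b v π),
        Tendsto (fun l => ((πl l).rnDeriv π w.2).toReal) atTop (𝓝 1) :=
      ae_of_ae_map (f := Prod.snd)
        (p := fun z => Tendsto (fun l => ((πl l).rnDeriv π z).toReal) atTop (𝓝 1))
        measurable_snd.aemeasurable (by rw [hms]; exact hρ)
    filter_upwards [ae_all_iff.2 h1, h2] with w h1 h2
    exact h2.congr fun l => by rw [h1 l]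
  · set r' := (πl l).rnDeriv volume with hr'_def
    have hr' : Measurable r' := Measure.measurable_rnDeriv _ _
    have hacl : πl l ≪ volume := (hac l).trans hπ
    have hπr' : πl l = volume.withDensity r' := (Measure.withDensity_rnDeriv_eq _ _ hacl).symm
    have hd := map_gaussMix (a := a) (b := b) (v := v) hr hπr
    have hd' := map_gaussMix (a := a) (b := b) (v := v) hr' hπr'
    have hacg : (gaussMix a b v π).map (fun w => (w.2.1, w.1)) ≪ volume :=
      hd ▸ withDensity_absolutelyContinuous _ _
    have hacg' : (gaussMix a b v (πl l)).map (fun w => (w.2.1, w.1)) ≪ volume :=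
      hd' ▸ withDensity_absolutelyContinuous _ _
    have : IsProbabilityMeasure ((gaussMix a b v π).map fun w => (w.2.1, w.1)) :=
      Measure.isProbabilityMeasure_map hg.aemeasurable
    have : IsProbabilityMeasure ((gaussMix a b v (πl l)).map fun w => (w.2.1, w.1)) :=
      Measure.isProbabilityMeasure_map hg.aemeasurable
    have hrn := Measure.rnDeriv_eq_div hacg' hacg
    have hp := Measure.rnDeriv_withDensity (volume : Measure (E D × E D))
      (measurable_gaussMixPDF (a := a) (b := b) (v := v) hr)
    have hp' := Measure.rnDeriv_withDensity (volume : Measure (E D × E D))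
      (measurable_gaussMixPDF (a := a) (b := b) (v := v) hr')
    rw [← hd] at hp
    rw [← hd'] at hp'
    -- Equality of first marginals says that, for fixed `x`, the two mixing densities have the same
    -- mass, as the comparison requires.
    have hPae : ∀ᵐ x ∂(π.map Prod.fst), P x ≠ 0 ∧ P x ≠ ∞ ∧ h x < ∞ ∧ ∫⁻ y, r' (x, y) = P x := by
      have hacP : π.map Prod.fst ≪ volume := hfstP ▸ withDensity_absolutelyContinuous _ _
      have h1 := Measure.rnDeriv_withDensity (volume : Measure (E D)) hP
      rw [← hfstP] at h1
      have h2 : (fun x => ∫⁻ y, r' (x, y)) =ᵐ[volume] P := by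
        have h3 : (πl l).map Prod.fst = volume.withDensity fun x => ∫⁻ y, r' (x, y) := by
          conv_lhs => rw [hπr']
          exact map_fst_withDensity_prod hr'
        have h4 := Measure.rnDeriv_withDensity (volume : Measure (E D)) (f := fun x => ∫⁻ y, r' (x, y)) hr'.lintegral_prod_right'
        rw [← h3, hfst l] at h4
        exact h4.symm.trans h1
      filter_upwards [Measure.rnDeriv_pos hacP, hacP.ae_le h1, hacP.ae_le h2,
        hacP.ae_le (Measure.rnDeriv_lt_top (π.map Prod.fst) volume),
        ae_lt_top hh hhfin.ne] with x h3 h4 h5 h6 h7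
      rw [h4] at h3 h6
      exact ⟨h3.ne', h6.ne, h7, h5⟩
    have hPae' : ∀ᵐ w ∂(gaussMix a b v π), P w.2.1 ≠ 0 ∧ P w.2.1 ≠ ∞ ∧ h w.2.1 < ∞ ∧
        ∫⁻ y, r' (w.2.1, y) = P w.2.1 := by
      refine ae_of_ae_map (f := fun w : E D × (E D × E D) => w.2.1)
        (p := fun x => P x ≠ 0 ∧ P x ≠ ∞ ∧ h x < ∞ ∧ ∫⁻ y, r' (x, y) = P x) (by fun_prop) ?_
      have e : (gaussMix a b v π).map (fun w : E D × (E D × E D) => w.2.1) = π.map Prod.fst := by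
        conv_rhs => rw [← hms]
        rw [Measure.map_map measurable_fst measurable_snd]
        rfl
      rw [e]
      exact hPae
    filter_upwards [ae_of_ae_map hg.aemeasurable hrn,
      ae_of_ae_map hg.aemeasurable (hacg.ae_le hp),
      ae_of_ae_map hg.aemeasurable (hacg.ae_le hp'), hPae'] with w h1 h2 h3 h4
    rw [llr, h1, h2, h3]
    exact log_gaussian_mixture_div_le hv (hr.comp measurable_prodMk_left) h4.1 h4.2.1 rfl
      h4.2.2.2 h4.2.2.1 b (a • w.2.1) w.1 w.2.2

end GaussianMixture

/-! ### Three-time laws: asymptotic Markovianity and freezing the middle point -/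

section ThreeTimes

lemma lift_map {Ω Y Z : Type*} [MeasurableSpace Ω] [MeasurableSpace Y] [MeasurableSpace Z]
    {μ : Measure Ω} {g : Ω → Y} {e : Y → Z} {ν : Measure Z} (hg : Measurable g)
    (he : Measurable e) : (lift μ (e ∘ g) ν).map g = lift (μ.map g) e ν := by
  ext s hs
  rw [lift, lift, Measure.map_apply hg hs, withDensity_apply _ (hg hs), withDensity_apply _ hs,
    setLIntegral_map hs (by fun_prop) hg, Measure.map_map he hg]
  rfl

/-- If the divergence to the Markovian projection vanishes in the limit, then the density is
asymptotically Markovian. -/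
lemma exists_subseq_rnDeriv_sub_projMPDF {D N : ℕ} {p : Measure (Fin (N + 2) → E D)}
    [IsProbabilityMeasure p] (hp : p ≪ volume) (hpM : projM p = p)
    {q : ℕ → Measure (Fin (N + 2) → E D)} [∀ l, IsProbabilityMeasure (q l)] (hqp : ∀ l, q l ≪ p)
    (hfin : ∀ l, klDiv (q l) (projM (q l)) < ∞)
    (hlim : Tendsto (fun l => klDiv (q l) (projM (q l))) atTop (𝓝 0)) :
    ∃ ns : ℕ → ℕ, StrictMono ns ∧ ∀ᵐ x ∂p, Tendsto (fun k => ((q (ns k)).rnDeriv p x).toReal -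
      (projMPDF (q (ns k)) x / projMPDF p x).toReal) atTop (𝓝 0) := by
  have (l : ℕ) := isProbabilityMeasure_projM ((hqp l).trans hp)
  have h1 := tendsto_integral_abs_rnDeriv_sub_one hfin hlim
  let f (l : ℕ) (x : Fin (N + 2) → E D) : ℝ :=
    ((q l).rnDeriv p x).toReal - (projMPDF (q l) x / projMPDF p x).toReal
  have hf (l : ℕ) : Measurable (f l) :=
    (Measure.measurable_rnDeriv _ _).ennreal_toReal.sub
      ((measurable_projMPDF (q l)).div (measurable_projMPDF p)).ennreal_toReal
  -- Total variation does not depend on the reference measure; moving it to the fixed `p` makes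
  -- almost everywhere limits meaningful.
  have hfe (l : ℕ) : ∫⁻ x, ‖((q l).rnDeriv (projM (q l)) x).toReal - 1‖ₑ ∂(projM (q l)) =
      ∫⁻ x, ‖f l x‖ₑ ∂p := by
    have hqr := ac_projM ((hqp l).trans hp)
    have hrp : projM (q l) ≪ p := by
      have := projM_ac_projM hp (hqp l)
      rwa [hpM] at this
    have hr := rnDeriv_projM hp (hqp l)
    rw [hpM] at hr
    rw [← lintegral_rnDeriv_mul hrp (by fun_prop)]
    refine lintegral_congr_ae ?_
    filter_upwards [hr, Measure.rnDeriv_mul_rnDeriv (κ := p) hqr,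
      Measure.rnDeriv_ne_top (projM (q l)) p] with x h2 h3 h4
    simp only [f]
    rw [← h2, ← h3, Pi.mul_apply, ENNReal.toReal_mul]
    set A := (q l).rnDeriv (projM (q l)) x
    set B := (projM (q l)).rnDeriv p x
    have e : A.toReal * B.toReal - B.toReal = B.toReal * (A.toReal - 1) := by ring
    rw [e, enorm_mul, Real.enorm_eq_ofReal ENNReal.toReal_nonneg, ENNReal.ofReal_toReal h4]
  exact exists_subseq_ae_tendsto_zero (f := f) (fun l => (hf l).aestronglyMeasurable)
    (h1.congr hfe)

variable {D : ℕ} {a b v : ℝ}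

/-- The trajectory at three times that is determined by its middle point and its endpoints. -/
def path3 (w : E D × (E D × E D)) : Fin (1 + 2) → E D := ![w.2.1, w.1, w.2.2]

@[fun_prop]
lemma measurable_path3 : Measurable (path3 : E D × (E D × E D) → Fin (1 + 2) → E D) :=
  measurable_vec3.comp (by fun_prop : Measurable fun w : E D × (E D × E D) => (w.2.1, w.1, w.2.2))

lemma measurePreserving_path3 :
    MeasurePreserving (path3 : E D × (E D × E D) → Fin (1 + 2) → E D) volume volume := by
  refine ⟨measurable_path3, Measure.ext_of_lintegral _ fun G hG => ?_⟩
  have h1 : Measurable fun w : E D × (E D × E D) => G (path3 w) := by fun_prop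
  rw [lintegral_map hG measurable_path3, lintegral_three hG, Measure.volume_eq_prod,
    lintegral_prod _ h1.aemeasurable]
  have e (m : E D) : ∫⁻ z : E D × E D, G (path3 (m, z)) = ∫⁻ x, ∫⁻ y, G ![x, m, y] := by
    rw [Measure.volume_eq_prod]
    exact lintegral_prod _ (by fun_prop)
  simp only [e]
  have h2 : Measurable fun w : (E D × E D) × E D => G ![w.1.2, w.1.1, w.2] :=
    h1.comp (by fun_prop : Measurable fun w : (E D × E D) × E D => (w.1.1, w.1.2, w.2))
  exact lintegral_lintegral_swap h2.lintegral_prod_right'.aemeasurable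

lemma ends_path3 (w : E D × (E D × E D)) : ends (path3 w) = w.2 := rfl

lemma map_prod_left (π : Measure (E D × E D)) [SFinite π] :
    ((volume : Measure (E D)).prod π).map (fun w => (w.2.1, w.1)) =
      (π.map Prod.fst).prod volume := by
  have h := Measure.map_prod_map (volume : Measure (E D)) π measurable_id measurable_fst
  rw [Measure.map_id] at h
  rw [← Measure.prod_swap (ν := π.map Prod.fst), h, Measure.map_map measurable_swap (by fun_prop)]
  rfl

lemma map_prod_right (π : Measure (E D × E D)) [SFinite π] :
    ((volume : Measure (E D)).prod π).map (fun w => (w.1, w.2.2)) =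
      (volume : Measure (E D)).prod (π.map Prod.snd) := by
  rw [← Measure.map_id (μ := (volume : Measure (E D))),
    Measure.map_prod_map _ _ measurable_id measurable_snd, Measure.map_id]
  rfl

/-- The Gaussian density never vanishes. Hence almost sure statements for the mixture hold at almost
every middle point, for almost every pair. -/
lemma prod_ac_gaussMix (hv : 0 < v) (π : Measure (E D × E D)) :
    (volume : Measure (E D)).prod π ≪ gaussMix a b v π :=
  ac_withDensity_of_ae_ne_zero (by fun_prop) Measure.AbsolutelyContinuous.rfl
    (ae_of_all _ fun _ => isoGaussianPDF_ne_zero hv _ _)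

/-- The law at three times of a Gaussian mixture. -/
noncomputable def mix3 (a b v : ℝ) (π : Measure (E D × E D)) : Measure (Fin (1 + 2) → E D) :=
  (gaussMix a b v π).map path3

lemma isProbabilityMeasure_mix3 (hv : 0 < v) (π : Measure (E D × E D)) [IsProbabilityMeasure π] :
    IsProbabilityMeasure (mix3 a b v π) := by
  have := isProbabilityMeasure_gaussMix (a := a) (b := b) hv π
  exact Measure.isProbabilityMeasure_map measurable_path3.aemeasurable

lemma mix3_ac {π : Measure (E D × E D)} [SFinite π] (hπ : π ≪ volume) :
    mix3 a b v π ≪ volume := by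
  refine Measure.AbsolutelyContinuous.trans (Measure.AbsolutelyContinuous.map ?_ measurable_path3)
    measurePreserving_path3.quasiMeasurePreserving.absolutelyContinuous
  exact (withDensity_absolutelyContinuous _ _).trans (Measure.AbsolutelyContinuous.rfl.prod hπ)

lemma map_ends_mix3 (hv : 0 < v) (π : Measure (E D × E D)) [SFinite π] :
    (mix3 a b v π).map ends = π := by
  rw [mix3, Measure.map_map measurable_ends measurable_path3]
  exact map_snd_gaussMix hv π

lemma mix3_eq_lift (hv : 0 < v) {π π' : Measure (E D × E D)} [IsFiniteMeasure π]
    [IsFiniteMeasure π'] (h : π' ≪ π) :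
    mix3 a b v π' = lift (mix3 a b v π) ends π' := by
  rw [mix3, gaussMix_eq_lift hv h]
  exact lift_map (e := ends) measurable_path3 measurable_ends

lemma pairLaw_mix3_left (π : Measure (E D × E D)) :
    pairLaw (mix3 a b v π) 0 1 = (gaussMix a b v π).map fun w => (w.2.1, w.1) := by
  rw [pairLaw, mix3, Measure.map_map (by fun_prop) measurable_path3]
  rfl

lemma pairLaw_mix3_right (π : Measure (E D × E D)) :
    pairLaw (mix3 a b v π) 1 2 = (gaussMix a b v π).map fun w => (w.1, w.2.2) := by
  rw [pairLaw, mix3, Measure.map_map (by fun_prop) measurable_path3]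
  rfl

/-- Time reversal exchanges `a` and `b`, so estimates for the left pair also serve the right one. -/
lemma pairLaw_mix3_right_eq_swap (π : Measure (E D × E D)) [SFinite π] :
    pairLaw (mix3 a b v π) 1 2 =
      (pairLaw (mix3 b a v (π.map Prod.swap)) 0 1).map Prod.swap := by
  rw [pairLaw_mix3_left, pairLaw_mix3_right, Measure.map_map (by fun_prop) (by fun_prop)]
  refine Measure.ext_of_lintegral _ fun G hG => ?_
  rw [lintegral_map hG (by fun_prop), lintegral_map hG (by fun_prop),
    lintegral_gaussMix π (G := fun w => G (w.1, w.2.2)) (by fun_prop)]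
  have h1 : Measurable fun w : E D × (E D × E D) => G ((Prod.swap ∘ fun w => (w.2.1, w.1)) w) := by
    simp only [Function.comp_def, Prod.swap]
    fun_prop
  rw [lintegral_gaussMix _ h1]
  simp only [Function.comp_def, Prod.swap]
  have h2 : Measurable fun w : (E D × E D) × E D =>
      isoGaussianPDF (b • w.1.1 + a • w.1.2) v w.2 * G (w.2, w.1.1) := by fun_prop
  rw [lintegral_map h2.lintegral_prod_right' measurable_swap]
  refine lintegral_congr fun z => lintegral_congr fun m => ?_
  rw [Prod.fst_swap, Prod.snd_swap, add_comm]

lemma prod_ac_pairLaw_left (hv : 0 < v) (π : Measure (E D × E D)) [SFinite π] :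
    (π.map Prod.fst).prod volume ≪ pairLaw (mix3 a b v π) 0 1 := by
  rw [← map_prod_left, pairLaw_mix3_left]
  exact (prod_ac_gaussMix hv π).map (by fun_prop)

lemma prod_ac_pairLaw_right (hv : 0 < v) (π : Measure (E D × E D)) [SFinite π] :
    (volume : Measure (E D)).prod (π.map Prod.snd) ≪ pairLaw (mix3 a b v π) 1 2 := by
  rw [← map_prod_right, pairLaw_mix3_right]
  exact (prod_ac_gaussMix hv π).map (by fun_prop)

lemma projMPDF_three (q : Measure (Fin (1 + 2) → E D)) (x : Fin (1 + 2) → E D) :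
    projMPDF q x = marginalPDF q 0 (x 0) * transitionPDF q 0 1 (x 0) (x 1) *
      transitionPDF q 1 2 (x 1) (x 2) := by
  rw [mul_assoc]
  exact congrArg _ (Fin.prod_univ_two _)

lemma ae_transitionPDF_pos {n : ℕ} {q : Measure (Fin n → E D)} [IsProbabilityMeasure q]
    (hq : q ≪ volume) {i j : Fin n} (hij : i ≠ j) {μ : Measure (E D × E D)}
    (hμ : μ ≪ pairLaw q i j) :
    ∀ᵐ z ∂μ, (marginalPDF q i z.1 ≠ 0 ∧ marginalPDF q i z.1 ≠ ∞) ∧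
      transitionPDF q i j z.1 z.2 ≠ 0 ∧ transitionPDF q i j z.1 z.2 ≠ ∞ := by
  have hp := pairLaw_ac hq hij
  have hc := coordLaw_ac hq i
  have h1 : ∀ᵐ z ∂(pairLaw q i j), marginalPDF q i z.1 ≠ 0 ∧ marginalPDF q i z.1 ≠ ∞ := by
    refine ae_of_ae_map (f := Prod.fst) (p := fun a => marginalPDF q i a ≠ 0 ∧ marginalPDF q i a ≠ ∞)
      measurable_fst.aemeasurable ?_
    rw [← coordLaw_eq_fst]
    filter_upwards [Measure.rnDeriv_pos hc, hc.ae_le (Measure.rnDeriv_lt_top (coordLaw q i) volume)]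
      with a ha hb
    exact ⟨ha.ne', hb.ne⟩
  refine hμ.ae_le ?_
  filter_upwards [h1, Measure.rnDeriv_pos hp,
    hp.ae_le (Measure.rnDeriv_lt_top (pairLaw q i j) volume)] with z h2 h3 h4
  refine ⟨h2, ?_, ?_⟩
  · rw [transitionPDF_eq]
    exact (ENNReal.div_pos h3.ne' h2.2).ne'
  · rw [transitionPDF_eq]
    exact ENNReal.div_ne_top h4.ne h2.1

lemma ae_ae_of_ae_mix3 (hv : 0 < v) {π : Measure (E D × E D)} [SFinite π]
    {P : (Fin (1 + 2) → E D) → Prop} (h : ∀ᵐ x ∂(mix3 a b v π), P x) :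
    ∀ᵐ m : E D, ∀ᵐ z ∂π, P (path3 (m, z)) :=
  Measure.ae_ae_of_ae_prod ((prod_ac_gaussMix hv π).ae_le
    (ae_of_ae_map measurable_path3.aemeasurable h))

/-- The marginals of a Markovian Gaussian mixture have a product law that is absolutely
continuous with respect to the mixing measure. -/
lemma prod_ac_of_projM_mix3 (hv : 0 < v) {π : Measure (E D × E D)} [IsProbabilityMeasure π]
    (hπ : π ≪ volume) (hM : projM (mix3 a b v π) = mix3 a b v π) :
    (π.map Prod.fst).prod (π.map Prod.snd) ≪ π := by
  have := isProbabilityMeasure_mix3 (a := a) (b := b) hv π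
  have hp := mix3_ac (a := a) (b := b) (v := v) hπ
  set p₀ := π.map Prod.fst with hp₀
  set p₁ := π.map Prod.snd with hp₁
  have : IsProbabilityMeasure p₀ := Measure.isProbabilityMeasure_map (by fun_prop)
  have : IsProbabilityMeasure p₁ := Measure.isProbabilityMeasure_map (by fun_prop)
  have hac0 : p₀ ≪ volume :=
    map_ac_of_quasi (μ := volume) Measure.quasiMeasurePreserving_fst hπ
  have hac1 : p₁ ≪ volume :=
    map_ac_of_quasi (μ := volume) Measure.quasiMeasurePreserving_snd hπ
  let lam : Measure (E D × (E D × E D)) := (volume : Measure (E D)).prod (p₀.prod p₁)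
  -- The Markovian density is a function of the left pair times one of the right pair. These are
  -- positive almost everywhere for `p₀ ⊗ volume` and `volume ⊗ p₁`, hence their product is so for
  -- `volume ⊗ p₀ ⊗ p₁`.
  have hlam : lam.map path3 ≪ mix3 a b v π := by
    have h1 : lam.map path3 ≪ projM (mix3 a b v π) := by
      rw [projM_eq_withDensity]
      refine ac_withDensity_of_ae_ne_zero (measurable_projMPDF _) ?_ ?_
      · refine Measure.AbsolutelyContinuous.trans
          (Measure.AbsolutelyContinuous.map ?_ measurable_path3)
          measurePreserving_path3.quasiMeasurePreserving.absolutelyContinuous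
        exact Measure.AbsolutelyContinuous.rfl.prod (hac0.prod hac1)
      · have hl := ae_transitionPDF_pos hp (i := 0) (j := 1) (by decide)
          (prod_ac_pairLaw_left (a := a) (b := b) hv π)
        have hr := ae_transitionPDF_pos hp (i := 1) (j := 2) (by decide)
          (prod_ac_pairLaw_right (a := a) (b := b) hv π)
        have e1 := map_prod_left (p₀.prod p₁)
        have e2 := map_prod_right (p₀.prod p₁)
        rw [Measure.map_fst_prod, measure_univ, one_smul] at e1
        rw [Measure.map_snd_prod, measure_univ, one_smul] at e2
        rw [← e1] at hl
        rw [← e2] at hr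
        have hS : MeasurableSet {x | projMPDF (mix3 a b v π) x ≠ 0} :=
          ((measurable_projMPDF _) (measurableSet_singleton 0)).compl
        rw [ae_map_iff measurable_path3.aemeasurable hS]
        filter_upwards [ae_of_ae_map (by fun_prop) hl, ae_of_ae_map (by fun_prop) hr] with w h2 h3
        rw [projMPDF_three]
        exact mul_ne_zero (mul_ne_zero h2.1.1 h2.2.1) h3.2.1
    rwa [hM] at h1
  have h2 := hlam.map measurable_ends
  rw [map_ends_mix3 hv, Measure.map_map measurable_ends measurable_path3] at h2
  refine Measure.AbsolutelyContinuous.trans ?_ h2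
  have e : lam.map (ends ∘ path3) = lam.map Prod.snd := rfl
  rw [e, Measure.map_snd_prod]
  -- The endpoint image of `lam` is `p₀ ⊗ p₁` scaled by the Lebesgue mass of the whole space,
  -- possibly infinite but nonzero.
  refine Measure.AbsolutelyContinuous.mk fun s _ hs => ?_
  rw [Measure.smul_apply, smul_eq_mul, mul_eq_zero] at hs
  exact hs.resolve_left (isOpen_univ.measure_pos volume ⟨0, trivial⟩).ne'

end ThreeTimes

/-! ### Convergence of the couplings -/

section ThreeTimesLimit

variable {D : ℕ} {a b v : ℝ}

/-- The density of one mixture with respect to another depends only on the endpoints, while that of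
the projections factorizes once the middle point is fixed. One good middle point therefore brings
the couplings under `exists_subseq_rnDeriv_tendsto_one`. -/
lemma exists_subseq_mix3_rnDeriv_tendsto_one (hv : 0 < v) {π : Measure (E D × E D)}
    [IsProbabilityMeasure π] (hπ : π ≪ volume) (hM : projM (mix3 a b v π) = mix3 a b v π)
    {πl : ℕ → Measure (E D × E D)} [∀ l, IsProbabilityMeasure (πl l)]
    {C : ℝ≥0∞} (hC : C ≠ ∞) (hKL : ∀ l, klDiv (πl l) π ≤ C)
    (hfst : ∀ l, (πl l).map Prod.fst = π.map Prod.fst)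
    (hsnd : ∀ l, (πl l).map Prod.snd = π.map Prod.snd)
    (hfin : ∀ l, klDiv (mix3 a b v (πl l)) (projM (mix3 a b v (πl l))) < ∞)
    (hlim : Tendsto (fun l => klDiv (mix3 a b v (πl l)) (projM (mix3 a b v (πl l))))
      atTop (𝓝 0)) :
    ∃ ns : ℕ → ℕ, StrictMono ns ∧
      ∀ᵐ z ∂π, Tendsto (fun k => ((πl (ns k)).rnDeriv π z).toReal) atTop (𝓝 1) := by
  have hac (l : ℕ) : πl l ≪ π := ac_of_klDiv_lt_top ((hKL l).trans_lt hC.lt_top)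
  have := isProbabilityMeasure_mix3 (a := a) (b := b) hv π
  have (l : ℕ) := isProbabilityMeasure_mix3 (a := a) (b := b) hv (πl l)
  have hp := mix3_ac (a := a) (b := b) (v := v) hπ
  have hq (l : ℕ) := mix3_ac (a := a) (b := b) (v := v) ((hac l).trans hπ)
  have hlift (l : ℕ) := mix3_eq_lift (a := a) (b := b) hv (hac l)
  have hends := map_ends_mix3 (a := a) (b := b) hv π
  have hprod := prod_ac_of_projM_mix3 hv hπ hM
  set p := mix3 a b v π with hp_def
  set q := fun l => mix3 a b v (πl l) with hq_def
  have hqp (l : ℕ) : q l ≪ p := by simp only [q]; rw [hlift l]; exact lift_ac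
  obtain ⟨n₁, hn₁, hlim₁⟩ := exists_subseq_rnDeriv_sub_projMPDF hp hM hqp hfin hlim
  have hrn (l : ℕ) : (q l).rnDeriv p =ᵐ[p] fun x => (πl l).rnDeriv π (ends x) := by
    have := rnDeriv_lift (μ := p) (ν := πl l) measurable_ends
    rw [hends, ← hlift l] at this
    exact this
  let A (r : Measure (Fin (1 + 2) → E D)) (m x : E D) : ℝ≥0∞ :=
    marginalPDF r 0 x * transitionPDF r 0 1 x m
  let B (r : Measure (Fin (1 + 2) → E D)) (m y : E D) : ℝ≥0∞ := transitionPDF r 1 2 m y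
  have hAm (r : Measure (Fin (1 + 2) → E D)) (m : E D) : Measurable (A r m) :=
    (measurable_marginalPDF r 0).mul
      ((measurable_transitionPDF r 0 1).comp (by fun_prop : Measurable fun x : E D => (x, m)))
  have hBm (r : Measure (Fin (1 + 2) → E D)) (m : E D) : Measurable (B r m) :=
    (measurable_transitionPDF r 1 2).comp (by fun_prop : Measurable fun y : E D => (m, y))
  have hmain : ∀ᵐ m : E D, ∀ᵐ z ∂π, Tendsto (fun k => ((πl (n₁ k)).rnDeriv π z).toReal -
      (A (q (n₁ k)) m z.1 / A p m z.1).toReal * (B (q (n₁ k)) m z.2 / B p m z.2).toReal)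
      atTop (𝓝 0) := by
    have h1 : ∀ᵐ x ∂p, Tendsto (fun k => ((πl (n₁ k)).rnDeriv π (ends x)).toReal -
        (projMPDF (q (n₁ k)) x / projMPDF p x).toReal) atTop (𝓝 0) := by
      filter_upwards [hlim₁, ae_all_iff.2 hrn] with x h2 h3
      exact h2.congr fun k => by rw [h3]
    filter_upwards [ae_ae_of_ae_mix3 hv h1] with m hm
    filter_upwards [hm] with z hz
    refine hz.congr fun k => ?_
    rw [ends_path3, projMPDF_three, projMPDF_three, ← ENNReal.toReal_mul]
    simp only [ENNReal.toReal_mul, ENNReal.toReal_div, A, B]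
    congr 1
    exact mul_div_mul_comm _ _ _ _
  have hposA (π' : Measure (E D × E D)) [IsProbabilityMeasure π'] (h : π' ≪ volume)
      (hf : π'.map Prod.fst = π.map Prod.fst) :
      ∀ᵐ m : E D, ∀ᵐ x ∂(π.map Prod.fst),
        A (mix3 a b v π') m x ≠ 0 ∧ A (mix3 a b v π') m x ≠ ∞ := by
    have := isProbabilityMeasure_mix3 (a := a) (b := b) hv π'
    have h1 := ae_transitionPDF_pos (mix3_ac (a := a) (b := b) (v := v) h) (i := 0) (j := 1)
      (by decide) (prod_ac_pairLaw_left (a := a) (b := b) hv π')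
    rw [hf] at h1
    have h2 := (Measure.measurePreserving_swap (μ := (volume : Measure (E D)))
      (ν := π.map Prod.fst)).quasiMeasurePreserving.ae h1
    filter_upwards [Measure.ae_ae_of_ae_prod h2] with m hm
    filter_upwards [hm] with x hx
    exact ⟨mul_ne_zero hx.1.1 hx.2.1, ENNReal.mul_ne_top hx.1.2 hx.2.2⟩
  have hposB (π' : Measure (E D × E D)) [IsProbabilityMeasure π'] (h : π' ≪ volume)
      (hs : π'.map Prod.snd = π.map Prod.snd) :
      ∀ᵐ m : E D, ∀ᵐ y ∂(π.map Prod.snd),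
        B (mix3 a b v π') m y ≠ 0 ∧ B (mix3 a b v π') m y ≠ ∞ := by
    have := isProbabilityMeasure_mix3 (a := a) (b := b) hv π'
    have h1 := ae_transitionPDF_pos (mix3_ac (a := a) (b := b) (v := v) h) (i := 1) (j := 2)
      (by decide) (prod_ac_pairLaw_right (a := a) (b := b) hv π')
    rw [hs] at h1
    filter_upwards [Measure.ae_ae_of_ae_prod h1] with m hm
    filter_upwards [hm] with y hy
    exact hy.2
  -- Countably many almost everywhere conditions, so a single `m` satisfies them for every `l`.
  obtain ⟨m, hm, hA, hAl, hB, hBl⟩ := (hmain.and ((hposA π hπ rfl).and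
    ((ae_all_iff.2 fun l => hposA (πl l) ((hac l).trans hπ) (hfst l)).and
    ((hposB π hπ rfl).and
      (ae_all_iff.2 fun l => hposB (πl l) ((hac l).trans hπ) (hsnd l)))))).exists
  obtain ⟨n₂, hn₂, h⟩ := exists_subseq_rnDeriv_tendsto_one (πl := fun k => πl (n₁ k)) hprod
    (fun k => hac (n₁ k)) (fun k => hfst (n₁ k)) (fun k => hsnd (n₁ k)) hC (fun k => hKL (n₁ k))
    (U := fun k x => (A (q (n₁ k)) m x / A p m x).toReal)
    (V := fun k y => (B (q (n₁ k)) m y / B p m y).toReal)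
    (fun k => ((hAm _ m).div (hAm _ m)).ennreal_toReal)
    (fun k => ((hBm _ m).div (hBm _ m)).ennreal_toReal)
    (fun k => by
      filter_upwards [hA, hAl (n₁ k)] with x h1 h2
      exact ENNReal.toReal_pos (ENNReal.div_pos h2.1 h1.2).ne' (ENNReal.div_ne_top h2.2 h1.1))
    (fun k => by
      filter_upwards [hB, hBl (n₁ k)] with x h1 h2
      exact ENNReal.toReal_pos (ENNReal.div_pos h2.1 h1.2).ne' (ENNReal.div_ne_top h2.2 h1.1))
    hm
  exact ⟨fun k => n₁ (n₂ k), hn₁.comp hn₂, h⟩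

/-- Couplings whose Gaussian mixtures are asymptotically Markovian converge to the coupling with
the same marginals whose Gaussian mixture is Markovian. -/
theorem exists_subseq_klDiv_tendsto_zero (hv : 0 < v) {π : Measure (E D × E D)}
    [IsProbabilityMeasure π] (hπ : π ≪ volume) (hM : projM (mix3 a b v π) = mix3 a b v π)
    {πl : ℕ → Measure (E D × E D)} [∀ l, IsProbabilityMeasure (πl l)]
    {C : ℝ≥0∞} (hC : C ≠ ∞) (hKL : ∀ l, klDiv (πl l) π ≤ C)
    (hfst : ∀ l, (πl l).map Prod.fst = π.map Prod.fst)
    (hsnd : ∀ l, (πl l).map Prod.snd = π.map Prod.snd)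
    (hmom0 : ∫⁻ x, ENNReal.ofReal (‖x‖ ^ 2) ∂(π.map Prod.fst) < ∞)
    (hmom1 : ∫⁻ y, ENNReal.ofReal (‖y‖ ^ 2) ∂(π.map Prod.snd) < ∞)
    (hfin : ∀ l, klDiv (mix3 a b v (πl l)) (projM (mix3 a b v (πl l))) < ∞)
    (hlim : Tendsto (fun l => klDiv (mix3 a b v (πl l)) (projM (mix3 a b v (πl l))))
      atTop (𝓝 0)) :
    ∃ ns : ℕ → ℕ, StrictMono ns ∧ Tendsto (fun k => klDiv (πl (ns k)) π) atTop (𝓝 0) := by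
  have hac (l : ℕ) : πl l ≪ π := ac_of_klDiv_lt_top ((hKL l).trans_lt hC.lt_top)
  obtain ⟨n₁, hn₁, hρ⟩ :=
    exists_subseq_mix3_rnDeriv_tendsto_one hv hπ hM hC hKL hfst hsnd hfin hlim
  obtain ⟨n₂, hn₂, hleft⟩ := exists_subseq_klDiv_gaussMix (a := a) (b := b) hv hπ
    (πl := fun k => πl (n₁ k)) hC (fun k => hKL _) (fun k => hfst _) (fun k => hsnd _) hmom1 hρ
  have hsw (μ : Measure (E D × E D)) : (μ.map Prod.swap).map Prod.fst = μ.map Prod.snd := by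
    rw [Measure.map_map measurable_fst measurable_swap]; rfl
  have hsw' (μ : Measure (E D × E D)) : (μ.map Prod.swap).map Prod.snd = μ.map Prod.fst := by
    rw [Measure.map_map measurable_snd measurable_swap]; rfl
  have (l : ℕ) : IsProbabilityMeasure ((πl l).map Prod.swap) :=
    Measure.isProbabilityMeasure_map measurable_swap.aemeasurable
  have : IsProbabilityMeasure (π.map Prod.swap) :=
    Measure.isProbabilityMeasure_map measurable_swap.aemeasurable
  have hemb : MeasurableEmbedding (Prod.swap : E D × E D → E D × E D) :=
    (MeasurableEquiv.prodComm (α := E D) (β := E D)).measurableEmbedding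
  -- The same estimate for the reversed couplings controls the pair made of the middle point and the
  -- last endpoint.
  obtain ⟨n₃, hn₃, hright⟩ := exists_subseq_klDiv_gaussMix (a := b) (b := a) hv
    (π := π.map Prod.swap) (πl := fun k => (πl (n₁ (n₂ k))).map Prod.swap)
    (map_ac_of_quasi (μ := volume)
      (Measure.measurePreserving_swap (μ := (volume : Measure (E D)))
        (ν := (volume : Measure (E D)))).quasiMeasurePreserving hπ) hC
    (fun k => (klDiv_map_le _ _ measurable_swap).trans (hKL _))
    (fun k => by rw [hsw, hsw, hsnd]) (fun k => by rw [hsw', hsw', hfst])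
    (by rw [hsw']; exact hmom0) (by
      rw [hemb.ae_map_iff]
      filter_upwards [hρ, ae_all_iff.2 fun l => hemb.rnDeriv_map (πl l) π] with z h1 h2
      refine (h1.comp hn₂.tendsto_atTop).congr fun k => ?_
      rw [h2, Function.comp_apply])
  refine ⟨fun k => n₁ (n₂ (n₃ k)), hn₁.comp (hn₂.comp hn₃), ?_⟩
  have := isProbabilityMeasure_mix3 (a := a) (b := b) hv π
  have (l : ℕ) := isProbabilityMeasure_mix3 (a := a) (b := b) hv (πl l)
  have hp := mix3_ac (a := a) (b := b) (v := v) hπ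
  have hends := map_ends_mix3 (a := a) (b := b) hv π
  -- Lifting preserves the divergence, Pythagoras isolates the defect of Markovianity, and the
  -- remainder is at most the sum over the two consecutive pairs.
  have hle (l : ℕ) : klDiv (πl l) π ≤ klDiv (mix3 a b v (πl l)) (projM (mix3 a b v (πl l))) +
      (klDiv ((gaussMix a b v (πl l)).map fun w => (w.2.1, w.1))
        ((gaussMix a b v π).map fun w => (w.2.1, w.1)) +
      klDiv ((gaussMix b a v ((πl l).map Prod.swap)).map fun w => (w.2.1, w.1))
        ((gaussMix b a v (π.map Prod.swap)).map fun w => (w.2.1, w.1))) := by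
    have e : klDiv (mix3 a b v (πl l)) (mix3 a b v π) = klDiv (πl l) π := by
      rw [mix3_eq_lift hv (hac l), klDiv_lift measurable_ends (by rw [hends]; exact hac l), hends]
    have hlt : klDiv (mix3 a b v (πl l)) (mix3 a b v π) < ∞ := e ▸ (hKL l).trans_lt hC.lt_top
    rw [← e, klDiv_eq_add_projM hp hM hlt]
    gcongr
    refine (klDiv_projM_le hp hM hlt).trans ?_
    refine (Fin.sum_univ_two (fun i : Fin 2 =>
      klDiv (pairLaw (mix3 a b v (πl l)) i.castSucc i.succ)
        (pairLaw (mix3 a b v π) i.castSucc i.succ))).le.trans ?_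
    refine add_le_add (le_of_eq ?_) ?_
    · rw [← pairLaw_mix3_left, ← pairLaw_mix3_left]
      rfl
    · have := isProbabilityMeasure_mix3 (a := b) (b := a) hv (π.map Prod.swap)
      have := isProbabilityMeasure_mix3 (a := b) (b := a) hv ((πl l).map Prod.swap)
      change klDiv (pairLaw (mix3 a b v (πl l)) 1 2) (pairLaw (mix3 a b v π) 1 2) ≤ _
      rw [pairLaw_mix3_right_eq_swap, pairLaw_mix3_right_eq_swap, ← pairLaw_mix3_left,
        ← pairLaw_mix3_left]
      exact klDiv_map_le _ _ measurable_swap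
  refine tendsto_of_tendsto_of_tendsto_of_le_of_le tendsto_const_nhds ?_ (fun k => zero_le)
    (fun k => hle _)
  have h1 := hlim.comp (hn₁.comp (hn₂.comp hn₃)).tendsto_atTop
  have h2 := hleft.comp hn₃.tendsto_atTop
  simpa using h1.add (h2.add hright)

end ThreeTimesLimit

/-! ### Reduction to three times and convergence of the iteration -/

section Convergence

variable {D N : ℕ} {ε : ℝ} {p₀ p₁ : Measure (E D)} {W T : Measure (PathSpace D)}
  {t : Fin (N + 2) → unitInterval}

/-- The first, second and last time. -/
def triTimes (t : Fin (N + 2) → unitInterval) : Fin (1 + 2) → unitInterval := ![0, t 1, 1]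

lemma map_tri_discretize (ht0 : t 0 = 0) (ht1 : t (Fin.last (N + 1)) = 1)
    (T : Measure (PathSpace D)) : (discretize t T).map tri = discretize (triTimes t) T := by
  rw [discretize, Measure.map_map measurable_tri (measurable_discretize_map t), discretize]
  congr 1
  ext ω i : 2
  fin_cases i
  · exact congrArg ω ht0
  · rfl
  · exact congrArg ω ht1

lemma zero_lt_time_one (ht : StrictMono t) (ht0 : t 0 = 0) : 0 < t 1 := by
  rw [← ht0]
  exact ht (by rw [Fin.lt_def]; simp)

lemma time_one_lt_one (hN : 1 ≤ N) (ht : StrictMono t) (ht1 : t (Fin.last (N + 1)) = 1) :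
    t 1 < 1 := by
  rw [← ht1]
  refine ht ?_
  rw [Fin.lt_def, Fin.val_one, Fin.val_last]
  omega

lemma strictMono_triTimes (h0 : 0 < t 1) (h1 : t 1 < 1) : StrictMono (triTimes t) := by
  refine Fin.strictMono_iff_lt_succ.2 fun i => ?_
  fin_cases i
  · exact h0
  · exact h1

lemma map_withDensity_comp {X Y : Type*} [MeasurableSpace X] [MeasurableSpace Y] {μ : Measure X}
    {ν : Measure Y} {g : X → Y} (hg : MeasurePreserving g μ ν) {f : Y → ℝ≥0∞}
    (hf : Measurable f) : (μ.withDensity fun x => f (g x)).map g = ν.withDensity f := by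
  refine Measure.ext_of_lintegral _ fun G hG => ?_
  rw [lintegral_map hG hg.measurable, lintegral_withDensity_eq_lintegral_mul _ hf hG,
    ← hg.lintegral_comp (hf.mul hG)]
  exact lintegral_withDensity_eq_lintegral_mul _ (hf.comp hg.measurable) (hG.comp hg.measurable)

lemma bridgeMixture_triTimes {π : Measure (E D × E D)} [IsFiniteMeasure π] (hπ : π ≪ volume) :
    bridgeMixture ε (triTimes t) π =
      mix3 (1 - (t 1 : ℝ)) (t 1 : ℝ) (ε * ((t 1 : ℝ) * (1 - t 1))) π := by
  set s : ℝ := (t 1 : ℝ) with hs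
  set v : ℝ := ε * (s * (1 - s))
  set r := π.rnDeriv volume with hr_def
  have hr : Measurable r := Measure.measurable_rnDeriv _ _
  have hπr : π = volume.withDensity r := (Measure.withDensity_rnDeriv_eq _ _ hπ).symm
  let f (x : Fin (1 + 2) → E D) : ℝ≥0∞ :=
    r (x 0, x 2) * isoGaussianPDF ((1 - s) • x 0 + s • x 2) v (x 1)
  have hf : Measurable f := by fun_prop
  have h1 : gaussMix (1 - s) s v π =
      (volume : Measure (E D × (E D × E D))).withDensity fun w => f (path3 w) := by
    rw [gaussMix]
    conv_lhs => rw [hπr]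
    rw [prod_withDensity_right hr, ← withDensity_mul _ (by fun_prop) (by fun_prop)]
    rfl
  rw [mix3, h1, map_withDensity_comp measurePreserving_path3 hf, bridgeMixture]
  congr 1
  ext x : 1
  have e : bridgePDF ε (triTimes t) x = isoGaussianPDF ((1 - s) • x 0 + s • x 2) v (x 1) := by
    rw [bridgePDF]
    refine (Fin.prod_univ_one _).trans ?_
    change isoGaussianPDF (x 0 + ((s - ((0 : unitInterval) : ℝ)) / (1 - ((0 : unitInterval) : ℝ))) •
      (x 2 - x 0)) (ε * ((s - ((0 : unitInterval) : ℝ)) * (1 - s) /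
        (1 - ((0 : unitInterval) : ℝ)))) (x 1) = _
    simp only [Set.Icc.coe_zero, sub_zero, div_one]
    congr 1
    rw [smul_sub, sub_smul, one_smul]
    abel
  rw [e, mul_comm]
  rfl

lemma IsP2ac.lintegral_ofReal_sq_lt_top (h : IsP2ac p₀) :
    ∫⁻ x, ENNReal.ofReal (‖x‖ ^ 2) ∂p₀ < ∞ := by
  refine lt_of_eq_of_lt (lintegral_congr fun x => ?_) h.secondMoment
  rw [ENNReal.ofReal_pow (norm_nonneg _), ofReal_norm]

/-- If the bridge mixtures of couplings with the marginals of the Schrödinger bridge are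
asymptotically Markovian, then the couplings converge to the endpoints of the bridge. -/
theorem exists_subseq_klDiv_pathEndpoints (hN : 1 ≤ N) (hε : 0 < ε) (ht : StrictMono t)
    (ht0 : t 0 = 0) (ht1 : t (Fin.last (N + 1)) = 1) (hW : IsWienerLaw ε p₀ W) (h0 : IsP2ac p₀)
    (h1 : IsP2ac p₁) (hT : IsSchrodingerBridge p₀ p₁ W T)
    {πl : ℕ → Measure (E D × E D)} [∀ l, IsProbabilityMeasure (πl l)]
    {C : ℝ≥0∞} (hC : C ≠ ∞) (hKL : ∀ l, klDiv (πl l) (pathEndpoints T) ≤ C)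
    (hfst : ∀ l, (πl l).map Prod.fst = p₀) (hsnd : ∀ l, (πl l).map Prod.snd = p₁)
    (hfin : ∀ l, klDiv (lift (discretize t T) ends (πl l))
      (projM (lift (discretize t T) ends (πl l))) < ∞)
    (hlim : Tendsto (fun l => klDiv (lift (discretize t T) ends (πl l))
      (projM (lift (discretize t T) ends (πl l)))) atTop (𝓝 0)) :
    ∃ ns : ℕ → ℕ, StrictMono ns ∧
      Tendsto (fun k => klDiv (πl (ns k)) (pathEndpoints T)) atTop (𝓝 0) := by
  have := hW.isProbabilityMeasure
  have := hT.isBetween.isProbabilityMeasure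
  have hs0 := zero_lt_time_one ht ht0
  have hs1 := time_one_lt_one hN ht ht1
  have hv : 0 < ε * ((t 1 : ℝ) * (1 - t 1)) := by
    have h2 : (0 : ℝ) < t 1 := hs0
    have h3 : (t 1 : ℝ) < 1 := hs1
    exact mul_pos hε (mul_pos h2 (by linarith))
  have htri := strictMono_triTimes hs0 hs1
  have hπ := pathEndpoints_schrodinger_ac hε hW h0 h1 hT
  have hπfst := hT.pathEndpoints_fst
  have hπsnd := hT.pathEndpoints_snd
  have hac (l : ℕ) : πl l ≪ pathEndpoints T :=
    ac_of_klDiv_lt_top ((hKL l).trans_lt hC.lt_top)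
  have hp3 : discretize (triTimes t) T =
      mix3 (1 - (t 1 : ℝ)) (t 1 : ℝ) (ε * ((t 1 : ℝ) * (1 - t 1))) (pathEndpoints T) := by
    rw [discretize_schrodinger_eq_lift hε hW h0 h1 hT rfl rfl,
      ← bridgeMixture_eq_lift hε hW h0.absolutelyContinuous htri rfl rfl hπ hπfst,
      bridgeMixture_triTimes hπ]
  have hM := projM_discretize_schrodinger hε hW h0 h1 hT htri rfl rfl
  rw [hp3] at hM
  have hp := discretize_schrodinger_ac hε hW h0 h1 hT ht ht0
  have hacl (l : ℕ) : πl l ≪ (discretize t T).map ends := by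
    rw [endpoints_discretize ht0 ht1]; exact hac l
  have (l : ℕ) := isProbabilityMeasure_lift measurable_ends (hacl l)
  have hq3 (l : ℕ) : (lift (discretize t T) ends (πl l)).map tri =
      mix3 (1 - (t 1 : ℝ)) (t 1 : ℝ) (ε * ((t 1 : ℝ) * (1 - t 1))) (πl l) := by
    have h2 := lift_map (μ := discretize t T) (e := ends) (ν := πl l) measurable_tri
      measurable_ends
    rw [map_tri_discretize ht0 ht1, hp3, ← mix3_eq_lift hv (hac l)] at h2
    exact h2
  -- The three-time image of the Markovian projection is again Markovian, so Pythagoras with it as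
  -- reference shows that the three-time projection is at least as close; data processing gives the
  -- rest.
  have hle (l : ℕ) : klDiv (mix3 (1 - (t 1 : ℝ)) (t 1 : ℝ) (ε * ((t 1 : ℝ) * (1 - t 1))) (πl l))
      (projM (mix3 (1 - (t 1 : ℝ)) (t 1 : ℝ) (ε * ((t 1 : ℝ) * (1 - t 1))) (πl l))) ≤
      klDiv (lift (discretize t T) ends (πl l))
        (projM (lift (discretize t T) ends (πl l))) := by
    have hq : lift (discretize t T) ends (πl l) ≪ volume := lift_ac.trans hp
    have := isProbabilityMeasure_projM hq
    have : IsProbabilityMeasure ((projM (lift (discretize t T) ends (πl l))).map tri) :=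
      Measure.isProbabilityMeasure_map measurable_tri.aemeasurable
    have : IsProbabilityMeasure ((lift (discretize t T) ends (πl l)).map tri) :=
      Measure.isProbabilityMeasure_map measurable_tri.aemeasurable
    have hm := klDiv_map_le (lift (discretize t T) ends (πl l))
      (projM (lift (discretize t T) ends (πl l))) measurable_tri
    have hPM := projM_map_tri hN hq
    have hPac : (projM (lift (discretize t T) ends (πl l))).map tri ≪ volume := hPM ▸ projM_ac
    rw [← hq3 l]
    refine le_trans ?_ hm
    rw [klDiv_eq_add_projM hPac hPM (hm.trans_lt (hfin l))]
    exact le_self_add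
  exact exists_subseq_klDiv_tendsto_zero hv hπ hM hC hKL (fun l => by rw [hπfst, hfst])
    (fun l => by rw [hπsnd, hsnd]) (by rw [hπfst]; exact h0.lintegral_ofReal_sq_lt_top)
    (by rw [hπsnd]; exact h1.lintegral_ofReal_sq_lt_top)
    (fun l => (hle l).trans_lt (hfin l))
    (tendsto_of_tendsto_of_tendsto_of_le_of_le tendsto_const_nhds hlim (fun _ => zero_le) hle)

/-- The invariants of the iterative Markovian fitting procedure. -/
structure IsIterate (p₀ p₁ : Measure (E D)) (p q : Measure (Fin (N + 2) → E D)) : Prop where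
  isProbabilityMeasure : IsProbabilityMeasure q
  klDiv_lt_top : klDiv q p < ∞
  initial : coordLaw q 0 = p₀
  final : coordLaw q (Fin.last (N + 1)) = p₁

lemma IsIterate.of_eq_add {p q q' : Measure (Fin (N + 2) → E D)} (h : IsIterate p₀ p₁ p q)
    [IsProbabilityMeasure q'] (he : klDiv q p = klDiv q q' + klDiv q' p)
    (h0 : coordLaw q' 0 = coordLaw q 0)
    (h1 : coordLaw q' (Fin.last (N + 1)) = coordLaw q (Fin.last (N + 1))) :
    IsIterate p₀ p₁ p q' :=
  ⟨inferInstance, lt_of_le_of_lt (he ▸ le_add_self) h.klDiv_lt_top, h0.trans h.initial,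
    h1.trans h.final⟩

lemma IsIterate.projM {p q : Measure (Fin (N + 2) → E D)} [IsProbabilityMeasure p]
    (h : IsIterate p₀ p₁ p q) (hp : p ≪ volume) (hpM : projM p = p) :
    IsIterate p₀ p₁ p (projM q) ∧ klDiv q p = klDiv q (DIMF.projM q) + klDiv (DIMF.projM q) p := by
  have := h.isProbabilityMeasure
  have hq := (ac_of_klDiv_lt_top h.klDiv_lt_top).trans hp
  have := isProbabilityMeasure_projM hq
  have he := klDiv_eq_add_projM hp hpM h.klDiv_lt_top
  exact ⟨h.of_eq_add he (coordLaw_projM hq _) (coordLaw_projM hq _), he⟩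

lemma IsIterate.lift {p q : Measure (Fin (N + 2) → E D)} [IsProbabilityMeasure p]
    (h : IsIterate p₀ p₁ p q) :
    IsIterate p₀ p₁ p (lift p ends (q.map ends)) ∧
      klDiv q p = klDiv q (DIMF.lift p ends (q.map ends)) +
        klDiv (DIMF.lift p ends (q.map ends)) p := by
  have := h.isProbabilityMeasure
  have hac := (ac_of_klDiv_lt_top h.klDiv_lt_top).map measurable_ends
  have : IsProbabilityMeasure (q.map ends) :=
    Measure.isProbabilityMeasure_map measurable_ends.aemeasurable
  have := isProbabilityMeasure_lift measurable_ends hac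
  have hm := map_lift measurable_ends hac
  have he := klDiv_eq_add_lift measurable_ends h.klDiv_lt_top
  refine ⟨h.of_eq_add he ?_ ?_, he⟩
  · rw [← map_ends_fst, hm, map_ends_fst]
  · rw [← map_ends_snd, hm, map_ends_snd]

/-- The Wiener process and the Schrödinger bridge have the same conditional law given the endpoints,
so `lift_lift` exchanges the reference. -/
lemma bridgeMixture_eq_lift_schrodinger (hε : 0 < ε) (ht : StrictMono t) (ht0 : t 0 = 0)
    (ht1 : t (Fin.last (N + 1)) = 1) (hW : IsWienerLaw ε p₀ W) (h0 : IsP2ac p₀)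
    (h1 : IsP2ac p₁) (hT : IsSchrodingerBridge p₀ p₁ W T)
    {π : Measure (E D × E D)} [IsProbabilityMeasure π] (hπ : π ≪ pathEndpoints T)
    (hfst : π.map Prod.fst = p₀) :
    bridgeMixture ε t π = lift (discretize t T) ends π := by
  have := hW.isProbabilityMeasure
  have := hT.isBetween.isProbabilityMeasure
  have hπT := pathEndpoints_schrodinger_ac hε hW h0 h1 hT
  have hac : pathEndpoints T ≪ (discretize t W).map ends := by
    rw [endpoints_discretize ht0 ht1]
    exact ac_pathEndpoints_wiener hε hW h0.absolutelyContinuous hπT hT.pathEndpoints_fst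
  rw [bridgeMixture_eq_lift hε hW h0.absolutelyContinuous ht ht0 ht1 (hπ.trans hπT) hfst,
    discretize_schrodinger_eq_lift hε hW h0 h1 hT ht0 ht1, lift_lift measurable_ends hac hπ]

/-- The iterates approach the Schrödinger bridge monotonically. -/
lemma isIterate_dimf (hε : 0 < ε) (ht : StrictMono t) (ht0 : t 0 = 0)
    (ht1 : t (Fin.last (N + 1)) = 1) (hW : IsWienerLaw ε p₀ W) (h0 : IsP2ac p₀)
    (h1 : IsP2ac p₁) (hT : IsSchrodingerBridge p₀ p₁ W T)
    {π : Measure (E D × E D)} (hπ : IsCoupling p₀ p₁ π)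
    (hstart : klDiv (dimf ε t π 0) (discretize t T) < ∞) (l : ℕ) :
    IsIterate p₀ p₁ (discretize t T) (dimf ε t π l) ∧
      (Even l → dimf ε t π l = lift (discretize t T) ends ((dimf ε t π l).map ends)) ∧
      klDiv (dimf ε t π l) (discretize t T) = klDiv (dimf ε t π l) (dimf ε t π (l + 1)) +
        klDiv (dimf ε t π (l + 1)) (discretize t T) := by
  have := hW.isProbabilityMeasure
  have := hT.isBetween.isProbabilityMeasure
  have hp := discretize_schrodinger_ac hε hW h0 h1 hT ht ht0
  have hpM := projM_discretize_schrodinger hε hW h0 h1 hT ht ht0 ht1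
  -- Finite divergence to the bridge supplies the absolute continuity of the endpoints that this
  -- identification needs.
  have hprojR {q : Measure (Fin (N + 2) → E D)} (h : IsIterate p₀ p₁ (discretize t T) q) :
      projR ε t q = lift (discretize t T) ends (q.map ends) := by
    have := h.isProbabilityMeasure
    have : IsProbabilityMeasure (q.map ends) :=
      Measure.isProbabilityMeasure_map measurable_ends.aemeasurable
    change bridgeMixture ε t (q.map ends) = _
    refine bridgeMixture_eq_lift_schrodinger hε ht ht0 ht1 hW h0 h1 hT ?_ ?_
    · rw [← endpoints_discretize ht0 ht1]
      exact (ac_of_klDiv_lt_top h.klDiv_lt_top).map measurable_ends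
    · rw [map_ends_fst]; exact h.initial
  have hstep (l : ℕ) (h : IsIterate p₀ p₁ (discretize t T) (dimf ε t π l)) :
      IsIterate p₀ p₁ (discretize t T) (dimf ε t π (l + 1)) ∧
        klDiv (dimf ε t π l) (discretize t T) = klDiv (dimf ε t π l) (dimf ε t π (l + 1)) +
          klDiv (dimf ε t π (l + 1)) (discretize t T) := by
    rw [dimf]
    split_ifs with hl
    · exact h.projM hp hpM
    · rw [hprojR h]
      exact h.lift
  have hzero : IsIterate p₀ p₁ (discretize t T) (dimf ε t π 0) ∧
      dimf ε t π 0 = lift (discretize t T) ends ((dimf ε t π 0).map ends) := by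
    have := hπ.isP2ac.isProbabilityMeasure
    have hπv := hπ.isP2ac.absolutelyContinuous
    have hacW : π ≪ (discretize t W).map ends := by
      rw [endpoints_discretize ht0 ht1]
      exact ac_pathEndpoints_wiener hε hW h0.absolutelyContinuous hπv hπ.fst
    have hd : dimf ε t π 0 = lift (discretize t W) ends π :=
      bridgeMixture_eq_lift hε hW h0.absolutelyContinuous ht ht0 ht1 hπv hπ.fst
    have hm : (dimf ε t π 0).map ends = π := by rw [hd, map_lift measurable_ends hacW]
    have : IsProbabilityMeasure (dimf ε t π 0) := by
      rw [hd]; exact isProbabilityMeasure_lift measurable_ends hacW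
    refine ⟨⟨this, hstart, ?_, ?_⟩, ?_⟩
    · rw [← map_ends_fst, hm, hπ.fst]
    · rw [← map_ends_snd, hm, hπ.snd]
    · rw [hm]
      refine bridgeMixture_eq_lift_schrodinger hε ht ht0 ht1 hW h0 h1 hT ?_ hπ.fst
      rw [← endpoints_discretize ht0 ht1, ← hm]
      exact (ac_of_klDiv_lt_top hstart).map measurable_ends
  have hall (l : ℕ) : IsIterate p₀ p₁ (discretize t T) (dimf ε t π l) := by
    induction l with
    | zero => exact hzero.1
    | succ l ih => exact (hstep l ih).1
  refine ⟨hall l, fun hl => ?_, (hstep l (hall l)).2⟩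
  rcases l with _ | l
  · exact hzero.2
  · have hq := hall l
    have := hq.isProbabilityMeasure
    have hl' : ¬ Even l := by rwa [Nat.even_add_one] at hl
    have hd : dimf ε t π (l + 1) = lift (discretize t T) ends ((dimf ε t π l).map ends) := by
      rw [dimf, if_neg hl', hprojR hq]
    have hm : (dimf ε t π (l + 1)).map ends = (dimf ε t π l).map ends := by
      rw [hd, map_lift measurable_ends
        ((ac_of_klDiv_lt_top hq.klDiv_lt_top).map measurable_ends)]
    rw [hm, hd]

/-- A decreasing sequence of divergences has a limit; a subsequence of the even iterates, on which
the divergence equals that of the couplings, shows that this limit is zero. -/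
theorem tendsto_klDiv_dimf (hN : 1 ≤ N) (hε : 0 < ε) (ht : StrictMono t) (ht0 : t 0 = 0)
    (ht1 : t (Fin.last (N + 1)) = 1) (hW : IsWienerLaw ε p₀ W) (h0 : IsP2ac p₀)
    (h1 : IsP2ac p₁) (hT : IsSchrodingerBridge p₀ p₁ W T)
    {π : Measure (E D × E D)} (hπ : IsCoupling p₀ p₁ π)
    (hstart : klDiv (dimf ε t π 0) (discretize t T) < ∞) :
    Tendsto (fun l => klDiv (dimf ε t π l) (discretize t T)) atTop (𝓝 0) := by
  have := hT.isBetween.isProbabilityMeasure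
  have hit := isIterate_dimf hε ht ht0 ht1 hW h0 h1 hT hπ hstart
  have (l : ℕ) : IsProbabilityMeasure (dimf ε t π l) := (hit l).1.isProbabilityMeasure
  set A := fun l => klDiv (dimf ε t π l) (discretize t T) with hA
  have hAfin (l : ℕ) : A l < ∞ := (hit l).1.klDiv_lt_top
  have hanti : Antitone A := antitone_nat_of_succ_le fun l => by
    simp only [A]
    rw [(hit l).2.2]
    exact le_add_self
  have hlimA := tendsto_atTop_iInf hanti
  set L := ⨅ l, A l
  have hL : L ≠ ∞ := ((iInf_le A 0).trans_lt (hAfin 0)).ne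
  -- Each term is the difference of consecutive values of `A`; finiteness of `L` makes the
  -- subtraction in `ℝ≥0∞` continuous at the limit.
  have hδ : Tendsto (fun l => klDiv (dimf ε t π l) (dimf ε t π (l + 1))) atTop (𝓝 0) := by
    have h2 := ENNReal.Tendsto.sub hlimA (hlimA.comp (tendsto_add_atTop_nat 1)) (Or.inl hL)
    rw [tsub_self] at h2
    refine h2.congr fun l => ?_
    simp only [Function.comp_apply]
    rw [show A l = _ from (hit l).2.2]
    exact ENNReal.add_sub_cancel_right (hAfin (l + 1)).ne
  let πl (l : ℕ) : Measure (E D × E D) := (dimf ε t π (2 * l)).map ends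
  have (l : ℕ) : IsProbabilityMeasure (πl l) :=
    Measure.isProbabilityMeasure_map measurable_ends.aemeasurable
  have hlift (l : ℕ) : lift (discretize t T) ends (πl l) = dimf ε t π (2 * l) :=
    ((hit (2 * l)).2.1 (even_two_mul l)).symm
  have hproj (l : ℕ) : projM (dimf ε t π (2 * l)) = dimf ε t π (2 * l + 1) := by
    rw [dimf, if_pos (even_two_mul l)]
  have hac (l : ℕ) : πl l ≪ (discretize t T).map ends :=
    (ac_of_klDiv_lt_top (hAfin (2 * l))).map measurable_ends
  have hKL (l : ℕ) : klDiv (πl l) (pathEndpoints T) = A (2 * l) := by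
    simp only [A]
    rw [← hlift, klDiv_lift measurable_ends (hac l), endpoints_discretize ht0 ht1]
  have htwo : Tendsto (fun l : ℕ => 2 * l) atTop atTop :=
    tendsto_id.const_mul_atTop' (by norm_num)
  obtain ⟨ns, hns, hlim⟩ := exists_subseq_klDiv_pathEndpoints hN hε ht ht0 ht1 hW h0 h1 hT
    (πl := πl) (hAfin 0).ne (fun l => by rw [hKL]; exact hanti (Nat.zero_le _))
    (fun l => by simp only [πl]; rw [map_ends_fst]; exact (hit _).1.initial)
    (fun l => by simp only [πl]; rw [map_ends_snd]; exact (hit _).1.final)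
    (fun l => by
      rw [hlift, hproj]
      refine lt_of_le_of_lt ?_ (hAfin (2 * l))
      rw [show A (2 * l) = _ from (hit (2 * l)).2.2]
      exact le_self_add)
    (by simp only [hlift, hproj]; exact hδ.comp htwo)
  simp only [hKL] at hlim
  have h2 := hlimA.comp (htwo.comp hns.tendsto_atTop)
  rw [tendsto_nhds_unique h2 hlim] at hlimA
  exact hlimA

end Convergence

end DIMF

theorem mainTheorem4 (D N : ℕ) (hN : 1 ≤ N) (ε : ℝ) (hε : 0 < ε)
    (t : Fin (N + 2) → unitInterval) (ht : StrictMono t)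
    (ht0 : t 0 = 0) (ht1 : t (Fin.last (N + 1)) = 1)
    (p₀ p₁ : Measure (DIMF.E D)) (hp₀ : DIMF.IsP2ac p₀) (hp₁ : DIMF.IsP2ac p₁)
    (W : Measure (DIMF.PathSpace D)) (hW : DIMF.IsWienerLaw ε p₀ W)
    (Tstar : Measure (DIMF.PathSpace D)) (hT : DIMF.IsSchrodingerBridge p₀ p₁ W Tstar)
    (π : Measure (DIMF.E D × DIMF.E D)) (hπ : DIMF.IsCoupling p₀ p₁ π)
    (hstart : klDiv (DIMF.dimf ε t π 0) (DIMF.discretize t Tstar) < ∞)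
    (hsucc : ∀ l, klDiv (DIMF.dimf ε t π l) (DIMF.dimf ε t π (l + 1)) < ∞) :
    Tendsto (fun l => klDiv (DIMF.dimf ε t π l) (DIMF.discretize t Tstar)) atTop (𝓝 0) ∧
    DIMF.IsStaticSchrodingerBridge p₀ p₁ (DIMF.pathEndpoints W) (DIMF.pathEndpoints Tstar) ∧
    Tendsto (fun l => klDiv (DIMF.endpoints (DIMF.dimf ε t π l)) (DIMF.pathEndpoints Tstar))
      atTop (𝓝 0) := by
  have := hT.isBetween.isProbabilityMeasure
  have hlim := DIMF.tendsto_klDiv_dimf hN hε ht ht0 ht1 hW hp₀ hp₁ hT hπ hstart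
  refine ⟨hlim, DIMF.isStaticSchrodingerBridge_pathEndpoints hε hW hp₀ hp₁ hT, ?_⟩
  -- Data processing: restricting to the endpoints cannot increase the divergence.
  refine tendsto_of_tendsto_of_tendsto_of_le_of_le tendsto_const_nhds hlim (fun _ => zero_le)
    fun l => ?_
  have := (DIMF.isIterate_dimf hε ht ht0 ht1 hW hp₀ hp₁ hT hπ hstart l).1.isProbabilityMeasure
  rw [← DIMF.endpoints_discretize ht0 ht1, DIMF.endpoints_eq]
  exact klDiv_map_le _ _ DIMF.measurable_ends
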